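/- **Setting.** Let $H=H^2(\mathbb R^4)$ be the completion of the real-valued Schwartz space $\mathcal S(\mathbb R^4)$ under the inner product $(f,g)_H=\int_{\mathbb R^4}\big((I-\Delta)^2f\big)\,g\,dx$. Let $\Theta$ be a separable real Banach space into which $H$ is continuously and injectively embedded with dense image, and let $\mathcal W$ be a Borel probability measure on $\Theta$ such that $(H,\Theta,\mathcal W)$ is an abstract Wiener space, i.e. $\mathbb E^{\mathcal W}[e^{iL}]=e^{-\|h_L\|_H^2/2}$ for all $L\in\Theta^*$, where $h_L\in H$ is determined by $(h,h_L)_H=L(h)$ for all $h\in H$. (This is the Gaussian free field on $\mathbb R^4$.) Let $\mathcal I:H\to L^2(\mathcal W)$ be the linear isometry extending $h_L\mapsto L$. A tempered distribution $\nu$ is in $H^{-2}(\mathbb R^4)$ if it is bounded for the norm of $H$; then $h_\nu\in H$ denotes the element with $(f,h_\nu)_H=\langle f,\nu\rangle$ for all $f\in\mathcal S(\mathbb R^4)$. For $x\in\mathbb R^4$, $\epsilon>0$ define tempered distributions by $$\langle f,\sigma^x_\epsilon\rangle=\frac1{2\pi^2\epsilon^3}\int_{|y-x|=\epsilon}f\,d\sigma,\qquad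 \langle f,d\sigma^x_\epsilon\rangle=\frac{d}{d\epsilon}\langle f,\sigma^x_\epsilon\rangle ,$$ where $d\sigma$ is surface area, and let $V^x_\epsilon=\big(\mathcal I(h_{\sigma^x_\epsilon}),\mathcal I(h_{d\sigma^x_\epsilon})\big)^\top$ (any measurable versions may be chosen). For $r>0$ let $$\mathbf A(r)=\begin{pmatrix}K_1'(r)&K_1(r)/r\\K_1''(r)&-K_2(r)/r\end{pmatrix},\quad \mathbf B(r)=\begin{pmatrix}I_1(r)/r&I_1'(r)\\I_2(r)/r&I_1''(r)\end{pmatrix},$$ $$\mathbf C(r)=\begin{pmatrix}I_1(r)/r&0\\I_2(r)&I_1(r)/r\end{pmatrix},\quad \mathbf D(r)=\begin{pmatrix}-K_2(r)&K_1(r)/r\\K_1(r)/r&0\end{pmatrix},$$ where $I_k,K_k$ are the modified Bessel functions of order $k$. **Lemma 2.1.** The distributions $\sigma^x_\epsilon,d\sigma^x_\epsilon$ belong to $H^{-2}(\mathbb R^4)$, $\{V^x_\epsilon:x\in\mathbb R^4,\epsilon>0\}$ is a centered Gaussian family, and: (1) For $x\in\mathbb R^4$ and $\epsilon_1\ge\epsilon_2>0$,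 $$\mathbb E^{\mathcal W}\big[V^x_{\epsilon_1}(V^x_{\epsilon_2})^\top\big]=-\frac1{4\pi^2}\,\mathbf A(\epsilon_1)\mathbf B^\top(\epsilon_2).$$ Moreover $\{V^x_\epsilon:\epsilon>0\}$ is a reversed Markov process: for $\epsilon_1\ge\epsilon_2>0$ and every Borel $A\subseteq\mathbb R^2$, almost surely $$\mathcal W\big(V^x_{\epsilon_2}\in A\,\big|\,\sigma\{V^x_\eta:\eta\ge\epsilon_1\}\big)=\mathcal W\big(V^x_{\epsilon_2}\in A\,\big|\,V^x_{\epsilon_1}\big).$$ (2) For $x\ne y$ in $\mathbb R^4$ and $\epsilon_1,\epsilon_2>0$ with $\epsilon_1>|x-y|+\epsilon_2$, $$\mathbb E^{\mathcal W}\big[V^x_{\epsilon_1}(V^y_{\epsilon_2})^\top\big]=-\frac1{2\pi^2}\,\mathbf A(\epsilon_1)\mathbf C(|x-y|)\mathbf B^\top(\epsilon_2).$$ (3) For $x\ne y$ in $\mathbb R^4$ and $\epsilon_1,\epsilon_2>0$ with $|x-y|>\epsilon_1+\epsilon_2$, $$\mathbb E^{\mathcal W}\big[V^x_{\epsilon_1}(V^y_{\epsilon_2})^\top\big]=-\frac1{2\pi^2}\,\mathbf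 B(\epsilon_1)\mathbf D(|x-y|)\mathbf B^\top(\epsilon_2).$$ -/

import Mathlib

open MeasureTheory ProbabilityTheory Filter Topology SchwartzMap
open scoped Laplacian LineDeriv

noncomputable section

namespace GFF4

/-- Four-dimensional Euclidean space. -/
abbrev E4 : Type := EuclideanSpace ℝ (Fin 4)

/-! ### Modified Bessel functions of integer order on the positive half-line -/

/-- The modified Bessel function of the first kind,
`I_k(r) = ∑ₘ (r/2)^(2m+k) / (m! (m+k)!)`. -/
def besselI (k : ℕ) (r : ℝ) : ℝ :=
  ∑' m : ℕ, (r / 2) ^ (2 * m + k) / ((m.factorial : ℝ) * ((m + k).factorial : ℝ))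

/-- The modified Bessel function of the second kind (Macdonald function),
`K_k(r) = ∫₀^∞ exp(-r cosh t) cosh(k t) dt`, for `r > 0`. -/
def besselK (k : ℕ) (r : ℝ) : ℝ :=
  ∫ t in Set.Ioi (0 : ℝ), Real.exp (-r * Real.cosh t) * Real.cosh (k * t)

/-- The matrix `A(r)`. -/
def matA (r : ℝ) : Matrix (Fin 2) (Fin 2) ℝ :=
  !![deriv (besselK 1) r, besselK 1 r / r;
     deriv (deriv (besselK 1)) r, -besselK 2 r / r]

/-- The matrix `B(r)`. -/
def matB (r : ℝ) : Matrix (Fin 2) (Fin 2) ℝ :=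
  !![besselI 1 r / r, deriv (besselI 1) r;
     besselI 2 r / r, deriv (deriv (besselI 1)) r]

/-- The matrix `C(r)`. -/
def matC (r : ℝ) : Matrix (Fin 2) (Fin 2) ℝ :=
  !![besselI 1 r / r, 0;
     besselI 2 r, besselI 1 r / r]

/-- The matrix `D(r)`. -/
def matD (r : ℝ) : Matrix (Fin 2) (Fin 2) ℝ :=
  !![-besselK 2 r, besselK 1 r / r;
     besselK 1 r / r, 0]

/-! ### The Sobolev space `H²(ℝ⁴)` -/

/-- The operator `I - Δ` on real-valued Schwartz functions. -/
def helmholtz (f : 𝓢(E4, ℝ)) : 𝓢(E4, ℝ) := f - Δ f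

/-- The inner product `∫ ((I - Δ)² f) g` on Schwartz functions. -/
def sobolevInner (f g : 𝓢(E4, ℝ)) : ℝ := ∫ x, helmholtz (helmholtz f) x * g x

lemma integrable_mul (f g : 𝓢(E4, ℝ)) : Integrable (fun x => f x * g x) :=
  (pairing (ContinuousLinearMap.mul ℝ ℝ) f g).integrable

lemma helmholtz_add (f g : 𝓢(E4, ℝ)) : helmholtz (f + g) = helmholtz f + helmholtz g := by
  have : Δ (f + g) = Δ f + Δ g := (LineDeriv.laplacianCLM ℝ E4 𝓢(E4, ℝ)).map_add f g
  rw [helmholtz, this, helmholtz, helmholtz]; abel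

lemma helmholtz_smul (c : ℝ) (f : 𝓢(E4, ℝ)) : helmholtz (c • f) = c • helmholtz f := by
  have : Δ (c • f) = c • Δ f := (LineDeriv.laplacianCLM ℝ E4 𝓢(E4, ℝ)).map_smul c f
  rw [helmholtz, this, helmholtz, smul_sub]

lemma integral_helmholtz (f g : 𝓢(E4, ℝ)) :
    ∫ x, helmholtz f x * g x = ∫ x, f x * helmholtz g x := by
  have h := integral_mul_laplacian_right_eq_left (μ := volume) f g
  simp only [helmholtz, _root_.sub_apply, sub_mul, mul_sub]
  rw [integral_sub (integrable_mul f g) (integrable_mul (Δ f) g),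
    integral_sub (integrable_mul f g) (integrable_mul f (Δ g)), h]

lemma sobolevInner_eq (f g : 𝓢(E4, ℝ)) :
    sobolevInner f g = ∫ x, helmholtz f x * helmholtz g x :=
  integral_helmholtz (helmholtz f) g

lemma eq_zero_of_integral_sq (f : 𝓢(E4, ℝ)) (h : ∫ x, f x * f x = 0) : f = 0 := by
  have h1 := (integral_eq_zero_iff_of_nonneg (fun x => mul_self_nonneg (f x))
    (integrable_mul f f)).1 h
  have h2 := (Continuous.ae_eq_iff_eq volume (f.continuous.mul f.continuous)
    continuous_const).1 h1
  ext x
  exact mul_self_eq_zero.1 (congrFun h2 x)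

lemma integral_mul_laplacian_nonpos (f : 𝓢(E4, ℝ)) : ∫ x, f x * Δ f x ≤ 0 := by
  simp_rw [laplacian_eq_sum (stdOrthonormalBasis ℝ E4), _root_.sum_apply, Finset.mul_sum]
  rw [MeasureTheory.integral_finsetSum _ (fun _ _ => integrable_mul _ _)]
  refine Finset.sum_nonpos fun i _ => ?_
  rw [integral_mul_lineDerivOp_right_eq_neg_left]
  exact neg_nonpos.2 (integral_nonneg fun x => mul_self_nonneg _)

lemma eq_zero_of_helmholtz (f : 𝓢(E4, ℝ)) (h : helmholtz f = 0) : f = 0 := by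
  apply eq_zero_of_integral_sq
  have h1 : ∫ x, f x * helmholtz f x = 0 := by simp [h]
  have h2 := integral_mul_laplacian_nonpos f
  simp only [helmholtz, _root_.sub_apply, mul_sub] at h1
  rw [integral_sub (integrable_mul f f) (integrable_mul f (Δ f))] at h1
  exact le_antisymm (by linarith) (integral_nonneg fun x => mul_self_nonneg _)

/-- The real-valued Schwartz functions, to be equipped with the inner product `sobolevInner`
(and not with the usual Schwartz topology). -/
def PreH2 : Type := 𝓢(E4, ℝ)

instance : AddCommGroup PreH2 := inferInstanceAs (AddCommGroup 𝓢(E4, ℝ))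

instance : Module ℝ PreH2 := inferInstanceAs (Module ℝ 𝓢(E4, ℝ))

/-- The identification of a Schwartz function with an element of `PreH2`. -/
def toPre : 𝓢(E4, ℝ) ≃ₗ[ℝ] PreH2 := LinearEquiv.refl ℝ 𝓢(E4, ℝ)

/-- `sobolevInner` is an inner product. -/
@[reducible] def preH2Core : InnerProductSpace.Core ℝ PreH2 where
  inner f g := sobolevInner (toPre.symm f) (toPre.symm g)
  conj_inner_symm f g := by
    change sobolevInner (toPre.symm g) (toPre.symm f) = sobolevInner (toPre.symm f) (toPre.symm g)
    rw [sobolevInner_eq, sobolevInner_eq]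
    exact integral_congr_ae (.of_forall fun x => mul_comm _ _)
  re_inner_nonneg f := by
    change 0 ≤ sobolevInner (toPre.symm f) (toPre.symm f)
    rw [sobolevInner_eq]
    exact integral_nonneg fun x => mul_self_nonneg _
  add_left f g h := by
    unfold sobolevInner
    rw [map_add, helmholtz_add, helmholtz_add,
      ← integral_add (integrable_mul _ _) (integrable_mul _ _)]
    exact integral_congr_ae (.of_forall fun x => add_mul _ _ _)
  smul_left f g c := by
    unfold sobolevInner
    rw [map_smul, helmholtz_smul, helmholtz_smul, ← integral_const_mul]
    exact integral_congr_ae (.of_forall fun x => mul_assoc _ _ _)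
  definite f h := by
    rw [sobolevInner_eq] at h
    exact toPre.symm.map_eq_zero_iff.1 (eq_zero_of_helmholtz _ (eq_zero_of_integral_sq _ h))

instance : NormedAddCommGroup PreH2 := preH2Core.toNormedAddCommGroup

instance : InnerProductSpace ℝ PreH2 := InnerProductSpace.ofCore preH2Core.toCore

/-- The real Hilbert space `H = H²(ℝ⁴)`: the completion of the real-valued Schwartz functions
under `(f, g) ↦ ∫ ((I - Δ)² f) g`. -/
abbrev H2 : Type := UniformSpace.Completion PreH2

/-- The dense embedding of the Schwartz functions into `H²(ℝ⁴)`. -/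
def toH2 : 𝓢(E4, ℝ) →ₗ[ℝ] H2 where
  toFun f := (toPre f : H2)
  map_add' f g := by rw [map_add, UniformSpace.Completion.coe_add]
  map_smul' c f := by rw [map_smul, UniformSpace.Completion.coe_smul, RingHom.id_apply]

lemma inner_toH2 (f g : 𝓢(E4, ℝ)) :
    inner ℝ (toH2 f) (toH2 g) = ∫ x, helmholtz (helmholtz f) x * g x :=
  UniformSpace.Completion.inner_coe (𝕜 := ℝ) (toPre f) (toPre g)

/-! ### The dual space `H⁻²(ℝ⁴)` and the representers `h_ν` -/

/-- A (real) tempered distribution `ν` belongs to `H⁻²(ℝ⁴)`, the dual of `H²(ℝ⁴)`, if it is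
bounded with respect to the norm of `H²(ℝ⁴)`. -/
def InHNegTwo (ν : 𝓢(E4, ℝ) →L[ℝ] ℝ) : Prop :=
  ∃ C : ℝ, ∀ f : 𝓢(E4, ℝ), |ν f| ≤ C * ‖toH2 f‖

/-- For `ν ∈ H⁻²(ℝ⁴)`, the element `h_ν = (I - Δ)⁻² ν` of `H²(ℝ⁴)`: the unique one with
`⟨h, ν⟩ = (h, h_ν)_H` for all `h`, where `⟨·, ν⟩` is extended from the Schwartz functions to
`H²(ℝ⁴)` by continuity. (The value is `0` if `ν ∉ H⁻²(ℝ⁴)`.) -/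
def representer (ν : 𝓢(E4, ℝ) →L[ℝ] ℝ) : H2 :=
  (InnerProductSpace.toDual ℝ H2).symm ((ν : 𝓢(E4, ℝ) →ₗ[ℝ] ℝ).extendOfNorm toH2)

lemma denseRange_toH2 : DenseRange toH2 :=
  (UniformSpace.Completion.denseRange_coe (α := PreH2)).comp toPre.surjective.denseRange
    (UniformSpace.Completion.continuous_coe PreH2)

lemma inner_representer {ν : 𝓢(E4, ℝ) →L[ℝ] ℝ} (hν : InHNegTwo ν) (f : 𝓢(E4, ℝ)) :
    inner ℝ (toH2 f) (representer ν) = ν f := by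
  rw [real_inner_comm, representer, InnerProductSpace.toDual_symm_apply]
  exact LinearMap.extendOfNorm_eq (f := (ν : 𝓢(E4, ℝ) →ₗ[ℝ] ℝ)) denseRange_toH2 hν f

/-! ### The Gaussian free field and its Paley-Wiener integrals -/

section Wiener

variable {Θ : Type*} [NormedAddCommGroup Θ] [NormedSpace ℝ Θ]

/-- For `L ∈ Θ*`, the unique element `h_L` of `H` with `(h, h_L)_H = L h` for all `h ∈ H`,
where `ι : H → Θ` is the embedding. -/
def dualRepr (ι : H2 →L[ℝ] Θ) : StrongDual ℝ Θ →ₗ[ℝ] H2 where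
  toFun L := (InnerProductSpace.toDual ℝ H2).symm (L.comp ι)
  map_add' L M := by rw [ContinuousLinearMap.add_comp, map_add]
  map_smul' c L := by rw [ContinuousLinearMap.smul_comp]; simp

/-- `(H, Θ, W)` is an abstract Wiener space, with `H = H²(ℝ⁴)` embedded by `ι` into the separable
Banach space `Θ`; equivalently `(Θ, W)` is a realization of the Gaussian free field on `ℝ⁴`. -/
structure IsAbstractWienerSpace [MeasurableSpace Θ] (ι : H2 →L[ℝ] Θ) (W : Measure Θ) : Prop where
  isProbabilityMeasure : IsProbabilityMeasure W
  injective : Function.Injective ι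
  denseRange : DenseRange ι
  charFun_eq : ∀ L : StrongDual ℝ Θ,
    ∫ θ, Complex.exp (Complex.I * (L θ : ℂ)) ∂W = Complex.exp (-(‖dualRepr ι L‖ : ℂ) ^ 2 / 2)

variable [MeasurableSpace Θ] [BorelSpace Θ]

/-- The Paley-Wiener map `𝓘 : H → L²(W)`, the continuous extension of `h_L ↦ L`, `L ∈ Θ*`.
For an abstract Wiener space it exists and is a linear isometry, see `paleyWiener_dualRepr` and
`norm_paleyWiener`. -/
def paleyWiener (ι : H2 →L[ℝ] Θ) (W : Measure Θ) : H2 →L[ℝ] Lp ℝ 2 W :=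
  (StrongDual.toLp (𝕜 := ℝ) W 2 : StrongDual ℝ Θ →L[ℝ] Lp ℝ 2 W).toLinearMap.extendOfNorm (dualRepr ι)

lemma denseRange_dualRepr {ι : H2 →L[ℝ] Θ} (hι : Function.Injective ι) :
    DenseRange (dualRepr ι) := by
  have h : (LinearMap.range (dualRepr ι)).topologicalClosure = ⊤ := by
    rw [Submodule.topologicalClosure_eq_top_iff, Submodule.eq_bot_iff]
    intro v hv
    apply hι
    rw [map_zero]
    refine SeparatingDual.eq_zero_of_forall_dual_eq_zero (R := ℝ) fun L => ?_
    have := (Submodule.mem_orthogonal _ v).1 hv _ (LinearMap.mem_range_self (dualRepr ι) L)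
    simpa [dualRepr] using this
  intro v
  have : v ∈ (LinearMap.range (dualRepr ι)).topologicalClosure := by simp [h]
  rw [← SetLike.mem_coe, Submodule.topologicalClosure_coe, LinearMap.coe_range] at this
  exact this

lemma norm_toLp_eq [CompleteSpace Θ] [TopologicalSpace.SeparableSpace Θ] {ι : H2 →L[ℝ] Θ}
    {W : Measure Θ} (hW : IsAbstractWienerSpace ι W) (L : StrongDual ℝ Θ) :
    MemLp id 2 W ∧ ‖StrongDual.toLp W 2 L‖ = ‖dualRepr ι L‖ := by
  have := hW.isProbabilityMeasure
  have : SecondCountableTopology Θ := UniformSpace.secondCountable_of_separable Θ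
  have hmap (L : StrongDual ℝ Θ) :
      W.map L = gaussianReal 0 (‖dualRepr ι L‖₊ ^ 2) := by
    refine Measure.ext_of_charFun (funext fun u => ?_)
    have h1 := hW.charFun_eq (u • L)
    rw [charFun_map_eq_charFunDual_smul, charFunDual_apply, charFun_gaussianReal]
    simp_rw [mul_comm _ Complex.I]
    rw [h1, map_smul, norm_smul]
    congr 1
    push_cast
    rw [mul_pow, ← Complex.ofReal_pow ‖u‖, Real.norm_eq_abs, sq_abs]
    push_cast
    ring
  have : IsGaussian W := isGaussian_of_map_eq_gaussianReal fun L => ⟨_, _, hmap L⟩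
  have hmem : MemLp id 2 W := IsGaussian.memLp_two_id
  refine ⟨hmem, ?_⟩
  rw [← sq_eq_sq₀ (norm_nonneg _) (norm_nonneg _), ← real_inner_self_eq_norm_sq]
  change uncenteredCovarianceBilinDual W L L = _
  rw [uncenteredCovarianceBilinDual_apply hmem]
  have hv := variance_of_integral_eq_zero (μ := W.map L) (X := id) aemeasurable_id
    (by rw [hmap L]; simp)
  rw [integral_map (by fun_prop) (by fun_prop), hmap L, variance_id_gaussianReal] at hv
  simpa [sq] using hv.symm

lemma paleyWiener_dualRepr [CompleteSpace Θ] [TopologicalSpace.SeparableSpace Θ]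
    {ι : H2 →L[ℝ] Θ} {W : Measure Θ} (hW : IsAbstractWienerSpace ι W) (L : StrongDual ℝ Θ) :
    paleyWiener ι W (dualRepr ι L) =ᵐ[W] L := by
  have h : paleyWiener ι W (dualRepr ι L) = StrongDual.toLp W 2 L :=
    LinearMap.extendOfNorm_eq (denseRange_dualRepr hW.injective)
      ⟨1, fun M => by simpa using (norm_toLp_eq hW M).2.le⟩ L
  rw [h, StrongDual.toLp_apply (norm_toLp_eq hW L).1]
  exact MemLp.coeFn_toLp _

lemma norm_paleyWiener [CompleteSpace Θ] [TopologicalSpace.SeparableSpace Θ]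
    {ι : H2 →L[ℝ] Θ} {W : Measure Θ} (hW : IsAbstractWienerSpace ι W) (h : H2) :
    ‖paleyWiener ι W h‖ = ‖h‖ := by
  refine (denseRange_dualRepr hW.injective).induction_on h
    (isClosed_eq (by fun_prop) (by fun_prop)) fun L => ?_
  rw [← (norm_toLp_eq hW L).2]
  congr 1
  exact LinearMap.extendOfNorm_eq (denseRange_dualRepr hW.injective)
    ⟨1, fun M => by simpa using (norm_toLp_eq hW M).2.le⟩ L

end Wiener

/-! ### Spherical averages and their radial derivatives -/

/-- The surface area measure of the sphere with centre `x` and radius `r > 0` in `ℝ⁴`: the image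
of the surface area measure of the unit sphere under `ω ↦ x + r ω`, multiplied by `r³`. -/
def surfaceMeasure (x : E4) (r : ℝ) : Measure E4 :=
  ENNReal.ofReal (r ^ 3) •
    ((volume : Measure E4).toSphere.map (fun ω : Metric.sphere (0 : E4) 1 => x + r • (ω : E4)))

/-- The average of `f` over the sphere with centre `x` and radius `r > 0`. -/
def sphereMean (x : E4) (r : ℝ) (f : E4 → ℝ) : ℝ :=
  1 / (2 * Real.pi ^ 2 * r ^ 3) * ∫ y, f y ∂(surfaceMeasure x r)

lemma sphereMean_eq (x : E4) {r : ℝ} (hr : 0 < r) (f : 𝓢(E4, ℝ)) :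
    sphereMean x r f = 1 / (2 * Real.pi ^ 2) *
      ∫ ω : Metric.sphere (0 : E4) 1, f (x + r • (ω : E4)) ∂(volume : Measure E4).toSphere := by
  have hm : Continuous (fun ω : Metric.sphere (0 : E4) 1 => x + r • (ω : E4)) := by fun_prop
  rw [sphereMean, surfaceMeasure, integral_smul_measure,
    integral_map hm.aemeasurable f.continuous.aestronglyMeasurable,
    ENNReal.toReal_ofReal (by positivity), smul_eq_mul]
  field_simp

lemma integrable_sphere {F : Type*} [NormedAddCommGroup F]
    {g : Metric.sphere (0 : E4) 1 → F} (hg : Continuous g) :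
    Integrable g (volume : Measure E4).toSphere :=
  hg.integrable_of_hasCompactSupport (HasCompactSupport.of_compactSpace g)

lemma hasDerivAt_sphereMean (x : E4) {r : ℝ} (hr : 0 < r) (f : 𝓢(E4, ℝ)) :
    HasDerivAt (fun s => sphereMean x s f) (1 / (2 * Real.pi ^ 2) *
      ∫ ω : Metric.sphere (0 : E4) 1, fderiv ℝ f (x + r • (ω : E4)) (ω : E4)
        ∂(volume : Measure E4).toSphere) r := by
  have hF : Continuous (fderiv ℝ f) := (f.smooth 1).continuous_fderiv (by norm_num)
  have key := (hasDerivAt_integral_of_dominated_loc_of_deriv_le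
    (μ := (volume : Measure E4).toSphere) (x₀ := r) (s := Set.univ)
    (F := fun s (ω : Metric.sphere (0 : E4) 1) => f (x + s • (ω : E4)))
    (F' := fun s (ω : Metric.sphere (0 : E4) 1) => fderiv ℝ f (x + s • (ω : E4)) (ω : E4))
    (bound := fun _ => SchwartzMap.seminorm ℝ 0 1 f) Filter.univ_mem
    (.of_forall fun s => (f.continuous.comp (by fun_prop)).aestronglyMeasurable)
    (integrable_sphere (f.continuous.comp (by fun_prop)))
    (integrable_sphere (Continuous.clm_apply (hF.comp (by fun_prop)) (by fun_prop))).1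
    (.of_forall fun ω s _ => by
      have h1 := norm_iteratedFDeriv_le_seminorm ℝ f 1 (x + s • (ω : E4))
      rw [norm_iteratedFDeriv_one] at h1
      refine ((fderiv ℝ f (x + s • (ω : E4))).le_opNorm _).trans ?_
      simpa using h1)
    (integrable_const _)
    (.of_forall fun ω s _ => by
      have h1 : HasDerivAt (fun s : ℝ => x + s • (ω : E4)) (ω : E4) s := by
        simpa using ((hasDerivAt_id s).smul_const (ω : E4)).const_add x
      exact (f.differentiableAt.hasFDerivAt).comp_hasDerivAt s h1)).2
  refine (key.const_mul (1 / (2 * Real.pi ^ 2))).congr_of_eventuallyEq ?_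
  filter_upwards [lt_mem_nhds hr] with s hs
  exact sphereMean_eq x hs f

/-- The tempered distribution `σ_ε^x`: the average over the sphere with centre `x` and
radius `ε > 0`. -/
def sphereAvg (x : E4) (ε : Set.Ioi (0 : ℝ)) : 𝓢(E4, ℝ) →L[ℝ] ℝ :=
  mkCLMtoNormedSpace (fun f => sphereMean x ε f)
    (fun f g => by
      simp only [sphereMean_eq x ε.2, _root_.add_apply]
      rw [integral_add (f := fun ω : Metric.sphere (0 : E4) 1 => f (x + (ε : ℝ) • (ω : E4)))
        (g := fun ω : Metric.sphere (0 : E4) 1 => g (x + (ε : ℝ) • (ω : E4)))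
        (integrable_sphere (f.continuous.comp (by fun_prop)))
        (integrable_sphere (g.continuous.comp (by fun_prop))), mul_add])
    (fun c f => by
      simp only [sphereMean_eq x ε.2, _root_.smul_apply, RingHom.id_apply, smul_eq_mul]
      rw [integral_const_mul]; ring)
    ⟨{(0, 0)}, 1 / (2 * Real.pi ^ 2) * (volume : Measure E4).toSphere.real Set.univ,
      by positivity, fun f => by
        simp only [sphereMean_eq x ε.2, norm_mul, Finset.sup_singleton]
        rw [Real.norm_of_nonneg (by positivity), mul_assoc]
        refine mul_le_mul_of_nonneg_left ?_ (by positivity)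
        rw [mul_comm]
        exact norm_integral_le_of_norm_le_const (.of_forall fun ω => norm_le_seminorm ℝ f _)⟩

/-- The tempered distribution `dσ_ε^x`: the derivative, with respect to the radius, of the average
over the sphere with centre `x` and radius `ε > 0`. -/
def dSphereAvg (x : E4) (ε : Set.Ioi (0 : ℝ)) : 𝓢(E4, ℝ) →L[ℝ] ℝ :=
  mkCLMtoNormedSpace (fun f => deriv (fun r : ℝ => sphereMean x r f) ε)
    (fun f g => by
      have h : (fun r : ℝ => sphereMean x r (f + g : 𝓢(E4, ℝ)))
          =ᶠ[𝓝 (ε : ℝ)] fun r => sphereMean x r f + sphereMean x r g := by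
        filter_upwards [lt_mem_nhds ε.2] with r hr
        exact (sphereAvg x ⟨r, hr⟩).map_add f g
      rw [h.deriv_eq]
      exact ((hasDerivAt_sphereMean x ε.2 f).add (hasDerivAt_sphereMean x ε.2 g)).deriv.trans
        (by rw [(hasDerivAt_sphereMean x ε.2 f).deriv, (hasDerivAt_sphereMean x ε.2 g).deriv]))
    (fun c f => by
      have h : (fun r : ℝ => sphereMean x r (c • f : 𝓢(E4, ℝ)))
          =ᶠ[𝓝 (ε : ℝ)] fun r => c * sphereMean x r f := by
        filter_upwards [lt_mem_nhds ε.2] with r hr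
        exact (sphereAvg x ⟨r, hr⟩).map_smul c f
      rw [h.deriv_eq, ((hasDerivAt_sphereMean x ε.2 f).const_mul c).deriv,
        (hasDerivAt_sphereMean x ε.2 f).deriv]
      simp)
    ⟨{(0, 1)}, 1 / (2 * Real.pi ^ 2) * (volume : Measure E4).toSphere.real Set.univ,
      by positivity, fun f => by
        simp only [(hasDerivAt_sphereMean x ε.2 f).deriv, norm_mul, Finset.sup_singleton]
        rw [Real.norm_of_nonneg (by positivity), mul_assoc]
        refine mul_le_mul_of_nonneg_left ?_ (by positivity)
        rw [mul_comm]
        refine norm_integral_le_of_norm_le_const (.of_forall fun ω => ?_)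
        have h1 := norm_iteratedFDeriv_le_seminorm ℝ f 1 (x + (ε : ℝ) • (ω : E4))
        rw [norm_iteratedFDeriv_one] at h1
        refine ((fderiv ℝ f (x + (ε : ℝ) • (ω : E4))).le_opNorm _).trans ?_
        simpa using h1⟩

/-! ### The vector `V_ε^x` -/

section Field

variable {Θ : Type*} [NormedAddCommGroup Θ] [NormedSpace ℝ Θ] [MeasurableSpace Θ] [BorelSpace Θ]

/-- The random vector `V_ε^x = (𝓘(h_{σ_ε^x}), 𝓘(h_{dσ_ε^x}))ᵀ`. -/
def sphereVec (ι : H2 →L[ℝ] Θ) (W : Measure Θ) (x : E4) (ε : Set.Ioi (0 : ℝ)) (θ : Θ) :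
    Fin 2 → ℝ :=
  ![paleyWiener ι W (representer (sphereAvg x ε)) θ,
    paleyWiener ι W (representer (dSphereAvg x ε)) θ]

/-- The matrix `𝔼[X Yᵀ]`. -/
def crossMoment (W : Measure Θ) (X Y : Θ → Fin 2 → ℝ) : Matrix (Fin 2) (Fin 2) ℝ :=
  Matrix.of fun i j => ∫ θ, X θ i * Y θ j ∂W

end Field

end GFF4

end

/-!
Means over spheres are computed in the Hilbert space `H²(ℝ⁴)` and then transported to the
Gaussian space by the Paley-Wiener isometry, so that the covariances of the field are inner products
of the representers of `σ_ε^x` and `dσ_ε^x`.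

*Boundedness.* The flux `r³ M'(r)` of the spherical mean `M(r)` of `f` is the integral over a ball of
`Δ f` (`pow_mul_dSphAvg`). Since `‖f‖_{L²}` and `‖Δ f‖_{L²}` are bounded by the norm of `H²`, so are
the mean and its radial derivative, locally uniformly in `r` (`exists_bound_sphereAvg`). Hence
`r ↦ (h, h_{σ_r})` has the derivative `(h, h_{dσ_r})` for every `h` in `H²`
(`hasDerivAt_inner_sphRepr`), and only the inner products of the `h_{σ_r}` have to be found.

*The potential.* The function `h_{σ_b^y}` is the radial solution of `(1 - Δ)² U = σ_b^y`. Inside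
the sphere it is a combination of `I_1(r)/r` and `I_2(r)`, outside of `K_1(r)/r` and `K_2(r)`; that
the explicit `potential` is a weak solution follows from Green's identity and the Wronskian
(`integral_potential_mul`). Instead of identifying it with an element of the completion, the equality
of `(h_{σ_b^y}, h_{σ_a^x})` with the mean of the potential over the sphere of radius `a` about `x`
is obtained by testing against radial functions in the variable `a` (`inner_sphRepr_sphRepr`).

*Covariances.* If the spheres are nested or disjoint, the potential of one is a smooth solution of
`(1 - Δ)² U = 0` near the ball bounded by the other, and the mean value property
`M(r) = 2 U(x) I_1(r)/r - ((1 - Δ) U)(x) I_2(r)` (`sphAvg_eq_of_helmholtz_eq_zero`) evaluates the mean.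
The result is bilinear in functions of the two radii, and differentiating in both of them fills the
matrices (`gramMat_of_nested`, `gramMat_of_disjoint`). The concentric case is the nested one with
distance zero, where the middle matrix is `I_1(r)/r = 1/2` times the identity, and a limit if
the radii agree (`gramMat_self`).

*Markov property.* The Paley-Wiener integrals form a centered Gaussian process
(`isGaussianProcess_paleyWiener`). By the factorized form of the concentric covariance and the
invertibility of `B`, the innovation `V_a - B(a) B(b)⁻¹ V_b`, `a ≤ b`, is uncorrelated with, hence
independent of, all `V_c` with `c ≥ b` (`indep_innovation`). Both conditional laws of
`V_a` are therefore the same function of `V_b` (`condExp_indicator_add_mulVec`).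
-/


noncomputable section

namespace GFF4

/-! ### Modified Bessel functions -/

/-- The entire function `e_j(s) = ∑ₘ (s/4)^m / (m! (m+j)!)`, so that `I_j(r) = (r/2)^j e_j(r²)`.
In the variable `s = r²` the functions `I_1(r)/r` and `I_2(r)` are smooth across the origin. -/
def besselE (j : ℕ) (s : ℝ) : ℝ :=
  ∑' m : ℕ, (s / 4) ^ m / ((m.factorial : ℝ) * ((m + j).factorial : ℝ))

lemma summable_besselE (j : ℕ) (s : ℝ) :
    Summable fun m : ℕ => (s / 4) ^ m / ((m.factorial : ℝ) * ((m + j).factorial : ℝ)) := by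
  refine Summable.of_norm_bounded (Real.summable_pow_div_factorial |s / 4|) fun m => ?_
  rw [norm_div, norm_pow, Real.norm_eq_abs, Real.norm_of_nonneg (by positivity)]
  have h1 : (1 : ℝ) ≤ ((m + j).factorial : ℝ) := by exact_mod_cast (m + j).factorial_pos
  gcongr
  exact le_mul_of_one_le_right (by positivity) h1

lemma besselI_eq (k : ℕ) (r : ℝ) : besselI k r = (r / 2) ^ k * besselE k (r ^ 2) := by
  rw [besselI, besselE, ← tsum_mul_left]
  congr 1
  ext m
  rw [pow_add, pow_mul, div_pow r 2 2]
  norm_num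
  ring

lemma besselE_zero (j : ℕ) : besselE j 0 = 1 / (j.factorial : ℝ) := by
  rw [besselE, tsum_eq_single 0 (fun m hm => by simp [hm])]
  simp

lemma besselE_pos (j : ℕ) {s : ℝ} (hs : 0 ≤ s) : 0 < besselE j s :=
  (summable_besselE j s).tsum_pos (fun m => by positivity) 0 (by positivity)

lemma hasDerivAt_besselE (j : ℕ) (s : ℝ) : HasDerivAt (besselE j) (besselE (j + 1) s / 4) s := by
  let R : ℝ := |s| + 1
  have hR : 0 ≤ R := by positivity
  have hs : s ∈ Metric.ball (0 : ℝ) R := by simp [R]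
  let u : ℕ → ℝ := fun m => (m : ℝ) / 4 * (R / 4) ^ (m - 1) / (m.factorial : ℝ)
  have hu : Summable u := by
    rw [← summable_nat_add_iff 1]
    refine ((Real.summable_pow_div_factorial (R / 4)).mul_left (1 / 4)).congr fun m => ?_
    simp only [u, Nat.factorial_succ, Nat.add_sub_cancel]
    push_cast
    field_simp
  have key := hasDerivAt_tsum_of_isPreconnected
    (g := fun m (y : ℝ) => (y / 4) ^ m / ((m.factorial : ℝ) * ((m + j).factorial : ℝ)))
    (g' := fun m (y : ℝ) =>
      ((m : ℝ) / 4 * (y / 4) ^ (m - 1)) / ((m.factorial : ℝ) * ((m + j).factorial : ℝ)))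
    hu Metric.isOpen_ball (convex_ball (0 : ℝ) R).isPreconnected
    (fun m y _ => by
      have h := ((hasDerivAt_id y).div_const 4).pow m
      refine (h.div_const ((m.factorial : ℝ) * ((m + j).factorial : ℝ))).congr_deriv ?_
      simp only [id]
      ring)
    (fun m y hy => by
      have hy' : |y| ≤ R := by
        have := Metric.mem_ball.1 hy
        rw [Real.dist_eq, sub_zero] at this
        exact this.le
      have h1 : (1 : ℝ) ≤ ((m + j).factorial : ℝ) := by exact_mod_cast (m + j).factorial_pos
      rw [norm_div, norm_mul, norm_pow, norm_div y,
        Real.norm_of_nonneg (by positivity : (0 : ℝ) ≤ (m : ℝ) / 4), Real.norm_eq_abs y,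
        Real.norm_of_nonneg (by positivity : (0 : ℝ) ≤ 4),
        Real.norm_of_nonneg (by positivity : (0 : ℝ) ≤ (m.factorial : ℝ) * _)]
      simp only [u]
      gcongr
      exact le_mul_of_one_le_right (by positivity) h1)
    hs (summable_besselE j s) hs
  refine key.congr_deriv ?_
  have hsum : Summable fun m : ℕ =>
      ((m : ℝ) / 4 * (s / 4) ^ (m - 1)) / ((m.factorial : ℝ) * ((m + j).factorial : ℝ)) := by
    rw [← summable_nat_add_iff 1]
    refine ((summable_besselE (j + 1) s).mul_left (1 / 4)).congr fun m => ?_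
    rw [Nat.add_sub_cancel, Nat.factorial_succ m, show m + 1 + j = m + (j + 1) by ring]
    push_cast
    field_simp
  rw [hsum.tsum_eq_zero_add, besselE]
  simp only [CharP.cast_eq_zero, zero_div, zero_mul, zero_add]
  rw [← tsum_div_const]
  congr 1
  ext m
  rw [Nat.add_sub_cancel, Nat.factorial_succ m, show m + 1 + j = m + (j + 1) by ring]
  push_cast
  field_simp

lemma contDiff_besselE (j : ℕ) {n : ℕ∞} : ContDiff ℝ n (besselE j) := by
  suffices h : ∀ (n : ℕ) (j : ℕ), ContDiff ℝ n (besselE j) by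
    have h2 : ContDiff ℝ (⊤ : ℕ∞) (besselE j) := contDiff_infty.2 fun n => h n j
    exact h2.of_le (by exact_mod_cast le_top)
  intro n
  induction n with
  | zero =>
    intro j
    exact contDiff_zero.2 (continuous_iff_continuousAt.2 fun s =>
      (hasDerivAt_besselE j s).continuousAt)
  | succ n ih =>
    intro j
    push_cast
    rw [contDiff_succ_iff_deriv]
    refine ⟨fun s => (hasDerivAt_besselE j s).differentiableAt, by simp, ?_⟩
    rw [show deriv (besselE j) = fun s => besselE (j + 1) s / 4 from
      funext fun s => (hasDerivAt_besselE j s).deriv]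
    exact (ih (j + 1)).div_const 4

/-- The recurrence `I_j - I_{j+2} = 2(j+1) I_{j+1} / r` in terms of the entire functions `e_j`. -/
lemma besselE_recurrence (j : ℕ) (s : ℝ) :
    besselE j s = s / 4 * besselE (j + 2) s + (j + 1) * besselE (j + 1) s := by
  rw [besselE, (summable_besselE j s).tsum_eq_zero_add, besselE,
    besselE, (summable_besselE (j + 1) s).tsum_eq_zero_add, mul_add, ← tsum_mul_left,
    ← tsum_mul_left, add_left_comm, ← Summable.tsum_add]
  · congr 1
    · simp only [pow_zero, zero_add, Nat.factorial_succ, Nat.factorial_zero]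
      push_cast
      field_simp
    · congr 1
      ext m
      rw [show m + 1 + j = m + j + 1 by ring, show m + 1 + (j + 1) = m + j + 1 + 1 by ring,
        show m + (j + 2) = m + j + 1 + 1 by ring, Nat.factorial_succ (m + j + 1),
        Nat.factorial_succ m]
      push_cast
      field_simp
      ring
  · exact (summable_besselE (j + 2) s).mul_left _
  · exact ((summable_nat_add_iff 1).2 (summable_besselE (j + 1) s)).mul_left _

/-! ### The integrals defining `K_k` -/

lemma exp_neg_mul_cosh_le (n : ℕ) {δ t : ℝ} (hδ : 0 < δ) (ht : 0 ≤ t) :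
    Real.exp (-δ * Real.cosh t) * Real.cosh (n * t) ≤
      ((n + 1).factorial * (2 / δ) ^ (n + 1)) * Real.exp (-t) := by
  have hx : 0 < δ * Real.exp t / 2 := by positivity
  have h1 := Real.pow_div_factorial_le_exp _ hx.le (n + 1)
  have h2 : δ * Real.exp t / 2 ≤ δ * Real.cosh t := by
    rw [Real.cosh_eq, mul_div_assoc]
    gcongr
    linarith [Real.exp_pos (-t)]
  have h3 : Real.exp (-δ * Real.cosh t) ≤
      ((n + 1).factorial * (2 / δ) ^ (n + 1)) * Real.exp (-((n + 1 : ℕ) * t)) := by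
    rw [neg_mul, Real.exp_neg]
    have h4 : (δ * Real.exp t / 2) ^ (n + 1) / (n + 1).factorial ≤ Real.exp (δ * Real.cosh t) :=
      h1.trans (Real.exp_le_exp.2 h2)
    refine (inv_anti₀ (by positivity) h4).trans (le_of_eq ?_)
    rw [Real.exp_neg, Real.exp_nat_mul, inv_div, div_eq_mul_inv, mul_assoc, ← inv_pow, ← inv_pow,
      ← mul_pow]
    congr 2
    field_simp
  have h5 : Real.cosh (n * t) ≤ Real.exp (n * t) := by
    rw [Real.cosh_eq]
    have : Real.exp (-(n * t)) ≤ Real.exp (n * t) := Real.exp_le_exp.2 (by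
      have : 0 ≤ n * t := by positivity
      linarith)
    linarith
  calc _ ≤ ((n + 1).factorial * (2 / δ) ^ (n + 1)) * Real.exp (-((n + 1 : ℕ) * t)) *
        Real.exp (n * t) := by gcongr
    _ = _ := by
      rw [mul_assoc _ (Real.exp _) (Real.exp _), ← Real.exp_add]
      congr 2
      push_cast
      ring

lemma integrableOn_besselK (n : ℕ) {r : ℝ} (hr : 0 < r) :
    IntegrableOn (fun t => Real.exp (-r * Real.cosh t) * Real.cosh (n * t)) (Set.Ioi 0) := by
  refine Integrable.mono' (((integrableOn_exp_neg_Ioi 0)).const_mul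
    ((n + 1).factorial * (2 / r) ^ (n + 1))) (by fun_prop) ?_
  filter_upwards [ae_restrict_mem measurableSet_Ioi] with t ht
  rw [Real.norm_of_nonneg (by positivity)]
  exact exp_neg_mul_cosh_le n hr (le_of_lt ht)

lemma cosh_mul_cosh_succ (n : ℕ) (t : ℝ) : Real.cosh t * Real.cosh ((n + 1 : ℕ) * t) =
    (Real.cosh ((n + 2 : ℕ) * t) + Real.cosh (n * t)) / 2 := by
  have h1 : ((n + 2 : ℕ) : ℝ) * t = (n + 1 : ℕ) * t + t := by push_cast; ring
  have h2 : (n : ℝ) * t = (n + 1 : ℕ) * t - t := by push_cast; ring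
  rw [h1, h2, Real.cosh_add, Real.cosh_sub]
  ring

lemma sinh_mul_sinh_succ (n : ℕ) (t : ℝ) : Real.sinh t * Real.sinh ((n + 1 : ℕ) * t) =
    (Real.cosh ((n + 2 : ℕ) * t) - Real.cosh (n * t)) / 2 := by
  have h1 : ((n + 2 : ℕ) : ℝ) * t = (n + 1 : ℕ) * t + t := by push_cast; ring
  have h2 : (n : ℝ) * t = (n + 1 : ℕ) * t - t := by push_cast; ring
  rw [h1, h2, Real.cosh_add, Real.cosh_sub]
  ring

lemma hasDerivAt_besselK_succ (n : ℕ) {r : ℝ} (hr : 0 < r) :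
    HasDerivAt (besselK (n + 1)) (-(besselK (n + 2) r + besselK n r) / 2) r := by
  have hr2 : 0 < r / 2 := by positivity
  have h := (hasDerivAt_integral_of_dominated_loc_of_deriv_le
    (μ := volume.restrict (Set.Ioi (0 : ℝ))) (x₀ := r) (s := Set.Ioi (r / 2))
    (F := fun r t => Real.exp (-r * Real.cosh t) * Real.cosh ((n + 1 : ℕ) * t))
    (F' := fun r t => -(Real.exp (-r * Real.cosh t) * Real.cosh ((n + 2 : ℕ) * t) +
      Real.exp (-r * Real.cosh t) * Real.cosh (n * t)) / 2)
    (bound := fun t => (Real.exp (-(r / 2) * Real.cosh t) * Real.cosh ((n + 2 : ℕ) * t) +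
      Real.exp (-(r / 2) * Real.cosh t) * Real.cosh (n * t)) / 2)
    (Ioi_mem_nhds (by linarith))
    (.of_forall fun s => by fun_prop)
    (integrableOn_besselK (n + 1) hr) (by fun_prop)
    (.of_forall fun t s hs => by
      have hs' : r / 2 < s := hs
      rw [norm_div, norm_neg, Real.norm_of_nonneg (by positivity),
        Real.norm_of_nonneg (by positivity : (0 : ℝ) ≤ 2)]
      have : 0 < Real.cosh t := Real.cosh_pos t
      gcongr)
    (((integrableOn_besselK (n + 2) hr2).add (integrableOn_besselK n hr2)).div_const 2)
    (.of_forall fun t s _ => by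
      have h1 : HasDerivAt (fun s : ℝ => Real.exp (-s * Real.cosh t))
          (Real.exp (-s * Real.cosh t) * (-1 * Real.cosh t)) s :=
        ((hasDerivAt_id s).neg.mul_const (Real.cosh t)).exp
      refine (h1.mul_const _).congr_deriv ?_
      linear_combination (-Real.exp (-s * Real.cosh t)) * cosh_mul_cosh_succ n t)).2
  refine h.congr_deriv ?_
  rw [integral_div, integral_neg, integral_add (integrableOn_besselK (n + 2) hr)
    (integrableOn_besselK n hr)]
  rfl

lemma besselK_recurrence (n : ℕ) {r : ℝ} (hr : 0 < r) :
    besselK (n + 2) r = besselK n r + 2 * (n + 1) / r * besselK (n + 1) r := by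
  have hi : ∀ m : ℕ, IntegrableOn
      (fun t => Real.exp (-r * Real.cosh t) * Real.cosh (m * t)) (Set.Ioi 0) :=
    fun m => integrableOn_besselK m hr
  have hd : ∀ t ∈ Set.Ici (0 : ℝ), HasDerivAt
      (fun t => Real.exp (-r * Real.cosh t) * Real.sinh ((n + 1 : ℕ) * t))
      (-(r / 2) * (Real.exp (-r * Real.cosh t) * Real.cosh ((n + 2 : ℕ) * t)) +
        (r / 2) * (Real.exp (-r * Real.cosh t) * Real.cosh (n * t)) +
        (n + 1) * (Real.exp (-r * Real.cosh t) * Real.cosh ((n + 1 : ℕ) * t))) t := fun t _ => by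
    have h1 : HasDerivAt (fun t : ℝ => Real.exp (-r * Real.cosh t))
        (Real.exp (-r * Real.cosh t) * (-r * Real.sinh t)) t :=
      ((Real.hasDerivAt_cosh t).const_mul (-r)).exp
    have h2 : HasDerivAt (fun t : ℝ => Real.sinh ((n + 1 : ℕ) * t))
        (Real.cosh ((n + 1 : ℕ) * t) * ((n + 1 : ℕ) * 1)) t :=
      ((hasDerivAt_id t).const_mul ((n + 1 : ℕ) : ℝ)).sinh
    refine (h1.mul h2).congr_deriv ?_
    push_cast
    have := sinh_mul_sinh_succ n t
    push_cast at this
    linear_combination (-r * Real.exp (-r * Real.cosh t)) * this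
  have hint : IntegrableOn (fun t =>
      -(r / 2) * (Real.exp (-r * Real.cosh t) * Real.cosh ((n + 2 : ℕ) * t)) +
        (r / 2) * (Real.exp (-r * Real.cosh t) * Real.cosh (n * t)) +
        (n + 1) * (Real.exp (-r * Real.cosh t) * Real.cosh ((n + 1 : ℕ) * t))) (Set.Ioi 0) :=
    (((hi (n + 2)).const_mul _).add ((hi n).const_mul _)).add ((hi (n + 1)).const_mul _)
  have hlim : Tendsto (fun t => Real.exp (-r * Real.cosh t) * Real.sinh ((n + 1 : ℕ) * t))
      atTop (𝓝 0) := by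
    have h0 : Tendsto (fun t => (((n + 1 : ℕ) + 1).factorial * (2 / r) ^ ((n + 1 : ℕ) + 1)) *
        Real.exp (-t)) atTop (𝓝 0) := by
      simpa using (Real.tendsto_exp_neg_atTop_nhds_zero).const_mul
        ((((n + 1 : ℕ) + 1).factorial * (2 / r) ^ ((n + 1 : ℕ) + 1)) : ℝ)
    refine squeeze_zero' ?_ ?_ h0
    · filter_upwards [eventually_ge_atTop (0 : ℝ)] with t ht
      have : 0 ≤ Real.sinh ((n + 1 : ℕ) * t) := Real.sinh_nonneg_iff.2 (by positivity)
      positivity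
    · filter_upwards [eventually_ge_atTop (0 : ℝ)] with t ht
      refine le_trans ?_ (exp_neg_mul_cosh_le (n + 1) hr ht)
      gcongr
      exact (Real.sinh_lt_cosh _).le
  have h := integral_Ioi_of_hasDerivAt_of_tendsto' hd hint hlim
  have hadd : IntegrableOn (fun t =>
      -(r / 2) * (Real.exp (-r * Real.cosh t) * Real.cosh ((n + 2 : ℕ) * t)) +
        (r / 2) * (Real.exp (-r * Real.cosh t) * Real.cosh (n * t))) (Set.Ioi 0) :=
    ((hi (n + 2)).const_mul _).add ((hi n).const_mul _)
  rw [integral_add hadd ((hi (n + 1)).const_mul _),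
    integral_add ((hi (n + 2)).const_mul _) ((hi n).const_mul _), integral_const_mul,
    integral_const_mul, integral_const_mul] at h
  have h' : -(r / 2) * besselK (n + 2) r + r / 2 * besselK n r + (n + 1) * besselK (n + 1) r = 0 := by
    unfold besselK
    rw [h]
    simp
  field_simp
  linarith

lemma besselK_nonneg (n : ℕ) (r : ℝ) : 0 ≤ besselK n r :=
  integral_nonneg fun t => by positivity

lemma besselK_mono {m n : ℕ} (h : m ≤ n) {r : ℝ} (hr : 0 < r) : besselK m r ≤ besselK n r := by
  refine setIntegral_mono_on (integrableOn_besselK m hr) (integrableOn_besselK n hr)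
    measurableSet_Ioi fun t ht => ?_
  have ht' : 0 < t := ht
  gcongr
  rw [Real.cosh_le_cosh, abs_of_nonneg (by positivity), abs_of_nonneg (by positivity)]
  gcongr

lemma besselK_le_exp (n : ℕ) {r : ℝ} (hr : 1 ≤ r) :
    besselK n r ≤ besselK n 1 * Real.exp (-(r - 1)) := by
  rw [besselK, besselK, ← integral_mul_const]
  refine setIntegral_mono_on (integrableOn_besselK n (by linarith))
    ((integrableOn_besselK n one_pos).mul_const _) measurableSet_Ioi fun t _ => ?_
  have h1 : Real.exp (-r * Real.cosh t) ≤ Real.exp (-1 * Real.cosh t) * Real.exp (-(r - 1)) := by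
    rw [← Real.exp_add, Real.exp_le_exp]
    nlinarith [Real.one_le_cosh t]
  calc _ ≤ Real.exp (-1 * Real.cosh t) * Real.exp (-(r - 1)) * Real.cosh (n * t) := by gcongr
    _ = _ := by ring

/-- Near the origin `K_1(r)` behaves like `1 / r`. -/
lemma tendsto_mul_besselK_one : Tendsto (fun r => r * besselK 1 r) (𝓝[>] 0) (𝓝 1) := by
  have hsinh : ∀ r : ℝ, 0 < r →
      IntegrableOn (fun t => Real.exp (-r * Real.cosh t) * (r * Real.sinh t)) (Set.Ioi 0) ∧
      ∫ t in Set.Ioi (0 : ℝ), Real.exp (-r * Real.cosh t) * (r * Real.sinh t) = Real.exp (-r) := by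
    intro r hr
    have hd : ∀ t ∈ Set.Ici (0 : ℝ), HasDerivAt (fun t => -Real.exp (-r * Real.cosh t))
        (Real.exp (-r * Real.cosh t) * (r * Real.sinh t)) t := fun t _ => by
      refine (((Real.hasDerivAt_cosh t).const_mul (-r)).exp.neg).congr_deriv ?_
      ring
    have hint : IntegrableOn (fun t => Real.exp (-r * Real.cosh t) * (r * Real.sinh t))
        (Set.Ioi 0) := by
      refine Integrable.mono' ((integrableOn_besselK 1 hr).const_mul r) (by fun_prop) ?_
      filter_upwards [ae_restrict_mem measurableSet_Ioi] with t ht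
      have h0 : 0 ≤ Real.sinh t := Real.sinh_nonneg_iff.2 (le_of_lt ht)
      rw [Real.norm_of_nonneg (by positivity), Nat.cast_one, one_mul]
      have := (Real.sinh_lt_cosh t).le
      calc _ ≤ Real.exp (-r * Real.cosh t) * (r * Real.cosh t) := by gcongr
        _ = _ := by ring
    have hlim : Tendsto (fun t => -Real.exp (-r * Real.cosh t)) atTop (𝓝 0) := by
      rw [← neg_zero]
      refine Tendsto.neg (Real.tendsto_exp_comp_nhds_zero.2 ?_)
      simp_rw [neg_mul]
      refine tendsto_neg_atBot_iff.2 (Tendsto.const_mul_atTop hr ?_)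
      refine tendsto_atTop_mono (fun t => ?_) (tendsto_id.atTop_div_const two_pos)
      rw [Real.cosh_eq, id]
      linarith [Real.add_one_le_exp t, Real.exp_pos (-t)]
    refine ⟨hint, ?_⟩
    rw [integral_Ioi_of_hasDerivAt_of_tendsto' hd hint hlim]
    simp
  have hlow : ∀ r : ℝ, 0 < r → Real.exp (-r) ≤ r * besselK 1 r := fun r hr => by
    rw [← (hsinh r hr).2, besselK, ← integral_const_mul]
    refine setIntegral_mono_on (hsinh r hr).1 ((integrableOn_besselK 1 hr).const_mul r)
      measurableSet_Ioi fun t _ => ?_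
    rw [Nat.cast_one, one_mul, mul_left_comm]
    gcongr
    exact (Real.sinh_lt_cosh t).le
  have hup : ∀ r : ℝ, 0 < r → r * besselK 1 r ≤ Real.exp (-r) + r := fun r hr => by
    have h1 : (∫ t in Set.Ioi (0 : ℝ), r * Real.exp (-t)) = r := by
      rw [integral_const_mul, integral_exp_neg_Ioi_zero, mul_one]
    have hi1 : IntegrableOn (fun t : ℝ => r * Real.exp (-t)) (Set.Ioi 0) :=
      (integrableOn_exp_neg_Ioi 0).const_mul r
    calc r * besselK 1 r ≤ ∫ t in Set.Ioi (0 : ℝ),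
          (Real.exp (-r * Real.cosh t) * (r * Real.sinh t) + r * Real.exp (-t)) := by
          rw [besselK, ← integral_const_mul]
          refine setIntegral_mono_on ((integrableOn_besselK 1 hr).const_mul r)
            ((hsinh r hr).1.add hi1) measurableSet_Ioi fun t _ => ?_
          have h2 : Real.cosh t = Real.sinh t + Real.exp (-t) := by
            rw [Real.cosh_eq, Real.sinh_eq]; ring
          have h3 : Real.exp (-r * Real.cosh t) ≤ 1 := Real.exp_le_one_iff.2 (by
            nlinarith [Real.cosh_pos t])
          rw [Nat.cast_one, one_mul]
          calc _ = Real.exp (-r * Real.cosh t) * (r * Real.sinh t) +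
              Real.exp (-r * Real.cosh t) * (r * Real.exp (-t)) := by
                nth_rewrite 2 [h2]; ring
            _ ≤ Real.exp (-r * Real.cosh t) * (r * Real.sinh t) + 1 * (r * Real.exp (-t)) := by
                gcongr
            _ = _ := by ring
      _ = _ := by rw [integral_add (hsinh r hr).1 hi1, (hsinh r hr).2, h1]
  have l1 : Tendsto (fun r : ℝ => Real.exp (-r)) (𝓝[>] 0) (𝓝 1) := by
    have : Continuous fun r : ℝ => Real.exp (-r) := by fun_prop
    simpa using (this.tendsto 0).mono_left nhdsWithin_le_nhds
  have l2 : Tendsto (fun r : ℝ => Real.exp (-r) + r) (𝓝[>] 0) (𝓝 1) := by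
    have : Continuous fun r : ℝ => Real.exp (-r) + r := by fun_prop
    simpa using (this.tendsto 0).mono_left nhdsWithin_le_nhds
  refine tendsto_of_tendsto_of_tendsto_of_le_of_le' l1 l2 ?_ ?_
  · filter_upwards [self_mem_nhdsWithin] with r hr using hlow r hr
  · filter_upwards [self_mem_nhdsWithin] with r hr using hup r hr

/-! ### Radial solutions of `(1 - Δ)² u = 0` -/

/-- At the radius `r > 0` the functions `A` and `B` satisfy `A' = B / r`, `B' = r A - 2 B / r`.
With `L = d²/dr² + (3/r) d/dr`, the radial part of the Laplacian of `ℝ⁴`, this gives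
`(1 - L) A = 0` and `(1 - L) B = -2 A`, so `A` and `B` span a two-dimensional space of radial
solutions of `(1 - Δ)² u = 0`. The space regular at the origin has the basis
`A = I_1(r)/r`, `B = I_2(r)`; the space decaying at infinity has `A = K_1(r)/r`, `B = -K_2(r)`. -/
def IsBesselPair (A B : ℝ → ℝ) (r : ℝ) : Prop :=
  HasDerivAt A (B r / r) r ∧ HasDerivAt B (r * A r - 2 * B r / r) r

/-- The function `I_1(r)/r`, extended smoothly by `1/2` to `r = 0`. -/
def regA (r : ℝ) : ℝ := besselE 1 (r ^ 2) / 2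

/-- The function `I_2(r)`. -/
def regB (r : ℝ) : ℝ := r ^ 2 / 4 * besselE 2 (r ^ 2)

/-- The function `K_1(r)/r`. -/
def decA (r : ℝ) : ℝ := besselK 1 r / r

/-- The function `-K_2(r)`. -/
def decB (r : ℝ) : ℝ := -besselK 2 r

lemma besselI_one (r : ℝ) : besselI 1 r = r * regA r := by
  rw [besselI_eq, regA]; ring

lemma besselI_one_div {r : ℝ} (hr : r ≠ 0) : besselI 1 r / r = regA r := by
  rw [besselI_one]; field_simp

lemma besselI_two (r : ℝ) : besselI 2 r = regB r := by
  rw [besselI_eq, regB]; ring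

lemma regA_zero : regA 0 = 1 / 2 := by simp [regA, besselE_zero]

lemma regB_zero : regB 0 = 0 := by simp [regB]

lemma regA_pos (r : ℝ) : 0 < regA r := half_pos (besselE_pos 1 (sq_nonneg r))

lemma isBesselPair_reg {r : ℝ} (hr : r ≠ 0) : IsBesselPair regA regB r := by
  have hs : HasDerivAt (fun r : ℝ => r ^ 2) (2 * r) r := by simpa using hasDerivAt_pow 2 r
  have h1 := (hasDerivAt_besselE 1 (r ^ 2)).comp r hs
  have h2 := (hasDerivAt_besselE 2 (r ^ 2)).comp r hs
  have h3 := besselE_recurrence 1 (r ^ 2)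
  norm_num at h1 h2 h3
  refine ⟨(h1.div_const 2).congr_deriv ?_, ((hs.div_const 4).mul h2).congr_deriv ?_⟩
  · rw [regB]
    field_simp
  · simp only [regA, regB, Function.comp, h3]
    field_simp
    ring

lemma isBesselPair_dec {r : ℝ} (hr : 0 < r) : IsBesselPair decA decB r := by
  have h1 := hasDerivAt_besselK_succ 0 hr
  have h2 := hasDerivAt_besselK_succ 1 hr
  have r1 := besselK_recurrence 0 hr
  have r2 := besselK_recurrence 1 hr
  norm_num at h1 h2 r1 r2
  refine ⟨(h1.div (hasDerivAt_id r) hr.ne').congr_deriv ?_, h2.neg.congr_deriv ?_⟩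
  · simp only [decB, r1, id]
    field_simp
    ring
  · simp only [decA, decB, r2]
    field_simp
    ring

lemma continuous_regA : Continuous regA :=
  (((contDiff_besselE 1 (n := 0)).continuous).comp (continuous_pow 2)).div_const 2

lemma continuous_regB : Continuous regB :=
  (by fun_prop : Continuous fun r : ℝ => r ^ 2 / 4).mul
    (((contDiff_besselE 2 (n := 0)).continuous).comp (continuous_pow 2))

lemma continuousOn_decA : ContinuousOn decA (Set.Ioi 0) := fun _ hr =>
  (isBesselPair_dec hr).1.continuousAt.continuousWithinAt

lemma continuousOn_decB : ContinuousOn decB (Set.Ioi 0) := fun _ hr =>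
  (isBesselPair_dec hr).2.continuousAt.continuousWithinAt

/-- The Wronskian relation `I_1 K_2 + I_2 K_1 = 1/r`. The expression times `r` is constant, and the
constant is found by letting `r → 0`. -/
lemma bessel_wronskian {r : ℝ} (hr : 0 < r) :
    r ^ 2 * (decA r * regB r - regA r * decB r) = 1 := by
  set w : ℝ → ℝ := fun r => r ^ 2 * (decA r * regB r - regA r * decB r) with hw
  have hd : ∀ r ∈ Set.Ioi (0 : ℝ), HasDerivAt w 0 r := fun r hr => by
    have hr' : (0 : ℝ) < r := hr
    have h1 := isBesselPair_dec hr'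
    have h2 := isBesselPair_reg hr'.ne'
    have hs : HasDerivAt (fun r : ℝ => r ^ 2) (2 * r) r := by simpa using hasDerivAt_pow 2 r
    refine (hs.mul ((h1.1.mul h2.2).sub (h2.1.mul h1.2))).congr_deriv ?_
    simp only [Pi.mul_apply, Pi.sub_apply]
    field_simp
    ring
  have hconst : ∀ s ∈ Set.Ioi (0 : ℝ), w s = w r := fun s hs =>
    isOpen_Ioi.is_const_of_deriv_eq_zero isPreconnected_Ioi
      (fun t ht => (hd t ht).differentiableAt.differentiableWithinAt)
      (fun t ht => (hd t ht).deriv) hs hr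
  have hid : Tendsto (fun r : ℝ => r) (𝓝[>] 0) (𝓝 0) := nhdsWithin_le_nhds
  have lA : Tendsto regA (𝓝[>] 0) (𝓝 (1 / 2)) := by
    rw [← regA_zero]; exact (continuous_regA.tendsto 0).mono_left nhdsWithin_le_nhds
  have lB : Tendsto regB (𝓝[>] 0) (𝓝 0) := by
    have := (continuous_regB.tendsto 0).mono_left (nhdsWithin_le_nhds (s := Set.Ioi 0))
    rwa [regB_zero] at this
  have l0 : Tendsto (fun r => r ^ 2 * besselK 0 r) (𝓝[>] 0) (𝓝 0) := by
    have hup : Tendsto (fun r : ℝ => r * (r * besselK 1 r)) (𝓝[>] 0) (𝓝 0) := by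
      simpa using hid.mul tendsto_mul_besselK_one
    refine squeeze_zero' ?_ ?_ hup
    · filter_upwards with r
      exact mul_nonneg (sq_nonneg r) (besselK_nonneg 0 r)
    · filter_upwards [self_mem_nhdsWithin] with r hr
      rw [← mul_assoc, ← sq]
      exact mul_le_mul_of_nonneg_left (besselK_mono zero_le_one hr) (sq_nonneg r)
  have hlim : Tendsto w (𝓝[>] 0) (𝓝 1) := by
    have h := (tendsto_mul_besselK_one.mul lB).add
      (lA.mul (l0.add (tendsto_mul_besselK_one.const_mul 2)))
    norm_num at h
    refine h.congr' ?_
    filter_upwards [self_mem_nhdsWithin] with r hr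
    have hr' : (0 : ℝ) < r := hr
    have r1 := besselK_recurrence 0 hr'
    norm_num at r1
    simp only [hw, decA, decB, r1]
    field_simp
    ring
  have hlim2 : Tendsto w (𝓝[>] 0) (𝓝 (w r)) := by
    refine tendsto_const_nhds.congr' ?_
    filter_upwards [self_mem_nhdsWithin] with s hs using (hconst s hs).symm
  exact tendsto_nhds_unique hlim2 hlim

/-- `B(r)` is invertible: its determinant times `r³` vanishes at the origin and has the
positive derivative `2 r I_1²`. -/
lemma bessel_det_pos {r : ℝ} (hr : 0 < r) :
    0 < r ^ 2 * regA r ^ 2 - 2 * (regA r * regB r) - regB r ^ 2 := by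
  set D : ℝ → ℝ := fun r => r ^ 2 * (r ^ 2 * regA r ^ 2 - 2 * (regA r * regB r) - regB r ^ 2)
    with hD
  have hcont : Continuous D := by
    have := continuous_regA
    have := continuous_regB
    fun_prop
  have hmono : StrictMonoOn D (Set.Ici 0) := by
    refine strictMonoOn_of_deriv_pos (convex_Ici 0) hcont.continuousOn fun t ht => ?_
    rw [interior_Ici] at ht
    have ht' : (0 : ℝ) < t := ht
    have h2 := isBesselPair_reg ht'.ne'
    have hs : HasDerivAt (fun r : ℝ => r ^ 2) (2 * t) t := by simpa using hasDerivAt_pow 2 t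
    have hd : HasDerivAt D (2 * t ^ 3 * regA t ^ 2) t := by
      refine (hs.mul (((hs.mul (h2.1.pow 2)).sub ((h2.1.mul h2.2).const_mul 2)).sub
        (h2.2.pow 2))).congr_deriv ?_
      simp only [Pi.mul_apply, Pi.sub_apply, Pi.pow_apply]
      field_simp
      ring
    rw [hd.deriv]
    have := regA_pos t
    positivity
  have h := hmono (Set.self_mem_Ici) (Set.mem_Ici.2 hr.le) hr
  have h0 : D 0 = 0 := by simp [hD]
  rw [h0] at h
  exact pos_of_mul_pos_right h (sq_nonneg r)

/-! ### The matrices `A`, `B`, `C`, `D` in terms of Bessel pairs -/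

lemma hasDerivAt_mul_of_isBesselPair {A B : ℝ → ℝ} {r : ℝ} (hr : r ≠ 0)
    (h : IsBesselPair A B r) : HasDerivAt (fun r => r * A r) (A r + B r) r := by
  refine ((hasDerivAt_id r).mul h.1).congr_deriv ?_
  simp only [id]
  field_simp

lemma hasDerivAt_add_of_isBesselPair {A B : ℝ → ℝ} {r : ℝ}
    (h : IsBesselPair A B r) : HasDerivAt (fun r => A r + B r) (r * A r - B r / r) r :=
  (h.1.add h.2).congr_deriv (by ring)

lemma matA_eq {r : ℝ} (hr : 0 < r) :
    matA r = !![decA r + decB r, decA r; r * decA r - decB r / r, decB r / r] := by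
  have h0 : ∀ s ∈ Set.Ioi (0 : ℝ), besselK 1 s = s * decA s := fun s hs => by
    have : s ≠ 0 := ne_of_gt hs
    rw [decA]; field_simp
  have h1 : ∀ s ∈ Set.Ioi (0 : ℝ), deriv (besselK 1) s = decA s + decB s := fun s hs =>
    ((hasDerivAt_mul_of_isBesselPair (ne_of_gt hs) (isBesselPair_dec hs)).congr_of_eventuallyEq
      (eventually_of_mem (Ioi_mem_nhds hs) h0)).deriv
  have h2 : deriv (deriv (besselK 1)) r = r * decA r - decB r / r :=
    ((hasDerivAt_add_of_isBesselPair (isBesselPair_dec hr)).congr_of_eventuallyEq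
      (eventually_of_mem (Ioi_mem_nhds hr) h1)).deriv
  rw [matA, h1 r hr, h2]
  rfl

lemma matB_eq {r : ℝ} (hr : 0 < r) :
    matB r = !![regA r, regA r + regB r; regB r / r, r * regA r - regB r / r] := by
  have h1 : ∀ s ∈ Set.Ioi (0 : ℝ), deriv (besselI 1) s = regA s + regB s := fun s hs => by
    rw [show besselI 1 = fun r => r * regA r from funext besselI_one]
    exact (hasDerivAt_mul_of_isBesselPair (ne_of_gt hs) (isBesselPair_reg (ne_of_gt hs))).deriv
  have h2 : deriv (deriv (besselI 1)) r = r * regA r - regB r / r :=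
    ((hasDerivAt_add_of_isBesselPair (isBesselPair_reg hr.ne')).congr_of_eventuallyEq
      (eventually_of_mem (Ioi_mem_nhds hr) h1)).deriv
  rw [matB, h1 r hr, h2, besselI_one_div hr.ne', besselI_two]

lemma matC_eq {r : ℝ} (hr : 0 < r) : matC r = !![regA r, 0; regB r, regA r] := by
  rw [matC, besselI_one_div hr.ne', besselI_two]

lemma matD_eq (r : ℝ) : matD r = !![decB r, decA r; decA r, 0] := rfl

lemma isUnit_det_matB {r : ℝ} (hr : 0 < r) : IsUnit (matB r).det := by
  rw [matB_eq hr, Matrix.det_fin_two_of, isUnit_iff_ne_zero]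
  have h := bessel_det_pos hr
  have : regA r * (r * regA r - regB r / r) - (regA r + regB r) * (regB r / r) =
      (r ^ 2 * regA r ^ 2 - 2 * (regA r * regB r) - regB r ^ 2) / r := by
    field_simp
    ring
  rw [this]
  positivity

/-! ### Spherical means and polar coordinates -/

/-- The mean of `g` over the sphere with centre `x` and radius `r`, where `r` may be any real
number; it is `g x` for `r = 0`. -/
def sphAvg (x : E4) (g : E4 → ℝ) (r : ℝ) : ℝ :=
  1 / (2 * Real.pi ^ 2) *
    ∫ ω : Metric.sphere (0 : E4) 1, g (x + r • (ω : E4)) ∂(volume : Measure E4).toSphere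

lemma toSphere_real_univ : (volume : Measure E4).toSphere.real Set.univ = 2 * Real.pi ^ 2 := by
  rw [Measure.toSphere_real_apply_univ, measureReal_def, EuclideanSpace.volume_ball]
  have h : Real.Gamma ((4 : ℝ) / 2 + 1) = 2 := by
    rw [show (4 : ℝ) / 2 + 1 = ((2 : ℕ) : ℝ) + 1 by norm_num, Real.Gamma_nat_eq_factorial]
    norm_num
  have h2 : √Real.pi ^ 4 = Real.pi ^ 2 := by
    rw [show 4 = 2 * 2 by norm_num, pow_mul, Real.sq_sqrt Real.pi_pos.le]
  simp only [ENNReal.ofReal_one, one_pow, one_mul, Fintype.card_fin, Nat.cast_ofNat, h, h2,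
    finrank_euclideanSpace_fin]
  rw [ENNReal.toReal_ofReal (by positivity)]
  ring

lemma sphAvg_zero (x : E4) (g : E4 → ℝ) : sphAvg x g 0 = g x := by
  simp only [sphAvg, zero_smul, add_zero, integral_const, toSphere_real_univ, smul_eq_mul]
  field_simp

lemma integral_polar (x : E4) {g : E4 → ℝ} (hg : Integrable g) :
    ∫ z, g z = ∫ r in Set.Ioi (0 : ℝ), 2 * Real.pi ^ 2 * (r ^ 3 * sphAvg x g r) := by
  have hd : Module.finrank ℝ E4 - 1 = 3 := by simp
  have hmp := (volume : Measure E4).measurePreserving_homeomorphUnitSphereProd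
  rw [hd] at hmp
  set G : Metric.sphere (0 : E4) 1 × Set.Ioi (0 : ℝ) → ℝ := fun p => g (x + (p.2 : ℝ) • (p.1 : E4))
    with hG
  have hcomp : ∀ z : ({(0 : E4)}ᶜ : Set E4), G (homeomorphUnitSphereProd E4 z) = g (x + z) := by
    intro z
    have hz : ‖(z : E4)‖ ≠ 0 := norm_ne_zero_iff.2 z.2
    simp [hG, smul_smul, mul_inv_cancel₀ hz]
  have hemb : MeasurableEmbedding (Subtype.val : ({(0 : E4)}ᶜ : Set E4) → E4) :=
    MeasurableEmbedding.subtype_coe (measurableSet_singleton _).compl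
  have hgx : Integrable (fun z => g (x + z)) := hg.comp_add_left x
  have hint : Integrable G ((volume : Measure E4).toSphere.prod (.volumeIoiPow 3)) := by
    rw [← hmp.integrable_comp_emb (Homeomorph.measurableEmbedding _)]
    have : G ∘ (homeomorphUnitSphereProd E4) = (fun z => g (x + z)) ∘ Subtype.val :=
      funext hcomp
    rw [this, ← hemb.integrable_map_iff, hemb.map_comap, Subtype.range_coe]
    exact hgx.restrict
  calc ∫ z, g z = ∫ z, g (x + z) := (integral_add_left_eq_self g x).symm
    _ = ∫ z : ({(0 : E4)}ᶜ : Set E4), g (x + z) ∂(volume.comap Subtype.val) := by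
      rw [integral_subtype_comap (measurableSet_singleton _).compl fun z : E4 ↦ g (x + z),
        restrict_compl_singleton]
    _ = ∫ p, G p ∂(volume : Measure E4).toSphere.prod (.volumeIoiPow 3) := by
      rw [← hmp.integral_comp (Homeomorph.measurableEmbedding _)]
      simp_rw [hcomp]
    _ = ∫ r : Set.Ioi (0 : ℝ), (∫ ω, G (ω, r) ∂(volume : Measure E4).toSphere)
          ∂(.volumeIoiPow 3) := integral_prod_symm G hint
    _ = _ := by
      simp only [Measure.volumeIoiPow, ENNReal.ofReal]
      rw [integral_withDensity_eq_integral_smul ((measurable_subtype_coe.pow_const _).real_toNNReal),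
        integral_subtype_comap measurableSet_Ioi (fun r : ℝ => Real.toNNReal (r ^ 3) •
          ∫ ω : Metric.sphere (0 : E4) 1, g (x + r • (ω : E4)) ∂(volume : Measure E4).toSphere)]
      refine setIntegral_congr_fun measurableSet_Ioi fun r hr => ?_
      simp only [NNReal.smul_def, Real.coe_toNNReal _ (pow_nonneg (le_of_lt hr) 3), smul_eq_mul,
        sphAvg]
      field_simp

lemma norm_sub_add_smul (x : E4) {r : ℝ} (hr : 0 ≤ r) (ω : Metric.sphere (0 : E4) 1) :
    ‖x + r • (ω : E4) - x‖ = r := by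
  simp [norm_smul, abs_of_nonneg hr]

lemma sphAvg_radial_mul (x : E4) (F : ℝ → ℝ) (g : E4 → ℝ) {r : ℝ} (hr : 0 ≤ r) :
    sphAvg x (fun z => F ‖z - x‖ * g z) r = F r * sphAvg x g r := by
  simp only [sphAvg, norm_sub_add_smul x hr]
  rw [integral_const_mul]
  ring

lemma continuous_sphAvg (x : E4) {g : E4 → ℝ} (hg : Continuous g) : Continuous (sphAvg x g) := by
  refine continuous_const.mul ?_
  have h := continuous_parametric_integral_of_continuous (μ := (volume : Measure E4).toSphere)
    (f := fun (r : ℝ) (ω : Metric.sphere (0 : E4) 1) => g (x + r • (ω : E4)))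
    (hg.comp (by fun_prop)) isCompact_univ
  simpa using h

lemma abs_sphAvg_le (x : E4) {g : E4 → ℝ} {C : ℝ} (hC : ∀ z, |g z| ≤ C) (r : ℝ) :
    |sphAvg x g r| ≤ C := by
  rw [sphAvg, abs_mul, abs_of_nonneg (by positivity)]
  have h := norm_integral_le_of_norm_le_const (μ := (volume : Measure E4).toSphere)
    (f := fun ω : Metric.sphere (0 : E4) 1 => g (x + r • (ω : E4))) (C := C)
    (.of_forall fun ω => hC _)
  rw [toSphere_real_univ, Real.norm_eq_abs] at h
  calc _ ≤ 1 / (2 * Real.pi ^ 2) * (C * (2 * Real.pi ^ 2)) := by gcongr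
    _ = C := by field_simp

lemma sphAvg_sub (x : E4) {f g : E4 → ℝ} (hf : Continuous f) (hg : Continuous g) (r : ℝ) :
    sphAvg x (fun z => f z - g z) r = sphAvg x f r - sphAvg x g r := by
  simp only [sphAvg]
  rw [integral_sub (f := fun ω : Metric.sphere (0 : E4) 1 => f (x + r • (ω : E4)))
    (g := fun ω : Metric.sphere (0 : E4) 1 => g (x + r • (ω : E4)))
    (integrable_sphere (hf.comp (by fun_prop)))
    (integrable_sphere (hg.comp (by fun_prop))), mul_sub]

/-- The derivative of the spherical mean with respect to the radius. -/
def dSphAvg (x : E4) (f : 𝓢(E4, ℝ)) (r : ℝ) : ℝ :=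
  1 / (2 * Real.pi ^ 2) * ∫ ω : Metric.sphere (0 : E4) 1,
    fderiv ℝ f (x + r • (ω : E4)) (ω : E4) ∂(volume : Measure E4).toSphere

lemma continuous_fderiv_schwartz (f : 𝓢(E4, ℝ)) : Continuous (fderiv ℝ f) :=
  (f.smooth 1).continuous_fderiv (by norm_num)

lemma continuous_dSphAvg (x : E4) (f : 𝓢(E4, ℝ)) : Continuous (dSphAvg x f) := by
  refine continuous_const.mul ?_
  have hF := continuous_fderiv_schwartz f
  have h := continuous_parametric_integral_of_continuous (μ := (volume : Measure E4).toSphere)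
    (f := fun (r : ℝ) (ω : Metric.sphere (0 : E4) 1) => fderiv ℝ f (x + r • (ω : E4)) (ω : E4))
    (Continuous.clm_apply (hF.comp (by fun_prop)) (by fun_prop)) isCompact_univ
  simpa using h

lemma abs_fderiv_apply_le (f : 𝓢(E4, ℝ)) (z : E4) (ω : Metric.sphere (0 : E4) 1) :
    |fderiv ℝ f z (ω : E4)| ≤ SchwartzMap.seminorm ℝ 0 1 f := by
  have h1 := norm_iteratedFDeriv_le_seminorm ℝ f 1 z
  rw [norm_iteratedFDeriv_one] at h1
  refine ((fderiv ℝ f z).le_opNorm _).trans ?_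
  simpa using h1

lemma abs_dSphAvg_le (x : E4) (f : 𝓢(E4, ℝ)) (r : ℝ) :
    |dSphAvg x f r| ≤ SchwartzMap.seminorm ℝ 0 1 f := by
  rw [dSphAvg, abs_mul, abs_of_nonneg (by positivity)]
  have h := norm_integral_le_of_norm_le_const (μ := (volume : Measure E4).toSphere)
    (f := fun ω : Metric.sphere (0 : E4) 1 => fderiv ℝ f (x + r • (ω : E4)) (ω : E4))
    (.of_forall fun ω => abs_fderiv_apply_le f _ ω)
  rw [toSphere_real_univ, Real.norm_eq_abs] at h
  calc _ ≤ 1 / (2 * Real.pi ^ 2) * (SchwartzMap.seminorm ℝ 0 1 f * (2 * Real.pi ^ 2)) := by gcongr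
    _ = _ := by field_simp

lemma hasDerivAt_sphAvg (x : E4) (f : 𝓢(E4, ℝ)) (r : ℝ) :
    HasDerivAt (sphAvg x f) (dSphAvg x f r) r := by
  have hF := continuous_fderiv_schwartz f
  refine HasDerivAt.const_mul _ (hasDerivAt_integral_of_dominated_loc_of_deriv_le
    (μ := (volume : Measure E4).toSphere) (x₀ := r) (s := Set.univ)
    (F := fun s (ω : Metric.sphere (0 : E4) 1) => f (x + s • (ω : E4)))
    (F' := fun s (ω : Metric.sphere (0 : E4) 1) => fderiv ℝ f (x + s • (ω : E4)) (ω : E4))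
    (bound := fun _ => SchwartzMap.seminorm ℝ 0 1 f) Filter.univ_mem
    (.of_forall fun s => (f.continuous.comp (by fun_prop)).aestronglyMeasurable)
    (integrable_sphere (f.continuous.comp (by fun_prop)))
    (integrable_sphere (Continuous.clm_apply (hF.comp (by fun_prop)) (by fun_prop))).1
    (.of_forall fun ω s _ => abs_fderiv_apply_le f _ ω)
    (integrable_const _)
    (.of_forall fun ω s _ => ?_)).2
  have h1 : HasDerivAt (fun s : ℝ => x + s • (ω : E4)) (ω : E4) s := by
    simpa using ((hasDerivAt_id s).smul_const (ω : E4)).const_add x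
  exact (f.differentiableAt.hasFDerivAt).comp_hasDerivAt s h1

lemma sphereAvg_apply (x : E4) (ε : Set.Ioi (0 : ℝ)) (f : 𝓢(E4, ℝ)) :
    sphereAvg x ε f = sphAvg x f ε := sphereMean_eq x ε.2 f

lemma dSphereAvg_apply (x : E4) (ε : Set.Ioi (0 : ℝ)) (f : 𝓢(E4, ℝ)) :
    dSphereAvg x ε f = dSphAvg x f ε := (hasDerivAt_sphereMean x ε.2 f).deriv

/-! ### The Laplacian of a radial function -/

lemma hasFDerivAt_comp_norm_sq (x : E4) {F : ℝ → ℝ} {z : E4} {F' : ℝ}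
    (hF : HasDerivAt F F' (‖z - x‖ ^ 2)) :
    HasFDerivAt (fun z => F (‖z - x‖ ^ 2)) ((2 * F') • innerSL ℝ (z - x)) z := by
  have h1 : HasFDerivAt (fun z : E4 => ‖z - x‖ ^ 2) (2 • innerSL ℝ (z - x)) z := by
    simpa using ((hasFDerivAt_id z).sub_const x).norm_sq
  refine (hF.comp_hasFDerivAt z h1).congr_fderiv ?_
  ext v
  simp
  ring

/-- In `ℝ⁴`, `Δ (F(|z - x|²)) = 4 s F''(s) + 8 F'(s)` at `s = |z - x|²`. -/
lemma laplacian_comp_norm_sq (x : E4) {F F' : ℝ → ℝ} {F'' : ℝ} {z : E4}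
    (h1 : ∀ᶠ s in 𝓝 (‖z - x‖ ^ 2), HasDerivAt F (F' s) s)
    (h2 : HasDerivAt F' F'' (‖z - x‖ ^ 2)) :
    Δ (fun z : E4 => F (‖z - x‖ ^ 2)) z = 4 * ‖z - x‖ ^ 2 * F'' + 8 * F' (‖z - x‖ ^ 2) := by
  have hc : Continuous fun z : E4 => ‖z - x‖ ^ 2 := by fun_prop
  have e1 : fderiv ℝ (fun z : E4 => F (‖z - x‖ ^ 2)) =ᶠ[𝓝 z]
      fun w => (2 * F' (‖w - x‖ ^ 2)) • innerSL ℝ (w - x) := by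
    filter_upwards [hc.continuousAt.eventually h1] with w hw
    exact (hasFDerivAt_comp_norm_sq x hw).fderiv
  have h3 : HasFDerivAt (fun w : E4 => 2 * F' (‖w - x‖ ^ 2))
      ((2 : ℝ) • (2 * F'') • innerSL ℝ (z - x)) z := (hasFDerivAt_comp_norm_sq x h2).const_mul 2
  have h4 : HasFDerivAt (fun w : E4 => innerSL ℝ (w - x)) (innerSL ℝ (E := E4)) z := by
    exact ((innerSL ℝ (E := E4)).hasFDerivAt.comp z
      ((hasFDerivAt_id z).sub_const x)).congr_fderiv (by ext; simp)
  have e2 := e1.fderiv_eq.trans (h3.smul h4).fderiv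
  rw [congrFun (InnerProductSpace.laplacian_eq_iteratedFDeriv_orthonormalBasis
    (fun z : E4 => F (‖z - x‖ ^ 2)) (EuclideanSpace.basisFun (Fin 4) ℝ)) z]
  simp only [iteratedFDeriv_two_apply, e2]
  have hn : ‖z - x‖ ^ 2 = ∑ i, (z i - x i) ^ 2 := by
    rw [EuclideanSpace.norm_sq_eq]; simp
  have hi : ∀ (v : E4) (i : Fin 4), inner ℝ v (EuclideanSpace.single i 1) = v i := fun v i => by
    simp [EuclideanSpace.inner_single_right]
  have hs : ∀ i : Fin 4, innerSL ℝ (E := E4) (EuclideanSpace.single i 1)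
      (EuclideanSpace.single i 1) = 1 := fun i => by rw [innerSL_apply_apply, hi]; simp
  simp only [Matrix.cons_val_zero, Matrix.cons_val_one, EuclideanSpace.basisFun_apply,
    FunLike.coe_add, FunLike.coe_smul, Pi.add_apply, Pi.smul_apply, smul_eq_mul, hs,
    ContinuousLinearMap.smulRight_apply, innerSL_apply_apply, hi, PiLp.sub_apply]
  generalize F' (‖z - x‖ ^ 2) = c
  rw [hn, Fin.sum_univ_four, Fin.sum_univ_four]
  ring

/-! ### The Euler-Poisson-Darboux equation for spherical means -/

/-- A continuous function on `(0, ∞)` vanishes if it integrates to zero, with weight `r`, against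
all test functions of the variable `r²`. -/
lemma eq_zero_of_integral_comp_sq {G : ℝ → ℝ} (hG : ContinuousOn G (Set.Ioi 0))
    (h : ∀ ψ : ℝ → ℝ, ContDiff ℝ (⊤ : ℕ∞) ψ → HasCompactSupport ψ → tsupport ψ ⊆ Set.Ioi 0 →
      ∫ r in Set.Ioi (0 : ℝ), r * ψ (r ^ 2) * G r = 0) {r : ℝ} (hr : 0 < r) : G r = 0 := by
  set f : ℝ → ℝ := fun s => G (√s) with hf
  have hfc : ContinuousOn f (Set.Ioi 0) :=
    hG.comp Real.continuous_sqrt.continuousOn fun s hs => Real.sqrt_pos.2 hs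
  have hae : ∀ᵐ s ∂(volume : Measure ℝ), s ∈ Set.Ioi (0 : ℝ) → f s = 0 := by
    refine isOpen_Ioi.ae_eq_zero_of_integral_contDiff_smul_eq_zero
      (hfc.locallyIntegrableOn measurableSet_Ioi) fun ψ hψ hc hs => ?_
    have h0 : ∀ s, s ∉ Set.Ioi (0 : ℝ) → ψ s • f s = 0 := fun s hs' => by
      rw [image_eq_zero_of_notMem_tsupport fun h => hs' (hs h), zero_smul]
    rw [← setIntegral_eq_integral_of_forall_compl_eq_zero h0,
      ← integral_comp_rpow_Ioi_of_pos (g := fun s => ψ s • f s) (p := 2) two_pos]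
    have h1 := h ψ hψ hc hs
    refine Eq.trans ?_ ((congrArg (2 * ·) h1).trans (mul_zero 2))
    rw [← integral_const_mul]
    refine setIntegral_congr_fun measurableSet_Ioi fun t ht => ?_
    have ht' : (0 : ℝ) < t := ht
    simp only [hf, smul_eq_mul]
    rw [show (2 : ℝ) - 1 = 1 by norm_num, Real.rpow_one, Real.rpow_two, Real.sqrt_sq ht'.le]
    ring
  have heq : Set.EqOn f (fun _ => 0) (Set.Ioi 0) := by
    refine Measure.eqOn_open_of_ae_eq (μ := volume) ?_ isOpen_Ioi hfc continuousOn_const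
    exact (ae_restrict_iff' measurableSet_Ioi).2 hae
  have := heq (show r ^ 2 ∈ Set.Ioi (0 : ℝ) from pow_pos hr 2)
  simpa [hf, Real.sqrt_sq hr.le] using this

lemma integral_Ioi_eq_intervalIntegral {g : ℝ → ℝ} {T : ℝ} (hT : 0 ≤ T)
    (hg : ∀ r, T < r → g r = 0) : ∫ r in Set.Ioi (0 : ℝ), g r = ∫ r in (0 : ℝ)..T, g r := by
  rw [intervalIntegral.integral_of_le hT]
  refine setIntegral_eq_of_subset_of_forall_sdiff_eq_zero measurableSet_Ioi
    Set.Ioc_subset_Ioi_self fun r hr => hg r ?_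
  by_contra h
  exact hr.2 ⟨hr.1, not_lt.1 h⟩

/-- Test functions `η(|z - x|²)`. -/
lemma exists_schwartz_comp_norm_sq (x : E4) {η : ℝ → ℝ} (hη : ContDiff ℝ (⊤ : ℕ∞) η) {S : ℝ}
    (hS : 0 < S) (h0 : ∀ s, S ≤ s → η s = 0) :
    ∃ φ : 𝓢(E4, ℝ), ∀ z, φ z = η (‖z - x‖ ^ 2) := by
  have hc : HasCompactSupport fun z : E4 => η (‖z - x‖ ^ 2) := by
    refine HasCompactSupport.intro (isCompact_closedBall x (S + 1)) fun z hz => h0 _ ?_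
    rw [Metric.mem_closedBall, not_le, dist_eq_norm] at hz
    nlinarith
  have hd : ContDiff ℝ (⊤ : ℕ∞) fun z : E4 => η (‖z - x‖ ^ 2) :=
    hη.comp ((contDiff_id.sub contDiff_const).norm_sq ℝ)
  exact ⟨hc.toSchwartzMap hd, fun z => rfl⟩

lemma exists_bound_of_hasCompactSupport {ψ : ℝ → ℝ} (hc : HasCompactSupport ψ) :
    ∃ S : ℝ, 0 < S ∧ ∀ s, S ≤ s → ψ s = 0 := by
  obtain ⟨R, hR⟩ := hc.isCompact.isBounded.subset_closedBall 0
  refine ⟨|R| + 1, by positivity, fun s hs => image_eq_zero_of_notMem_tsupport fun h => ?_⟩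
  have := hR h
  rw [Metric.mem_closedBall, Real.dist_eq, sub_zero] at this
  linarith [le_abs_self R, le_abs_self s]

/-- The Euler-Poisson-Darboux equation in integrated form: the flux of `∇f` through a sphere is the
integral of `Δ f` over the ball. It is obtained by testing `∫ f Δφ = ∫ φ Δf` with radial `φ`. -/
lemma pow_mul_dSphAvg (x : E4) (f : 𝓢(E4, ℝ)) {r : ℝ} (hr : 0 < r) :
    r ^ 3 * dSphAvg x f r = ∫ t in (0 : ℝ)..r, t ^ 3 * sphAvg x (Δ f : 𝓢(E4, ℝ)) t := by
  set N : ℝ → ℝ := sphAvg x (Δ f : 𝓢(E4, ℝ)) with hN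
  have hNc : Continuous N := continuous_sphAvg x (Δ f : 𝓢(E4, ℝ)).continuous
  have hMc : Continuous (sphAvg x f) := continuous_sphAvg x f.continuous
  set P : ℝ → ℝ := fun r => ∫ t in (0 : ℝ)..r, t ^ 3 * N t with hP
  have hPd : ∀ r, HasDerivAt P (r ^ 3 * N r) r := fun r =>
    intervalIntegral.integral_hasDerivAt_right
      ((by fun_prop : Continuous fun t => t ^ 3 * N t).intervalIntegrable _ _)
      (by fun_prop : Continuous fun t => t ^ 3 * N t).aestronglyMeasurable.stronglyMeasurableAtFilter
      (by fun_prop)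
  have hPc : Continuous P := continuous_iff_continuousAt.2 fun r => (hPd r).continuousAt
  have hdc := continuous_dSphAvg x f
  rw [← sub_eq_zero]
  refine eq_zero_of_integral_comp_sq (G := fun r => r ^ 3 * dSphAvg x f r - P r)
    (by fun_prop) (fun ψ hψ hc hs => ?_) hr
  obtain ⟨S, hS, hψS⟩ := exists_bound_of_hasCompactSupport hc
  set η : ℝ → ℝ := fun s => ∫ t in S..s, ψ t with hη
  have hηd : ∀ s, HasDerivAt η (ψ s) s := fun s =>
    intervalIntegral.integral_hasDerivAt_right (hψ.continuous.intervalIntegrable _ _)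
      hψ.continuous.aestronglyMeasurable.stronglyMeasurableAtFilter hψ.continuous.continuousAt
  have hψd : ∀ s, HasDerivAt ψ (deriv ψ s) s := fun s =>
    (hψ.differentiable (by simp) s).hasDerivAt
  have hψ'c : Continuous (deriv ψ) := hψ.continuous_deriv (by simp)
  have hψc := hψ.continuous
  have hηc : Continuous η := continuous_iff_continuousAt.2 fun r => (hηd r).continuousAt
  have hηs : ContDiff ℝ (⊤ : ℕ∞) η := by
    rw [contDiff_infty_iff_deriv]
    refine ⟨fun s => (hηd s).differentiableAt, ?_⟩
    rwa [show deriv η = ψ from funext fun s => (hηd s).deriv]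
  have hη0 : ∀ s, S ≤ s → η s = 0 := fun s hs => by
    refine intervalIntegral.integral_zero_ae (.of_forall fun t ht => hψS t ?_)
    rw [Set.uIoc_of_le hs] at ht
    exact ht.1.le
  have hψ'0 : ∀ s, S < s → deriv ψ s = 0 := fun s hs => by
    have : ψ =ᶠ[𝓝 s] fun _ => 0 := eventually_of_mem (Ioi_mem_nhds hs) fun t ht => hψS t (le_of_lt ht)
    rw [this.deriv_eq, deriv_const]
  -- test with the radial function whose profile `η` is the primitive of `ψ` vanishing at infinity
  obtain ⟨φ, hφ⟩ := exists_schwartz_comp_norm_sq x hηs hS hη0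
  have hΔ : ∀ z, Δ φ z = 4 * ‖z - x‖ ^ 2 * deriv ψ (‖z - x‖ ^ 2) + 8 * ψ (‖z - x‖ ^ 2) := by
    intro z
    rw [SchwartzMap.laplacian_apply, show (φ : E4 → ℝ) = fun z => η (‖z - x‖ ^ 2) from funext hφ]
    exact laplacian_comp_norm_sq x (.of_forall hηd) (hψd _)
  have key := integral_mul_laplacian_right_eq_left (μ := volume) f φ
  rw [integral_polar x (integrable_mul f (Δ φ)), integral_polar x (integrable_mul (Δ f) φ)] at key
  have e1 : ∀ r ∈ Set.Ioi (0 : ℝ), 2 * Real.pi ^ 2 * (r ^ 3 * sphAvg x (fun z => f z * Δ φ z) r) =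
      2 * Real.pi ^ 2 * (r ^ 3 * ((4 * r ^ 2 * deriv ψ (r ^ 2) + 8 * ψ (r ^ 2)) * sphAvg x f r)) := by
    intro r hr
    rw [← sphAvg_radial_mul x (fun r => 4 * r ^ 2 * deriv ψ (r ^ 2) + 8 * ψ (r ^ 2)) f (le_of_lt hr)]
    simp_rw [hΔ, mul_comm (f _)]
  have e2 : ∀ r ∈ Set.Ioi (0 : ℝ), 2 * Real.pi ^ 2 * (r ^ 3 * sphAvg x (fun z => Δ f z * φ z) r) =
      2 * Real.pi ^ 2 * (r ^ 3 * (η (r ^ 2) * N r)) := by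
    intro r hr
    rw [hN, ← sphAvg_radial_mul x (fun r => η (r ^ 2)) _ (le_of_lt hr)]
    simp_rw [hφ, mul_comm ((Δ f) _)]
  rw [setIntegral_congr_fun measurableSet_Ioi e1, setIntegral_congr_fun measurableSet_Ioi e2] at key
  have hT : ∀ r : ℝ, S + 1 < r → S < r ^ 2 := fun r hr => by nlinarith
  rw [integral_Ioi_eq_intervalIntegral (T := S + 1) (by positivity) (fun r hr => by
      rw [hψ'0 _ (hT r hr), hψS _ (hT r hr).le]; ring),
    integral_Ioi_eq_intervalIntegral (T := S + 1) (by positivity) (fun r hr => by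
      rw [hη0 _ (hT r hr).le]; ring)] at key
  rw [integral_Ioi_eq_intervalIntegral (T := S + 1) (by positivity) (fun r hr => by
      rw [hψS _ (hT r hr).le]; ring)]
  have hMd := hasDerivAt_sphAvg x f
  have hsq : ∀ r : ℝ, HasDerivAt (fun r : ℝ => r ^ 2) (2 * r) r := fun r => by
    simpa using hasDerivAt_pow 2 r
  have hH : ∀ r ∈ Set.uIcc 0 (S + 1), HasDerivAt
      (fun r => 2 * r ^ 4 * ψ (r ^ 2) * sphAvg x f r - η (r ^ 2) * P r)
      (r ^ 3 * ((4 * r ^ 2 * deriv ψ (r ^ 2) + 8 * ψ (r ^ 2)) * sphAvg x f r) -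
        r ^ 3 * (η (r ^ 2) * N r) +
        2 * (r * ψ (r ^ 2) * (r ^ 3 * dSphAvg x f r - P r))) r := fun r _ => by
    have h1 := ((((hasDerivAt_pow 4 r).const_mul 2).mul ((hψd (r ^ 2)).comp r (hsq r))).mul
      (hMd r)).sub (((hηd (r ^ 2)).comp r (hsq r)).mul (hPd r))
    refine h1.congr_deriv ?_
    simp only [Function.comp, Pi.mul_apply]
    push_cast
    ring
  have hFTC := intervalIntegral.integral_eq_sub_of_hasDerivAt hH
    (by apply Continuous.intervalIntegrable; fun_prop)
  rw [intervalIntegral.integral_add (by apply Continuous.intervalIntegrable; fun_prop)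
    (by apply Continuous.intervalIntegrable; fun_prop),
    intervalIntegral.integral_sub (by apply Continuous.intervalIntegrable; fun_prop)
    (by apply Continuous.intervalIntegrable; fun_prop),
    intervalIntegral.integral_const_mul] at hFTC
  rw [intervalIntegral.integral_const_mul, intervalIntegral.integral_const_mul] at key
  have key' := mul_left_cancel₀ (by positivity : (2 * Real.pi ^ 2) ≠ 0) key
  have hS2 : S ≤ (S + 1) ^ 2 := by nlinarith
  have hP0 : P 0 = 0 := by simp [hP]
  rw [hψS _ hS2, hη0 _ hS2, key', hP0] at hFTC
  simp only [sub_self, zero_add, mul_zero, zero_mul, ne_eq, OfNat.ofNat_ne_zero, not_false_eq_true,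
    zero_pow] at hFTC
  linarith

/-- The Euler-Poisson-Darboux equation for spherical means, in terms of `Δ = 1 - (1 - Δ)`. -/
lemma hasDerivAt_pow_mul_dSphAvg (x : E4) (f : 𝓢(E4, ℝ)) {r : ℝ} (hr : 0 < r) :
    HasDerivAt (fun r => r ^ 3 * dSphAvg x f r)
      (r ^ 3 * (sphAvg x f r - sphAvg x (helmholtz f) r)) r := by
  have hNc : Continuous (sphAvg x (Δ f : 𝓢(E4, ℝ))) :=
    continuous_sphAvg x (Δ f : 𝓢(E4, ℝ)).continuous
  have h := intervalIntegral.integral_hasDerivAt_right (a := 0) (b := r)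
      ((by fun_prop : Continuous fun t => t ^ 3 * sphAvg x (Δ f : 𝓢(E4, ℝ)) t).intervalIntegrable _ _)
      (by fun_prop : Continuous fun t => t ^ 3 *
        sphAvg x (Δ f : 𝓢(E4, ℝ)) t).aestronglyMeasurable.stronglyMeasurableAtFilter
      (by fun_prop)
  have e : sphAvg x (helmholtz f) r = sphAvg x f r - sphAvg x (Δ f : 𝓢(E4, ℝ)) r :=
    sphAvg_sub x f.continuous (Δ f : 𝓢(E4, ℝ)).continuous r
  rw [e, sub_sub_cancel]
  exact h.congr_of_eventuallyEq
    (eventually_of_mem (Ioi_mem_nhds hr) fun s hs => pow_mul_dSphAvg x f hs)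

/-! ### Green's second identity for `(1 - Δ)²` and the mean value property -/

/-- The boundary term in Green's identity for `(1 - L)²`, where `L = d²/dr² + (3/r) d/dr`, applied to the radial solution
`u = α A + β B`, for which `(1 - L) u = -2 β A`, and to the spherical means of `f` and of
`(1 - Δ) f`. -/
def greenBoundary (A B : ℝ → ℝ) (α β : ℝ) (x : E4) (f : 𝓢(E4, ℝ)) (r : ℝ) : ℝ :=
  (α * A r + β * B r) * (r ^ 3 * dSphAvg x (helmholtz f) r) -
    (α * (r ^ 2 * B r) + β * (r ^ 4 * A r - 2 * (r ^ 2 * B r))) * sphAvg x (helmholtz f) r -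
    2 * β * A r * (r ^ 3 * dSphAvg x f r) + 2 * β * (r ^ 2 * B r) * sphAvg x f r

lemma hasDerivAt_greenBoundary {A B : ℝ → ℝ} (α β : ℝ) (x : E4) (f : 𝓢(E4, ℝ)) {r : ℝ}
    (hr : 0 < r) (h : IsBesselPair A B r) :
    HasDerivAt (greenBoundary A B α β x f)
      (-(r ^ 3 * ((α * A r + β * B r) * sphAvg x (helmholtz (helmholtz f)) r))) r := by
  have f1 := hasDerivAt_pow_mul_dSphAvg x f hr
  have f2 := hasDerivAt_pow_mul_dSphAvg x (helmholtz f) hr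
  have g1 := hasDerivAt_sphAvg x f r
  have g2 := hasDerivAt_sphAvg x (helmholtz f) r
  have hB : HasDerivAt (fun r => r ^ 2 * B r) (r ^ 3 * A r) r := by
    refine ((hasDerivAt_pow 2 r).mul h.2).congr_deriv ?_
    push_cast
    field_simp
    ring
  have hA4 : HasDerivAt (fun r => r ^ 4 * A r - 2 * (r ^ 2 * B r))
      (2 * r ^ 3 * A r + r ^ 3 * B r) r := by
    refine (((hasDerivAt_pow 4 r).mul h.1).sub (hB.const_mul 2)).congr_deriv ?_
    push_cast
    field_simp
    ring
  have hu := (h.1.const_mul α).add (h.2.const_mul β)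
  have key := (((hu.mul f2).sub (((hB.const_mul α).add (hA4.const_mul β)).mul g2)).sub
    ((h.1.const_mul (2 * β)).mul f1)).add ((hB.const_mul (2 * β)).mul g1)
  refine key.congr_deriv ?_
  simp only [Pi.add_apply]
  field_simp
  ring

lemma continuous_greenBoundary_reg (α β : ℝ) (x : E4) (f : 𝓢(E4, ℝ)) :
    Continuous (greenBoundary regA regB α β x f) := by
  have := continuous_regA
  have := continuous_regB
  have := continuous_sphAvg x f.continuous
  have := continuous_sphAvg x (helmholtz f).continuous
  have := continuous_dSphAvg x f
  have := continuous_dSphAvg x (helmholtz f)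
  unfold greenBoundary
  fun_prop

lemma eq_of_hasDerivAt_zero {u : ℝ → ℝ} (hu : Continuous u) {r : ℝ} (hr : 0 < r)
    (hd : ∀ s ∈ Set.Ioo 0 r, HasDerivAt u 0 s) : u r = u 0 := by
  obtain ⟨c, -, hc⟩ := exists_hasDerivAt_eq_slope u (fun _ => 0) hr hu.continuousOn hd
  have : r - 0 ≠ 0 := by linarith
  rw [eq_comm, div_eq_zero_iff] at hc
  rcases hc with h | h
  · linarith
  · exact absurd h this

/-- Mean value property: if `(1 - Δ)² f = 0` in a ball, then the means over concentric spheres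
inside are the combination of `I_1(r)/r` and `I_2(r)` with the right behaviour at the centre. -/
lemma sphAvg_eq_of_helmholtz_eq_zero (x : E4) (f : 𝓢(E4, ℝ)) {r : ℝ} (hr : 0 < r)
    (h : ∀ z, ‖z - x‖ < r → helmholtz (helmholtz f) z = 0) :
    sphAvg x f r = 2 * f x * regA r - helmholtz f x * regB r := by
  have hp : ∀ s ∈ Set.Ioo 0 r, sphAvg x (helmholtz (helmholtz f)) s = 0 := fun s hs => by
    rw [sphAvg, integral_eq_zero_of_ae, mul_zero]
    refine .of_forall fun ω => h _ ?_
    rw [norm_sub_add_smul x hs.1.le]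
    exact hs.2
  have hQ : ∀ α β, ∀ s ∈ Set.Ioc 0 r, greenBoundary regA regB α β x f s = 0 := by
    intro α β s hs
    rw [eq_of_hasDerivAt_zero (continuous_greenBoundary_reg α β x f) hs.1 fun t ht => by
      have h1 := hasDerivAt_greenBoundary α β x f ht.1 (isBesselPair_reg ht.1.ne')
      rwa [hp t ⟨ht.1, ht.2.trans_le hs.2⟩, mul_zero, mul_zero, neg_zero] at h1]
    simp [greenBoundary]
  have hcA := continuous_regA
  have hcB := continuous_regB
  have hc1 := continuous_sphAvg x f.continuous
  have hc2 := continuous_sphAvg x (helmholtz f).continuous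
  have hA0 : ∀ s, regA s ≠ 0 := fun s => (regA_pos s).ne'
  -- the boundary terms vanish for both regular solutions; this is a first-order system for the
  -- two means, integrated by dividing by `A`
  -- the mean of `(1 - Δ) f` is a multiple of `A`
  have hq : ∀ s ∈ Set.Ioc 0 r, sphAvg x (helmholtz f) s = 2 * helmholtz f x * regA s := by
    intro s hs
    have h1 := eq_of_hasDerivAt_zero (u := fun s => sphAvg x (helmholtz f) s / regA s)
      (hc2.div hcA hA0) hs.1 fun t ht => by
        have hQ1 := hQ 1 0 t ⟨ht.1, ht.2.le.trans hs.2⟩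
        refine ((hasDerivAt_sphAvg x (helmholtz f) t).div (isBesselPair_reg ht.1.ne').1
          (hA0 t)).congr_deriv ?_
        have ht0 : t ≠ 0 := ht.1.ne'
        rw [div_eq_zero_iff]
        left
        simp only [greenBoundary] at hQ1
        field_simp
        refine mul_left_cancel₀ (pow_ne_zero 2 ht0) ?_
        linear_combination hQ1
    simp only [sphAvg_zero, regA_zero] at h1
    rw [div_eq_iff (hA0 s)] at h1
    rw [h1]
    ring
  have h1 := eq_of_hasDerivAt_zero
    (u := fun s => (sphAvg x f s + helmholtz f x * regB s) / regA s)
    ((hc1.add (continuous_const.mul hcB)).div hcA hA0) hr fun t ht => by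
      have ht' : t ∈ Set.Ioc 0 r := ⟨ht.1, ht.2.le⟩
      have hQ1 := hQ 1 0 t ht'
      have hQ2 := hQ 0 1 t ht'
      have hp := isBesselPair_reg ht.1.ne'
      refine (((hasDerivAt_sphAvg x f t).add (hp.2.const_mul (helmholtz f x))).div hp.1
        (hA0 t)).congr_deriv ?_
      have ht0 : t ≠ 0 := ht.1.ne'
      rw [div_eq_zero_iff]
      left
      simp only [greenBoundary] at hQ1 hQ2
      rw [hq t ht'] at hQ1 hQ2
      have hA := hA0 t
      simp only [Pi.add_apply]
      field_simp
      refine mul_left_cancel₀ (mul_ne_zero (mul_ne_zero two_ne_zero hA) (pow_ne_zero 2 ht0)) ?_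
      linear_combination (-regA t) * hQ2 + regB t * hQ1
  simp only [sphAvg_zero, regA_zero, regB_zero] at h1
  rw [div_eq_iff (hA0 r)] at h1
  linear_combination h1

/-! ### The potential of a sphere -/

lemma besselK_antitone (n : ℕ) : AntitoneOn (besselK n) (Set.Ioi 0) := by
  intro a ha b hb hab
  refine setIntegral_mono_on (integrableOn_besselK n hb) (integrableOn_besselK n ha)
    measurableSet_Ioi fun t _ => ?_
  have := Real.cosh_pos t
  gcongr

lemma isBigO_besselK (n : ℕ) : besselK n =O[atTop] fun r => Real.exp (-r) := by
  refine Asymptotics.IsBigO.of_bound (besselK n 1 * Real.exp 1) ?_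
  filter_upwards [eventually_ge_atTop 1] with r hr
  rw [Real.norm_of_nonneg (besselK_nonneg n r), Real.norm_of_nonneg (Real.exp_pos _).le, mul_assoc,
    ← Real.exp_add]
  convert besselK_le_exp n hr using 3
  ring

lemma isBigO_pow_mul_of_isBigO_exp {g : ℝ → ℝ} (hg : g =O[atTop] fun r => Real.exp (-r)) (n : ℕ) :
    (fun r => r ^ n * g r) =O[atTop] fun r => Real.exp (-(1 / 2) * r) := by
  have h := (isLittleO_pow_exp_pos_mul_atTop n (by norm_num : (0 : ℝ) < 1 / 2)).isBigO.mul hg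
  refine h.congr_right fun r => ?_
  rw [← Real.exp_add]
  congr 1
  ring

lemma isBigO_decB : decB =O[atTop] fun r => Real.exp (-r) := (isBigO_besselK 2).neg_left

lemma isBigO_decA : decA =O[atTop] fun r => Real.exp (-r) := by
  refine Asymptotics.IsBigO.trans ?_ (isBigO_besselK 1)
  refine Asymptotics.IsBigO.of_bound 1 ?_
  filter_upwards [eventually_ge_atTop 1] with r hr
  rw [one_mul, decA, norm_div, Real.norm_of_nonneg (by linarith : 0 ≤ r)]
  exact div_le_self (norm_nonneg _) hr

lemma isBigO_sphAvg (x : E4) (f : 𝓢(E4, ℝ)) : sphAvg x f =O[atTop] fun _ => (1 : ℝ) := by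
  refine Asymptotics.IsBigO.of_bound (SchwartzMap.seminorm ℝ 0 0 f) (.of_forall fun r => ?_)
  simpa using abs_sphAvg_le x (fun z => norm_le_seminorm ℝ f z) r

lemma isBigO_dSphAvg (x : E4) (f : 𝓢(E4, ℝ)) : dSphAvg x f =O[atTop] fun _ => (1 : ℝ) := by
  refine Asymptotics.IsBigO.of_bound (SchwartzMap.seminorm ℝ 0 1 f) (.of_forall fun r => ?_)
  simpa using abs_dSphAvg_le x f r

lemma tendsto_greenBoundary_dec (α β : ℝ) (x : E4) (f : 𝓢(E4, ℝ)) :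
    Tendsto (greenBoundary decA decB α β x f) atTop (𝓝 0) := by
  have hA : ∀ n, (fun r => r ^ n * decA r) =O[atTop] fun r => Real.exp (-(1 / 2) * r) :=
    isBigO_pow_mul_of_isBigO_exp isBigO_decA
  have hB : ∀ n, (fun r => r ^ n * decB r) =O[atTop] fun r => Real.exp (-(1 / 2) * r) :=
    isBigO_pow_mul_of_isBigO_exp isBigO_decB
  have h1 := (((hA 3).const_mul_left α).add ((hB 3).const_mul_left β)).mul
    (isBigO_dSphAvg x (helmholtz f))
  have h2 := (((hB 2).const_mul_left α).add (((hA 4).sub ((hB 2).const_mul_left 2)).const_mul_left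
    β)).mul (isBigO_sphAvg x (helmholtz f))
  have h3 := ((hA 3).const_mul_left (2 * β)).mul (isBigO_dSphAvg x f)
  have h4 := ((hB 2).const_mul_left (2 * β)).mul (isBigO_sphAvg x f)
  have h := ((h1.sub h2).sub h3).add h4
  simp only [mul_one] at h
  have h0 : Tendsto (fun r : ℝ => Real.exp (-(1 / 2) * r)) atTop (𝓝 0) :=
    Real.tendsto_exp_atBot.comp (tendsto_id.const_mul_atTop_of_neg (by norm_num))
  refine (h.congr_left fun r => ?_).trans_tendsto h0
  rw [greenBoundary]
  ring

lemma integrableOn_mul_dec (α β : ℝ) (x : E4) (f : 𝓢(E4, ℝ)) {b : ℝ} (hb : 0 < b) :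
    IntegrableOn (fun r => r ^ 3 * ((α * decA r + β * decB r) * sphAvg x f r)) (Set.Ioi b) := by
  have hsub : Set.Ici b ⊆ Set.Ioi 0 := fun r hr => lt_of_lt_of_le hb hr
  have cA := continuousOn_decA.mono hsub
  have cB := continuousOn_decB.mono hsub
  have cf := (continuous_sphAvg x f.continuous).continuousOn (s := Set.Ici b)
  refine integrable_of_isBigO_exp_neg (b := 1 / 2) (by norm_num) (by fun_prop) ?_
  have h := (((isBigO_pow_mul_of_isBigO_exp isBigO_decA 3).const_mul_left α).add
    ((isBigO_pow_mul_of_isBigO_exp isBigO_decB 3).const_mul_left β)).mul (isBigO_sphAvg x f)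
  simp only [mul_one] at h
  exact h.congr_left fun r => by ring

/-- The potential `(1 - Δ)⁻² σ_b` of the normalized surface measure of the sphere of radius `b`, as
a function of the distance `r` to the centre: the combination of the solutions regular at the origin
for `r ≤ b` and of the decaying ones for `r ≥ b`, with coefficients which make `U` and `(1 - Δ) U`
continuous across the sphere. -/
def potential (b r : ℝ) : ℝ :=
  -(1 / (4 * Real.pi ^ 2)) *
    ((2 * decA (max b r) + decB (max b r)) * regA (min b r) + decA (max b r) * regB (min b r))

lemma potential_of_le {b r : ℝ} (h : r ≤ b) : potential b r =
    -(1 / (4 * Real.pi ^ 2)) * (2 * decA b + decB b) * regA r +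
      -(1 / (4 * Real.pi ^ 2)) * decA b * regB r := by
  rw [potential, max_eq_left h, min_eq_right h]
  ring

lemma potential_of_ge {b r : ℝ} (h : b ≤ r) : potential b r =
    -(1 / (4 * Real.pi ^ 2)) * (2 * regA b + regB b) * decA r +
      -(1 / (4 * Real.pi ^ 2)) * regA b * decB r := by
  rw [potential, max_eq_right h, min_eq_left h]
  ring

lemma continuous_potential {b : ℝ} (hb : 0 < b) : Continuous (potential b) := by
  have h1 : Continuous fun r => decA (max b r) :=
    continuousOn_decA.comp_continuous (by fun_prop) fun r => lt_max_of_lt_left hb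
  have h2 : Continuous fun r => decB (max b r) :=
    continuousOn_decB.comp_continuous (by fun_prop) fun r => lt_max_of_lt_left hb
  have := continuous_regA
  have := continuous_regB
  unfold potential
  fun_prop

lemma exists_bound_potential {b : ℝ} (hb : 0 < b) : ∃ C, ∀ r, 0 ≤ r → |potential b r| ≤ C := by
  obtain ⟨CA, hA⟩ := (isCompact_Icc (a := 0) (b := b)).exists_bound_of_continuousOn
    continuous_regA.continuousOn
  obtain ⟨CB, hB⟩ := (isCompact_Icc (a := 0) (b := b)).exists_bound_of_continuousOn
    continuous_regB.continuousOn
  refine ⟨1 / (4 * Real.pi ^ 2) * ((2 * (besselK 1 b / b) + besselK 2 b) * CA +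
    besselK 1 b / b * CB), fun r hr => ?_⟩
  have hm : min b r ∈ Set.Icc 0 b := ⟨le_min hb.le hr, min_le_left _ _⟩
  have hM : b ≤ max b r := le_max_left _ _
  have hM0 : 0 < max b r := hb.trans_le hM
  have k1 : |decA (max b r)| ≤ besselK 1 b / b := by
    rw [decA, abs_of_nonneg (div_nonneg (besselK_nonneg 1 _) hM0.le)]
    exact div_le_div₀ (besselK_nonneg 1 b) (besselK_antitone 1 hb hM0 hM) hb hM
  have k2 : |decB (max b r)| ≤ besselK 2 b := by
    rw [decB, abs_neg, abs_of_nonneg (besselK_nonneg 2 _)]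
    exact besselK_antitone 2 hb hM0 hM
  have n1 := besselK_nonneg 1 b
  have n2 := besselK_nonneg 2 b
  rw [potential, abs_mul, abs_neg, abs_of_nonneg (by positivity)]
  gcongr
  refine (abs_add_le _ _).trans ?_
  rw [abs_mul, abs_mul]
  gcongr
  · refine (abs_add_le _ _).trans ?_
    rw [abs_mul, abs_two]
    gcongr
  · exact hA _ hm
  · exact hB _ hm

/-- The potential solves `(1 - Δ)² U = σ_b` in the sense of distributions. -/
lemma integral_potential_mul (x : E4) (f : 𝓢(E4, ℝ)) {b : ℝ} (hb : 0 < b) :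
    ∫ z, potential b ‖z - x‖ * helmholtz (helmholtz f) z = sphAvg x f b := by
  obtain ⟨C, hC⟩ := exists_bound_potential hb
  have hint : Integrable fun z => potential b ‖z - x‖ * helmholtz (helmholtz f) z :=
    (helmholtz (helmholtz f)).integrable.bdd_mul (c := C)
      ((continuous_potential hb).comp (by fun_prop)).aestronglyMeasurable
      (.of_forall fun z => hC _ (norm_nonneg _))
  set p := sphAvg x (helmholtz (helmholtz f)) with hp
  have hpc : Continuous p := continuous_sphAvg x (helmholtz (helmholtz f)).continuous
  have hUc := continuous_potential hb
  rw [integral_polar x hint, integral_const_mul]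
  have e1 : ∀ r ∈ Set.Ioi (0 : ℝ),
      r ^ 3 * sphAvg x (fun z => potential b ‖z - x‖ * helmholtz (helmholtz f) z) r =
      r ^ 3 * (potential b r * p r) := fun r hr => by rw [sphAvg_radial_mul x _ _ (le_of_lt hr)]
  rw [setIntegral_congr_fun measurableSet_Ioi e1]
  set c : ℝ := -(1 / (4 * Real.pi ^ 2)) with hc
  -- Green's identity inside and outside the sphere; the boundary terms at `0` and `∞` vanish, and
  -- the jump at `b` is evaluated by the Wronskian relation
  have hin : ∫ r in Set.Ioc 0 b, r ^ 3 * (potential b r * p r) =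
      -greenBoundary regA regB (c * (2 * decA b + decB b)) (c * decA b) x f b := by
    have h := intervalIntegral.integral_eq_sub_of_hasDerivAt_of_le hb.le
      (continuous_greenBoundary_reg (c * (2 * decA b + decB b)) (c * decA b) x f).continuousOn
      (fun r hr => hasDerivAt_greenBoundary (c * (2 * decA b + decB b)) (c * decA b) x f hr.1
        (isBesselPair_reg hr.1.ne')) (by
          have := continuous_regA
          have := continuous_regB
          have : Continuous (sphAvg x (helmholtz (helmholtz f))) := hpc
          apply Continuous.intervalIntegrable
          fun_prop)
    rw [intervalIntegral.integral_neg, intervalIntegral.integral_of_le hb.le,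
      show greenBoundary regA regB (c * (2 * decA b + decB b)) (c * decA b) x f 0 = 0 by
        simp [greenBoundary], sub_zero] at h
    rw [← h, neg_neg]
    refine setIntegral_congr_fun measurableSet_Ioc fun r hr => ?_
    simp only [potential_of_le hr.2, hc, hp]
  have hout' := integrableOn_mul_dec (c * (2 * regA b + regB b)) (c * regA b) x
      (helmholtz (helmholtz f)) hb
  have hcongr : ∀ r ∈ Set.Ioi b, r ^ 3 * (potential b r * p r) = r ^ 3 *
      ((c * (2 * regA b + regB b) * decA r + c * regA b * decB r) * p r) := fun r hr => by
    rw [potential_of_ge (le_of_lt hr)]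
  have hout : ∫ r in Set.Ioi b, r ^ 3 * (potential b r * p r) =
      greenBoundary decA decB (c * (2 * regA b + regB b)) (c * regA b) x f b := by
    have h := integral_Ioi_of_hasDerivAt_of_tendsto'
      (fun r (hr : b ≤ r) => hasDerivAt_greenBoundary (c * (2 * regA b + regB b)) (c * regA b) x f
        (hb.trans_le hr) (isBesselPair_dec (hb.trans_le hr))) hout'.neg
      (tendsto_greenBoundary_dec (c * (2 * regA b + regB b)) (c * regA b) x f)
    rw [integral_neg, zero_sub, neg_inj] at h
    rw [← h]
    exact setIntegral_congr_fun measurableSet_Ioi hcongr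
  rw [← Set.Ioc_union_Ioi_eq_Ioi hb.le, setIntegral_union Set.Ioc_disjoint_Ioi_same measurableSet_Ioi
    ((by fun_prop : Continuous fun r => r ^ 3 * (potential b r * p r)).integrableOn_Ioc)
    (hout'.congr_fun (fun r hr => (hcongr r hr).symm) measurableSet_Ioi), hin, hout]
  have hw := bessel_wronskian hb
  simp only [greenBoundary, hc]
  field_simp
  linear_combination (4 * sphAvg x f b) * hw

/-! ### Solving `(1 - Δ) u = f` in the Schwartz space -/

lemma hasTemperateGrowth_bessel_multiplier : Function.HasTemperateGrowth
    fun ξ : E4 => (1 + (2 * Real.pi) ^ 2 * ‖ξ‖ ^ 2)⁻¹ := by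
  have h := (Function.hasTemperateGrowth_one_add_norm_sq_rpow E4 (-1)).comp
    ((2 * Real.pi) • ContinuousLinearMap.id ℝ E4).hasTemperateGrowth
  refine Eq.mp (congrArg _ (funext fun ξ => ?_)) h
  simp [Real.rpow_neg_one, norm_smul, mul_pow]

lemma exists_sub_laplacian_eq (f : 𝓢(E4, ℂ)) : ∃ u : 𝓢(E4, ℂ), u - Δ u = f := by
  have h1 := hasTemperateGrowth_bessel_multiplier
  have h2 : Function.HasTemperateGrowth fun ξ : E4 => ‖ξ‖ ^ 2 := by fun_prop
  have h3 : Function.HasTemperateGrowth fun ξ : E4 => (2 * Real.pi) ^ 2 * ‖ξ‖ ^ 2 := by fun_prop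
  set g : E4 → ℝ := fun ξ => (1 + (2 * Real.pi) ^ 2 * ‖ξ‖ ^ 2)⁻¹ with hg
  refine ⟨fourierMultiplierCLM ℂ g f, ?_⟩
  rw [laplacian_eq_fourierMultiplierCLM]
  have e1 : fourierMultiplierCLM ℂ (fun ξ : E4 => ‖ξ‖ ^ 2) (fourierMultiplierCLM ℂ g f) =
      fourierMultiplierCLM ℂ (fun ξ : E4 => ‖ξ‖ ^ 2 * g ξ) f :=
    fourierMultiplierCLM_fourierMultiplierCLM_apply h2 h1 f
  have e2 : (g : E4 → ℝ) + (2 * Real.pi) ^ 2 • (fun ξ : E4 => ‖ξ‖ ^ 2 * g ξ) = fun _ => 1 := by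
    ext ξ
    have : (1 + (2 * Real.pi) ^ 2 * ‖ξ‖ ^ 2) ≠ 0 := by positivity
    simp only [Pi.add_apply, Pi.smul_apply, smul_eq_mul, hg]
    field_simp
  have e3 : fourierMultiplierCLM ℂ (fun _ : E4 => (1 : ℝ)) f = f := by simp
  have h4 : Function.HasTemperateGrowth (fun ξ : E4 => ‖ξ‖ ^ 2 * g ξ) := h2.mul h1
  have e4 : fourierMultiplierCLM ℂ (g + (2 * Real.pi) ^ 2 • (fun ξ : E4 => ‖ξ‖ ^ 2 * g ξ)) f =
      fourierMultiplierCLM ℂ g f +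
        (2 * Real.pi) ^ 2 • fourierMultiplierCLM ℂ (fun ξ : E4 => ‖ξ‖ ^ 2 * g ξ) f := by
    rw [← smul_apply, ← fourierMultiplierCLM_smul h4]
    simp only [fourierMultiplierCLM_apply]
    rw [← FourierTransform.fourierInv_add]
    congr 1
    have h5 : Function.HasTemperateGrowth ((2 * Real.pi) ^ 2 • fun ξ : E4 => ‖ξ‖ ^ 2 * g ξ) :=
      (Function.HasTemperateGrowth.const ((2 * Real.pi) ^ 2)).mul h4
    rw [smulLeftCLM_add h1 h5]
    rfl
  calc _ = fourierMultiplierCLM ℂ g f +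
        (2 * Real.pi) ^ 2 • fourierMultiplierCLM ℂ (fun ξ : E4 => ‖ξ‖ ^ 2 * g ξ) f := by
        rw [← e1, sub_eq_add_neg, ← neg_smul, neg_neg]
    _ = f := by rw [← e4, e2, e3]

lemma helmholtz_surjective (f : 𝓢(E4, ℝ)) : ∃ u, helmholtz u = f := by
  obtain ⟨u, hu⟩ := exists_sub_laplacian_eq (postcompCLM Complex.ofRealCLM f)
  refine ⟨postcompCLM Complex.reCLM u, ?_⟩
  ext z
  have h1 : Δ (postcompCLM Complex.reCLM u) z = (Δ u z).re := by
    rw [SchwartzMap.laplacian_apply, SchwartzMap.laplacian_apply]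
    exact ((u.smooth 2).contDiffAt).laplacian_CLM_comp_left (l := Complex.reCLM)
  have h2 := congrArg Complex.re (DFunLike.congr_fun hu z)
  simp only [helmholtz, _root_.sub_apply, postcompCLM_apply, h1]
  simpa using h2

/-! ### Means of Bessel-type functions about a different centre -/

lemma exists_schwartz_eqOn_ball (x : E4) {u : E4 → ℝ} {r ρ : ℝ} (hr : 0 < r) (hrρ : r < ρ)
    (hu : ContDiffOn ℝ (⊤ : ℕ∞) u (Metric.ball x ρ)) :
    ∃ f : 𝓢(E4, ℝ), ∀ z ∈ Metric.ball x r, f z = u z := by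
  let χ : ContDiffBump x := ⟨r, (r + ρ) / 2, hr, by linarith⟩
  have hc : HasCompactSupport fun z => χ z * u z := χ.hasCompactSupport.mul_right
  have hd : ContDiff ℝ (⊤ : ℕ∞) fun z => χ z * u z := by
    rw [contDiff_iff_contDiffAt]
    intro z
    by_cases hz : z ∈ Metric.ball x ρ
    · exact χ.contDiff.contDiffAt.mul (hu.contDiffAt (Metric.isOpen_ball.mem_nhds hz))
    · have hz' : z ∈ (Metric.closedBall x ((r + ρ) / 2))ᶜ := by
        rw [Set.mem_compl_iff, Metric.mem_closedBall]
        rw [Metric.mem_ball] at hz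
        linarith
      refine (contDiffAt_const (c := (0 : ℝ))).congr_of_eventuallyEq ?_
      filter_upwards [Metric.isClosed_closedBall.isOpen_compl.mem_nhds hz'] with w hw
      rw [χ.zero_of_le_dist, zero_mul]
      rw [Set.mem_compl_iff, Metric.mem_closedBall, not_le] at hw
      exact hw.le
  refine ⟨hc.toSchwartzMap hd, fun z hz => ?_⟩
  change χ z * u z = u z
  rw [χ.one_of_mem_closedBall (Metric.ball_subset_closedBall hz), one_mul]

/-- The mean value property for functions defined near a closed ball only. -/
lemma sphAvg_eq_of_laplacian (x : E4) {u w : E4 → ℝ} {r ρ : ℝ} (hr : 0 < r) (hrρ : r < ρ)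
    (hu : ContDiffOn ℝ (⊤ : ℕ∞) u (Metric.ball x ρ))
    (hΔu : ∀ z ∈ Metric.ball x ρ, Δ u z = u z - w z)
    (hΔw : ∀ z ∈ Metric.ball x ρ, Δ w z = w z) :
    sphAvg x u r = 2 * u x * regA r - w x * regB r := by
  obtain ⟨r', hr1, hr2⟩ := exists_between hrρ
  obtain ⟨f, hf⟩ := exists_schwartz_eqOn_ball x (hr.trans hr1) hr2 hu
  have hsub : Metric.ball x r' ⊆ Metric.ball x ρ := Metric.ball_subset_ball hr2.le
  have h1 : ∀ z ∈ Metric.ball x r', helmholtz f z = w z := fun z hz => by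
    have e : (f : E4 → ℝ) =ᶠ[𝓝 z] u := eventually_of_mem (Metric.isOpen_ball.mem_nhds hz) hf
    rw [helmholtz, _root_.sub_apply, SchwartzMap.laplacian_apply,
      (InnerProductSpace.laplacian_congr_nhds e).self_of_nhds, hf z hz, hΔu z (hsub hz)]
    ring
  have h2 : ∀ z ∈ Metric.ball x r', helmholtz (helmholtz f) z = 0 := fun z hz => by
    have e : (helmholtz f : E4 → ℝ) =ᶠ[𝓝 z] w :=
      eventually_of_mem (Metric.isOpen_ball.mem_nhds hz) h1
    rw [helmholtz, _root_.sub_apply, SchwartzMap.laplacian_apply,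
      (InnerProductSpace.laplacian_congr_nhds e).self_of_nhds, h1 z hz, hΔw z (hsub hz), sub_self]
  have hx : x ∈ Metric.ball x r' := Metric.mem_ball_self (hr.trans hr1)
  rw [← hf x hx, ← h1 x hx, ← sphAvg_eq_of_helmholtz_eq_zero x f hr fun z hz => h2 z (by
    rw [Metric.mem_ball, dist_eq_norm]; exact hz.trans hr1)]
  simp only [sphAvg]
  congr 2
  ext ω
  rw [hf]
  rw [Metric.mem_ball, dist_eq_norm, norm_sub_add_smul x hr.le]
  exact hr1

lemma contDiff_reg_comp (α β : ℝ) (y : E4) :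
    ContDiff ℝ (⊤ : ℕ∞) fun z : E4 => α * regA ‖z - y‖ + β * regB ‖z - y‖ := by
  have hn : ContDiff ℝ (⊤ : ℕ∞) fun z : E4 => ‖z - y‖ ^ 2 :=
    (contDiff_id.sub contDiff_const).norm_sq ℝ
  have h1 := (contDiff_besselE 1 (n := ⊤)).comp hn
  have h2 := (contDiff_besselE 2 (n := ⊤)).comp hn
  exact (contDiff_const.mul (h1.div_const 2)).add
    (contDiff_const.mul ((hn.div_const 4).mul h2))

lemma laplacian_reg_comp (α β : ℝ) (y z : E4) :
    Δ (fun z : E4 => α * regA ‖z - y‖ + β * regB ‖z - y‖) z =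
      α * regA ‖z - y‖ + β * regB ‖z - y‖ + 2 * β * regA ‖z - y‖ := by
  have hE := hasDerivAt_besselE
  have h := laplacian_comp_norm_sq y
    (F := fun s => α * (besselE 1 s / 2) + β * (s / 4 * besselE 2 s))
    (F' := fun s => α * (besselE 2 s / 8) + β * (besselE 2 s / 4 + s * besselE 3 s / 16))
    (F'' := α * (besselE 3 (‖z - y‖ ^ 2) / 32) +
      β * (besselE 3 (‖z - y‖ ^ 2) / 8 + ‖z - y‖ ^ 2 * besselE 4 (‖z - y‖ ^ 2) / 64)) (z := z)
    (.of_forall fun s => (((hE 1 s).div_const 2).const_mul α |>.add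
      ((((hasDerivAt_id s).div_const 4).mul (hE 2 s)).const_mul β)).congr_deriv (by
        simp only [id]; ring))
    ((((hE 2 _).div_const 8).const_mul α |>.add
      ((((hE 2 _).div_const 4).add (((hasDerivAt_id _).mul (hE 3 _)).div_const 16)).const_mul
        β)).congr_deriv (by ring_nf))
  refine h.trans ?_
  have r1 := besselE_recurrence 1 (‖z - y‖ ^ 2)
  have r2 := besselE_recurrence 2 (‖z - y‖ ^ 2)
  norm_num at r1 r2
  simp only [regA, regB]
  generalize ‖z - y‖ ^ 2 = s at *
  linear_combination (-α / 2 - β) * r1 - β * (s / 4) * r2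

lemma contDiffOn_dec : ContDiffOn ℝ (⊤ : ℕ∞) decA (Set.Ioi 0) ∧
    ContDiffOn ℝ (⊤ : ℕ∞) decB (Set.Ioi 0) := by
  suffices h : ∀ n : ℕ, ContDiffOn ℝ n decA (Set.Ioi 0) ∧ ContDiffOn ℝ n decB (Set.Ioi 0) from
    ⟨contDiffOn_infty.2 fun n => (h n).1, contDiffOn_infty.2 fun n => (h n).2⟩
  intro n
  induction n with
  | zero => exact ⟨contDiffOn_zero.2 continuousOn_decA, contDiffOn_zero.2 continuousOn_decB⟩
  | succ n ih =>
    have hne : ∀ r ∈ Set.Ioi (0 : ℝ), r ≠ 0 := fun r hr => ne_of_gt hr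
    push_cast
    rw [contDiffOn_succ_iff_deriv_of_isOpen isOpen_Ioi,
      contDiffOn_succ_iff_deriv_of_isOpen isOpen_Ioi]
    refine ⟨⟨fun r hr => (isBesselPair_dec hr).1.differentiableAt.differentiableWithinAt,
      by simp, ?_⟩, ⟨fun r hr => (isBesselPair_dec hr).2.differentiableAt.differentiableWithinAt,
      by simp, ?_⟩⟩
    · exact (ih.2.div contDiffOn_id hne).congr fun r hr => (isBesselPair_dec hr).1.deriv
    · exact ((contDiffOn_id.mul ih.1).sub ((contDiffOn_const.mul ih.2).div contDiffOn_id
        hne)).congr fun r hr => (isBesselPair_dec hr).2.deriv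

lemma contDiffOn_dec_comp (α β : ℝ) (y : E4) :
    ContDiffOn ℝ (⊤ : ℕ∞) (fun z : E4 => α * decA ‖z - y‖ + β * decB ‖z - y‖) {y}ᶜ := by
  have hn : ContDiffOn ℝ (⊤ : ℕ∞) (fun z : E4 => ‖z - y‖) {y}ᶜ := fun z hz =>
    ((contDiff_id.sub contDiff_const).contDiffAt.norm ℝ (sub_ne_zero.2 hz)).contDiffWithinAt
  have hm : Set.MapsTo (fun z : E4 => ‖z - y‖) {y}ᶜ (Set.Ioi 0) := fun z hz =>
    norm_pos_iff.2 (sub_ne_zero.2 hz)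
  exact (contDiffOn_const.mul (contDiffOn_dec.1.comp hn hm)).add
    (contDiffOn_const.mul (contDiffOn_dec.2.comp hn hm))

lemma hasDerivAt_dec_comp_sqrt {s : ℝ} (hs : 0 < s) :
    HasDerivAt (fun s => decA √s) (decB √s / (2 * s)) s ∧
      HasDerivAt (fun s => decB √s) (decA √s / 2 - decB √s / s) s := by
  obtain ⟨r, hr, rfl⟩ : ∃ r : ℝ, 0 < r ∧ r ^ 2 = s := ⟨√s, Real.sqrt_pos.2 hs, Real.sq_sqrt hs.le⟩
  have h1 := Real.hasDerivAt_sqrt hs.ne'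
  rw [Real.sqrt_sq hr.le] at h1 ⊢
  have h : IsBesselPair decA decB √(r ^ 2) := isBesselPair_dec (Real.sqrt_pos.2 hs)
  refine ⟨(h.1.comp _ h1).congr_deriv ?_, (h.2.comp _ h1).congr_deriv ?_⟩
  · rw [Real.sqrt_sq hr.le]
    field_simp
  · rw [Real.sqrt_sq hr.le]
    field_simp

lemma laplacian_dec_comp (α β : ℝ) {y z : E4} (hz : z ≠ y) :
    Δ (fun z : E4 => α * decA ‖z - y‖ + β * decB ‖z - y‖) z =
      α * decA ‖z - y‖ + β * decB ‖z - y‖ + 2 * β * decA ‖z - y‖ := by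
  have hs : 0 < ‖z - y‖ ^ 2 := pow_pos (norm_pos_iff.2 (sub_ne_zero.2 hz)) 2
  have hd : ∀ s : ℝ, 0 < s → HasDerivAt (fun s => α * decA √s + β * decB √s)
      (α * (decB √s / (2 * s)) + β * (decA √s / 2 - decB √s / s)) s := fun s hs =>
    ((hasDerivAt_dec_comp_sqrt hs).1.const_mul α).add ((hasDerivAt_dec_comp_sqrt hs).2.const_mul β)
  have h := laplacian_comp_norm_sq y (z := z)
    (F := fun s => α * decA √s + β * decB √s)
    (F' := fun s => α * (decB √s / (2 * s)) + β * (decA √s / 2 - decB √s / s))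
    (eventually_of_mem (Ioi_mem_nhds hs) hd) (by
      obtain ⟨hA, hB⟩ := hasDerivAt_dec_comp_sqrt hs
      have hi := hasDerivAt_id (‖z - y‖ ^ 2)
      exact ((hB.div (hi.const_mul 2) (by positivity)).const_mul α).add
        (((hA.div_const 2).sub (hB.div hi hs.ne')).const_mul β))
  simp only [Real.sqrt_sq (norm_nonneg _), id] at h
  refine h.trans ?_
  have : ‖z - y‖ ≠ 0 := norm_ne_zero_iff.2 (sub_ne_zero.2 hz)
  field_simp
  ring

/-- The mean of the potential of the sphere `(y, b)` over a sphere inside, where that potential is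
smooth, so that the mean value property applies. The centres may coincide. -/
lemma sphAvg_potential_of_nested (x y : E4) {a b : ℝ} (ha : 0 < a) (h : ‖x - y‖ + a < b) :
    sphAvg x (fun z => potential b ‖z - y‖) a = -(1 / (2 * Real.pi ^ 2)) *
      (((2 * decA b + decB b) * regA ‖x - y‖ + decA b * regB ‖x - y‖) * regA a +
        decA b * regA ‖x - y‖ * regB a) := by
  set c : ℝ := -(1 / (4 * Real.pi ^ 2)) with hc
  have hball : ∀ z ∈ Metric.ball x (b - ‖x - y‖), ‖z - y‖ ≤ b := fun z hz => by
    rw [Metric.mem_ball, dist_eq_norm] at hz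
    have := norm_sub_le_norm_sub_add_norm_sub z x y
    linarith
  have h1 := sphAvg_eq_of_laplacian x
    (u := fun z => c * (2 * decA b + decB b) * regA ‖z - y‖ + c * decA b * regB ‖z - y‖)
    (w := fun z => -(2 * (c * decA b)) * regA ‖z - y‖ + 0 * regB ‖z - y‖)
    ha (by linarith : a < b - ‖x - y‖) (contDiff_reg_comp _ _ y).contDiffOn
    (fun z _ => by rw [laplacian_reg_comp]; ring) (fun z _ => by rw [laplacian_reg_comp]; ring)
  have h2 : sphAvg x (fun z => potential b ‖z - y‖) a = sphAvg x
      (fun z => c * (2 * decA b + decB b) * regA ‖z - y‖ + c * decA b * regB ‖z - y‖) a := by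
    simp only [sphAvg]
    congr 2
    ext ω
    refine potential_of_le (hball _ ?_)
    rw [Metric.mem_ball, dist_eq_norm, norm_sub_add_smul x ha.le]
    linarith
  rw [h2, h1, hc]
  ring

/-- The mean of the potential of the sphere `(y, b)` over a disjoint sphere. -/
lemma sphAvg_potential_of_disjoint (x y : E4) {a b : ℝ} (ha : 0 < a) (hb : 0 < b)
    (h : a + b < ‖x - y‖) :
    sphAvg x (fun z => potential b ‖z - y‖) a = -(1 / (2 * Real.pi ^ 2)) *
      (((2 * regA b + regB b) * decA ‖x - y‖ + regA b * decB ‖x - y‖) * regA a +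
        regA b * decA ‖x - y‖ * regB a) := by
  set c : ℝ := -(1 / (4 * Real.pi ^ 2)) with hc
  have hball : ∀ z ∈ Metric.ball x (‖x - y‖ - b), b ≤ ‖z - y‖ := fun z hz => by
    rw [Metric.mem_ball, dist_comm, dist_eq_norm] at hz
    have := norm_sub_le_norm_sub_add_norm_sub x z y
    linarith
  have hne : ∀ z ∈ Metric.ball x (‖x - y‖ - b), z ≠ y := fun z hz hzy => by
    have := hball z hz
    rw [hzy, sub_self, norm_zero] at this
    linarith
  have h1 := sphAvg_eq_of_laplacian x
    (u := fun z => c * (2 * regA b + regB b) * decA ‖z - y‖ + c * regA b * decB ‖z - y‖)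
    (w := fun z => -(2 * (c * regA b)) * decA ‖z - y‖ + 0 * decB ‖z - y‖)
    ha (by linarith : a < ‖x - y‖ - b) ((contDiffOn_dec_comp _ _ y).mono hne)
    (fun z hz => by rw [laplacian_dec_comp _ _ (hne z hz)]; ring)
    (fun z hz => by rw [laplacian_dec_comp _ _ (hne z hz)]; ring)
  have h2 : sphAvg x (fun z => potential b ‖z - y‖) a = sphAvg x
      (fun z => c * (2 * regA b + regB b) * decA ‖z - y‖ + c * regA b * decB ‖z - y‖) a := by
    simp only [sphAvg]
    congr 2
    ext ω
    refine potential_of_ge (hball _ ?_)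
    rw [Metric.mem_ball, dist_eq_norm, norm_sub_add_smul x ha.le]
    linarith
  rw [h2, h1, hc]
  ring

/-! ### Spherical means as elements of `H⁻²` -/

lemma norm_sq_toH2 (f : 𝓢(E4, ℝ)) : ‖toH2 f‖ ^ 2 = ∫ z, helmholtz f z * helmholtz f z := by
  rw [← real_inner_self_eq_norm_sq, inner_toH2, integral_helmholtz]

lemma integral_sq_le_norm_sq_toH2 (f : 𝓢(E4, ℝ)) :
    ∫ z, f z * f z ≤ ‖toH2 f‖ ^ 2 ∧ ∫ z, Δ f z * Δ f z ≤ ‖toH2 f‖ ^ 2 := by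
  have h : ‖toH2 f‖ ^ 2 = (∫ z, f z * f z) - 2 * (∫ z, f z * Δ f z) + ∫ z, Δ f z * Δ f z := by
    rw [norm_sq_toH2, ← integral_const_mul]
    have hi : Integrable (fun z => f z * f z - 2 * (f z * Δ f z)) :=
      (integrable_mul f f).sub ((integrable_mul f (Δ f)).const_mul 2)
    rw [← integral_sub (integrable_mul f f) ((integrable_mul f (Δ f)).const_mul 2),
      ← integral_add hi (integrable_mul (Δ f) (Δ f))]
    congr 1
    ext z
    simp only [helmholtz, _root_.sub_apply]
    ring
  have h1 := integral_mul_laplacian_nonpos f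
  have h2 : 0 ≤ ∫ z, f z * f z := integral_nonneg fun z => mul_self_nonneg _
  have h3 : 0 ≤ ∫ z, Δ f z * Δ f z := integral_nonneg fun z => mul_self_nonneg _
  constructor <;> linarith

/-- The integral of `g` over a ball is bounded by the `L²` norm of `g`. -/
lemma abs_integral_pow_mul_sphAvg_le (x : E4) (g : 𝓢(E4, ℝ)) {s S N : ℝ} (hs : 0 ≤ s)
    (hsS : s ≤ S) (hN : 0 ≤ N) (hg : ∫ z, g z * g z ≤ N ^ 2) :
    |∫ t in (0 : ℝ)..s, t ^ 3 * sphAvg x g t| ≤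
      √((volume : Measure E4).real (Metric.closedBall x S)) * N := by
  set B : Set E4 := Metric.closedBall x s with hB
  have hBm : MeasurableSet B := Metric.isClosed_closedBall.measurableSet
  have hF : ∀ z, B.indicator g z = (Set.Iic s).indicator 1 ‖z - x‖ * g z := fun z => by
    by_cases hz : z ∈ B
    · rw [Set.indicator_of_mem hz, Set.indicator_of_mem (by rwa [hB, mem_closedBall_iff_norm] at hz)]
      simp
    · rw [Set.indicator_of_notMem hz,
        Set.indicator_of_notMem (by rwa [hB, mem_closedBall_iff_norm] at hz)]
      simp
  have h1 := integral_polar x (g.integrable.indicator hBm (μ := volume))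
  have e1 : ∀ r ∈ Set.Ioi (0 : ℝ), 2 * Real.pi ^ 2 * (r ^ 3 * sphAvg x (B.indicator g) r) =
      2 * Real.pi ^ 2 * (r ^ 3 * ((Set.Iic s).indicator 1 r * sphAvg x g r)) := fun r hr => by
    rw [show B.indicator g = fun z => (Set.Iic s).indicator 1 ‖z - x‖ * g z from funext hF,
      sphAvg_radial_mul x _ _ (le_of_lt hr)]
  rw [setIntegral_congr_fun measurableSet_Ioi e1, integral_const_mul,
    integral_Ioi_eq_intervalIntegral hs (fun r hr => by
      rw [Set.indicator_of_notMem (by simpa using hr)]; ring)] at h1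
  have e2 : ∫ r in (0 : ℝ)..s, r ^ 3 * ((Set.Iic s).indicator 1 r * sphAvg x g r) =
      ∫ r in (0 : ℝ)..s, r ^ 3 * sphAvg x g r := by
    refine intervalIntegral.integral_congr fun r hr => ?_
    rw [Set.uIcc_of_le hs] at hr
    rw [Set.indicator_of_mem (by simpa using hr.2)]
    simp
  rw [e2] at h1
  have hvol : (volume : Measure E4) B ≠ ⊤ := (isCompact_closedBall x s).measure_lt_top.ne
  -- Cauchy-Schwarz
  have h2 : |∫ z, B.indicator g z| ≤ √((volume : Measure E4).real B) * √(∫ z, g z * g z) := by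
    have hm1 : MemLp (B.indicator (fun _ => (1 : ℝ))) (ENNReal.ofReal 2) (volume : Measure E4) :=
      memLp_indicator_const _ hBm _ (Or.inr hvol)
    have hm2 : MemLp g (ENNReal.ofReal 2) (volume : Measure E4) := g.memLp _ _
    have h3 := integral_mul_norm_le_Lp_mul_Lq (Real.HolderConjugate.two_two) hm1 hm2
    have e3 : ∫ z, ‖B.indicator (fun _ => (1 : ℝ)) z‖ ^ (2 : ℝ) = (volume : Measure E4).real B := by
      have : ∀ z, ‖B.indicator (fun _ => (1 : ℝ)) z‖ ^ (2 : ℝ) = B.indicator 1 z := fun z => by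
        by_cases hz : z ∈ B <;> simp [hz]
      simp_rw [this]
      exact integral_indicator_one hBm
    have e4 : ∫ z, ‖g z‖ ^ (2 : ℝ) = ∫ z, g z * g z := by
      congr 1
      ext z
      rw [Real.rpow_two, Real.norm_eq_abs, sq_abs, sq]
    rw [e3, e4, ← Real.sqrt_eq_rpow, ← Real.sqrt_eq_rpow] at h3
    refine le_trans ?_ h3
    rw [← Real.norm_eq_abs]
    refine (norm_integral_le_integral_norm _).trans (le_of_eq ?_)
    congr 1
    ext z
    by_cases hz : z ∈ B <;> simp [hz]
  rw [h1, abs_mul, abs_of_nonneg (by positivity)] at h2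
  have hpi : 1 ≤ 2 * Real.pi ^ 2 := by nlinarith [Real.pi_gt_three]
  have h4 : √((volume : Measure E4).real B) ≤ √((volume : Measure E4).real (Metric.closedBall x S)) :=
    Real.sqrt_le_sqrt (measureReal_mono (Metric.closedBall_subset_closedBall hsS)
      (isCompact_closedBall x S).measure_lt_top.ne)
  have h5 : √(∫ z, g z * g z) ≤ N := (Real.sqrt_le_left hN).2 hg
  calc _ ≤ 2 * Real.pi ^ 2 * |∫ t in (0 : ℝ)..s, t ^ 3 * sphAvg x g t| :=
        le_mul_of_one_le_left (abs_nonneg _) hpi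
    _ ≤ _ := h2
    _ ≤ _ := by gcongr

/-- The flux through a sphere is controlled by the `L²` norm of `Δ f` over the ball. -/
lemma abs_pow_mul_dSphAvg_le (x : E4) (f : 𝓢(E4, ℝ)) {s S : ℝ} (hs : 0 < s) (hsS : s ≤ S) :
    |s ^ 3 * dSphAvg x f s| ≤
      √((volume : Measure E4).real (Metric.closedBall x S)) * ‖toH2 f‖ := by
  rw [pow_mul_dSphAvg x f hs]
  exact abs_integral_pow_mul_sphAvg_le x (Δ f) hs.le hsS (norm_nonneg _)
    (integral_sq_le_norm_sq_toH2 f).2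

/-- The mean over a sphere is recovered by integrating `(t⁴ M(t))' = 4 t³ M(t) + t⁴ M'(t)`, where the
first term gives an integral over a ball and the second is controlled by the flux. -/
lemma abs_pow_mul_sphAvg_le (x : E4) (f : 𝓢(E4, ℝ)) {s S : ℝ} (hs : 0 < s) (hsS : s ≤ S) :
    |s ^ 4 * sphAvg x f s| ≤
      (4 + S ^ 2) * √((volume : Measure E4).real (Metric.closedBall x S)) * ‖toH2 f‖ := by
  set C := √((volume : Measure E4).real (Metric.closedBall x S)) with hC
  have hc1 := continuous_sphAvg x f.continuous
  have hc2 := continuous_dSphAvg x f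
  have hd : ∀ t ∈ Set.uIcc 0 s, HasDerivAt (fun t => t ^ 4 * sphAvg x f t)
      (4 * (t ^ 3 * sphAvg x f t) + t * (t ^ 3 * dSphAvg x f t)) t := fun t _ => by
    refine ((hasDerivAt_pow 4 t).mul (hasDerivAt_sphAvg x f t)).congr_deriv ?_
    push_cast
    ring
  have h := intervalIntegral.integral_eq_sub_of_hasDerivAt hd
    (by apply Continuous.intervalIntegrable; fun_prop)
  rw [intervalIntegral.integral_add (by apply Continuous.intervalIntegrable; fun_prop)
    (by apply Continuous.intervalIntegrable; fun_prop), intervalIntegral.integral_const_mul] at h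
  simp only [ne_eq, OfNat.ofNat_ne_zero, not_false_eq_true, zero_pow, zero_mul, sub_zero] at h
  have h1 := abs_integral_pow_mul_sphAvg_le x f hs.le hsS (norm_nonneg _)
    (integral_sq_le_norm_sq_toH2 f).1
  have h2 : |∫ t in (0 : ℝ)..s, t * (t ^ 3 * dSphAvg x f t)| ≤ S * (C * ‖toH2 f‖) * |s - 0| := by
    rw [← Real.norm_eq_abs (∫ t in (0 : ℝ)..s, _)]
    refine intervalIntegral.norm_integral_le_of_norm_le_const fun t ht => ?_
    rw [Set.uIoc_of_le hs.le] at ht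
    rw [Real.norm_eq_abs, abs_mul, abs_of_pos ht.1]
    have := abs_pow_mul_dSphAvg_le x f ht.1 (ht.2.trans hsS)
    have := ht.2.trans hsS
    have := ht.1
    have : 0 ≤ S := hs.le.trans hsS
    gcongr
  rw [← h]
  refine (abs_add_le _ _).trans ?_
  rw [abs_mul, abs_of_nonneg (by norm_num : (0 : ℝ) ≤ 4)]
  rw [sub_zero, abs_of_pos hs] at h2
  have h3 : S * (C * ‖toH2 f‖) * s ≤ S * (C * ‖toH2 f‖) * S := by
    have : 0 ≤ S := hs.le.trans hsS
    gcongr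
  nlinarith

/-- The functionals `σ_s^x` and `dσ_s^x` are bounded on `H²`, uniformly for `s` in a compact
subset of `(0, ∞)`. -/
lemma exists_bound_sphereAvg (x : E4) {δ T : ℝ} (hδ : 0 < δ) : ∃ C, 0 ≤ C ∧
    ∀ s ∈ Set.Icc δ T, ∀ f : 𝓢(E4, ℝ),
      |sphAvg x f s| ≤ C * ‖toH2 f‖ ∧ |dSphAvg x f s| ≤ C * ‖toH2 f‖ := by
  set K := √((volume : Measure E4).real (Metric.closedBall x T)) with hK
  refine ⟨(4 + T ^ 2) * K / δ ^ 4 + K / δ ^ 3, by positivity, fun s hs f => ?_⟩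
  have hs0 : 0 < s := hδ.trans_le hs.1
  have h1 := abs_pow_mul_sphAvg_le x f hs0 hs.2
  have h2 := abs_pow_mul_dSphAvg_le x f hs0 hs.2
  rw [abs_mul, abs_of_pos (by positivity)] at h1 h2
  have h1' : δ ^ 4 * |sphAvg x f s| ≤ (4 + T ^ 2) * K * ‖toH2 f‖ :=
    le_trans (by have := hs.1; gcongr) h1
  have h2' : δ ^ 3 * |dSphAvg x f s| ≤ K * ‖toH2 f‖ :=
    le_trans (by have := hs.1; gcongr) h2
  rw [add_mul, div_mul_eq_mul_div, div_mul_eq_mul_div]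
  constructor
  · refine le_trans ?_ (le_add_of_nonneg_right (by positivity))
    rw [le_div_iff₀ (by positivity), mul_comm]
    exact h1'
  · refine le_trans ?_ (le_add_of_nonneg_left (by positivity))
    rw [le_div_iff₀ (by positivity), mul_comm]
    exact h2'

lemma inHNegTwo_sphereAvg (x : E4) (ε : Set.Ioi (0 : ℝ)) : InHNegTwo (sphereAvg x ε) := by
  obtain ⟨C, -, h⟩ := exists_bound_sphereAvg x (T := ε) ε.2
  exact ⟨C, fun f => by
    rw [sphereAvg_apply]; exact (h ε ⟨le_rfl, le_rfl⟩ f).1⟩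

lemma inHNegTwo_dSphereAvg (x : E4) (ε : Set.Ioi (0 : ℝ)) : InHNegTwo (dSphereAvg x ε) := by
  obtain ⟨C, -, h⟩ := exists_bound_sphereAvg x (T := ε) ε.2
  exact ⟨C, fun f => by
    rw [dSphereAvg_apply]; exact (h ε ⟨le_rfl, le_rfl⟩ f).2⟩

lemma norm_representer_le {ν : 𝓢(E4, ℝ) →L[ℝ] ℝ} {C : ℝ} (hC : 0 ≤ C)
    (hν : ∀ f, |ν f| ≤ C * ‖toH2 f‖) : ‖representer ν‖ ≤ C := by
  have h : ∀ v : H2, inner ℝ v (representer ν) ≤ C * ‖v‖ := fun v => by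
    refine denseRange_toH2.induction_on v (isClosed_le (by fun_prop) (by fun_prop)) fun f => ?_
    rw [inner_representer ⟨C, hν⟩]
    exact (le_abs_self _).trans (hν f)
  have h1 := h (representer ν)
  rw [real_inner_self_eq_norm_sq, sq] at h1
  by_contra! h2
  have h3 : 0 < ‖representer ν‖ := hC.trans_lt h2
  exact absurd (le_of_mul_le_mul_right h1 h3) (not_le.2 h2)

/-- The representer of `σ_r^x`, as a function of a real variable `r` (with value `0` for
`r ≤ 0`). -/
def sphRepr (x : E4) (r : ℝ) : H2 :=
  if h : 0 < r then representer (sphereAvg x ⟨r, h⟩) else 0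

/-- The representer of `dσ_r^x`, as a function of a real variable `r` (with value `0` for
`r ≤ 0`). -/
def dSphRepr (x : E4) (r : ℝ) : H2 :=
  if h : 0 < r then representer (dSphereAvg x ⟨r, h⟩) else 0

lemma sphRepr_coe (x : E4) (ε : Set.Ioi (0 : ℝ)) : sphRepr x ε = representer (sphereAvg x ε) :=
  dif_pos ε.2

lemma dSphRepr_coe (x : E4) (ε : Set.Ioi (0 : ℝ)) : dSphRepr x ε = representer (dSphereAvg x ε) :=
  dif_pos ε.2

lemma inner_sphRepr (x : E4) {r : ℝ} (hr : 0 < r) (f : 𝓢(E4, ℝ)) :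
    inner ℝ (toH2 f) (sphRepr x r) = sphAvg x f r := by
  rw [sphRepr, dif_pos hr, inner_representer (inHNegTwo_sphereAvg x _), sphereAvg_apply]

lemma inner_dSphRepr (x : E4) {r : ℝ} (hr : 0 < r) (f : 𝓢(E4, ℝ)) :
    inner ℝ (toH2 f) (dSphRepr x r) = dSphAvg x f r := by
  rw [dSphRepr, dif_pos hr, inner_representer (inHNegTwo_dSphereAvg x _), dSphereAvg_apply]

lemma exists_bound_sphRepr (x : E4) {δ T : ℝ} (hδ : 0 < δ) : ∃ C, 0 ≤ C ∧
    ∀ s ∈ Set.Icc δ T, ‖sphRepr x s‖ ≤ C ∧ ‖dSphRepr x s‖ ≤ C := by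
  obtain ⟨C, hC, h⟩ := exists_bound_sphereAvg x (T := T) hδ
  refine ⟨C, hC, fun s hs => ?_⟩
  have hs0 : 0 < s := hδ.trans_le hs.1
  rw [sphRepr, dSphRepr, dif_pos hs0, dif_pos hs0]
  exact ⟨norm_representer_le hC fun f => by rw [sphereAvg_apply]; exact (h s hs f).1,
    norm_representer_le hC fun f => by rw [dSphereAvg_apply]; exact (h s hs f).2⟩

lemma neBot_comap_toH2 (h : H2) : (comap toH2 (𝓝 h)).NeBot :=
  comap_neBot fun t ht => by
    obtain ⟨_, hy, f, rfl⟩ := mem_closure_iff_nhds.1 (denseRange_toH2 h) t ht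
    exact ⟨f, hy⟩

/-- For a family `v` bounded on `[δ, T]`, the functions `s ↦ (f, v s)` with Schwartz functions
`f → h` converge to `s ↦ (h, v s)` uniformly on `[δ, T]`. -/
lemma tendstoUniformlyOn_inner {δ T C : ℝ} {v : ℝ → H2} (h : H2) (hC : 0 ≤ C)
    (hv : ∀ s ∈ Set.Icc δ T, ‖v s‖ ≤ C) :
    TendstoUniformlyOn (fun (f : 𝓢(E4, ℝ)) s => inner ℝ (toH2 f) (v s)) (fun s => inner ℝ h (v s))
      (comap toH2 (𝓝 h)) (Set.Icc δ T) := by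
  rw [Metric.tendstoUniformlyOn_iff]
  intro ε hε
  have h1 : ∀ᶠ f : 𝓢(E4, ℝ) in comap toH2 (𝓝 h), ‖toH2 f - h‖ < ε / (C + 1) := by
    have h2 : ∀ᶠ g in 𝓝 h, ‖g - h‖ < ε / (C + 1) := by
      have := Metric.ball_mem_nhds h (by positivity : 0 < ε / (C + 1))
      filter_upwards [this] with g hg
      rwa [← dist_eq_norm]
    exact tendsto_comap.eventually h2
  filter_upwards [h1] with f hf s hs
  rw [dist_comm, Real.dist_eq, ← inner_sub_left]
  refine (abs_real_inner_le_norm _ _).trans_lt ?_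
  calc _ ≤ ‖toH2 f - h‖ * (C + 1) := by
        gcongr
        linarith [hv s hs]
    _ < ε / (C + 1) * (C + 1) := by gcongr
    _ = ε := by field_simp

/-- In the weak sense `dσ_r^x` is the derivative of `σ_r^x` with respect to `r`, on all of `H²`. -/
lemma hasDerivAt_inner_sphRepr (x : E4) (h : H2) {r : ℝ} (hr : 0 < r) :
    HasDerivAt (fun r => inner ℝ h (sphRepr x r)) (inner ℝ h (dSphRepr x r)) r := by
  obtain ⟨C, hC, hb⟩ := exists_bound_sphRepr x (T := 2 * r) (half_pos hr)
  have := neBot_comap_toH2 h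
  have hsub : Set.Ioo (r / 2) (2 * r) ⊆ Set.Icc (r / 2) (2 * r) := Set.Ioo_subset_Icc_self
  refine hasDerivAt_of_tendstoUniformlyOn (l := comap toH2 (𝓝 h)) isOpen_Ioo
    ((tendstoUniformlyOn_inner h hC fun s hs => (hb s hs).2).mono hsub)
    (.of_forall fun f s hs => ?_)
    (fun s hs => (tendstoUniformlyOn_inner h hC fun s hs => (hb s hs).1).tendsto_at (hsub hs))
    ⟨by linarith, by linarith⟩
  have hs0 : 0 < s := (half_pos hr).trans hs.1
  rw [inner_dSphRepr x hs0]
  exact (hasDerivAt_sphAvg x f s).congr_of_eventuallyEq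
    (eventually_of_mem (Ioi_mem_nhds hs0) fun t ht => inner_sphRepr x ht f)

lemma continuousOn_inner_sphRepr (x : E4) (h : H2) :
    ContinuousOn (fun r => inner ℝ h (sphRepr x r)) (Set.Ioi 0) := fun _ hr =>
  (hasDerivAt_inner_sphRepr x h hr).continuousAt.continuousWithinAt

lemma continuousAt_inner_dSphRepr (x : E4) (h : H2) {r : ℝ} (hr : 0 < r) :
    ContinuousAt (fun r => inner ℝ h (dSphRepr x r)) r := by
  obtain ⟨C, hC, hb⟩ := exists_bound_sphRepr x (T := 2 * r) (half_pos hr)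
  have := neBot_comap_toH2 h
  have hc : ContinuousOn (fun r => inner ℝ h (dSphRepr x r)) (Set.Icc (r / 2) (2 * r)) := by
    refine (tendstoUniformlyOn_inner h hC fun s hs => (hb s hs).2).continuousOn
      (Eventually.frequently (.of_forall fun f => ?_))
    exact (continuous_dSphAvg x f).continuousOn.congr fun s hs =>
      inner_dSphRepr x ((half_pos hr).trans_le hs.1) f
  exact hc.continuousAt (Icc_mem_nhds (by linarith) (by linarith))

/-! ### The inner products of the representers -/

lemma exists_Icc_of_tsupport_subset {ψ : ℝ → ℝ} (hc : HasCompactSupport ψ)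
    (hs : tsupport ψ ⊆ Set.Ioi 0) :
    ∃ δ T : ℝ, 0 < δ ∧ ∀ r, 0 < r → r ∉ Set.Icc δ T → ψ (r ^ 2) = 0 := by
  obtain ⟨S, hS, h1⟩ := exists_bound_of_hasCompactSupport hc
  have h0 : (tsupport ψ)ᶜ ∈ 𝓝 (0 : ℝ) :=
    (isClosed_tsupport ψ).isOpen_compl.mem_nhds fun h => lt_irrefl (0 : ℝ) (hs h)
  obtain ⟨ε, hε, h2⟩ := Metric.mem_nhds_iff.1 h0
  refine ⟨√(ε / 2), √S, Real.sqrt_pos.2 (half_pos hε), fun r hr hrI => ?_⟩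
  rw [Set.mem_Icc, not_and_or, not_le, not_le] at hrI
  rcases hrI with h | h
  · refine image_eq_zero_of_notMem_tsupport (h2 ?_)
    rw [mem_ball_zero_iff, Real.norm_of_nonneg (sq_nonneg r)]
    linarith [(Real.lt_sqrt hr.le).1 h]
  · exact h1 _ ((Real.sqrt_lt' hr).1 h).le

lemma integrableOn_comp_sq_mul {ψ G : ℝ → ℝ} (hψ : Continuous ψ) (hc : HasCompactSupport ψ)
    (hs : tsupport ψ ⊆ Set.Ioi 0) (hG : ContinuousOn G (Set.Ioi 0)) :
    IntegrableOn (fun r => ψ (r ^ 2) * G r) (Set.Ioi 0) := by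
  obtain ⟨δ, T, hδ, h0⟩ := exists_Icc_of_tsupport_subset hc hs
  have hsub : Set.Icc δ T ⊆ Set.Ioi 0 := fun r hr => hδ.trans_le hr.1
  have h1 : IntegrableOn (fun r => ψ (r ^ 2) * G r) (Set.Icc δ T) :=
    ContinuousOn.integrableOn_compact isCompact_Icc
      ((hψ.comp (continuous_pow 2)).continuousOn.mul (hG.mono hsub))
  exact h1.of_forall_sdiff_eq_zero measurableSet_Ioi fun r hr => by
    rw [h0 r hr.1 hr.2, zero_mul]

/-- A radial test function `φ = ψ(‖· - x‖²)` is a superposition of spherical means, so that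
`(I - Δ)⁻² φ` is the corresponding superposition of the representers. -/
lemma inner_toH2_of_radial (x : E4) {ψ : ℝ → ℝ} (hψ : Continuous ψ) (hc : HasCompactSupport ψ)
    (hs : tsupport ψ ⊆ Set.Ioi 0) {f : 𝓢(E4, ℝ)}
    (hf : ∀ z, helmholtz (helmholtz f) z = ψ (‖z - x‖ ^ 2)) (h : H2) :
    inner ℝ (toH2 f) h =
      ∫ r in Set.Ioi (0 : ℝ), ψ (r ^ 2) * (2 * Real.pi ^ 2 * r ^ 3 * inner ℝ h (sphRepr x r)) := by
  have hcont (h : H2) : ContinuousOn (fun r => 2 * Real.pi ^ 2 * r ^ 3 * inner ℝ h (sphRepr x r))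
      (Set.Ioi 0) :=
    (by fun_prop : Continuous fun r : ℝ => 2 * Real.pi ^ 2 * r ^ 3).continuousOn.mul
      (continuousOn_inner_sphRepr x h)
  refine denseRange_toH2.induction_on h (isClosed_eq (by fun_prop) ?_) fun g => ?_
  · rw [continuous_iff_continuousAt]
    intro h₀
    obtain ⟨δ, T, hδ, h0⟩ := exists_Icc_of_tsupport_subset hc hs
    obtain ⟨C, hC, hb⟩ := exists_bound_sphRepr x (T := T) hδ
    refine continuousAt_of_dominated
      (bound := fun r => |ψ (r ^ 2) * (2 * Real.pi ^ 2 * r ^ 3 * ((‖h₀‖ + 1) * C))|)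
      (.of_forall fun h => (integrableOn_comp_sq_mul hψ hc hs (hcont h)).1) ?_
      (integrableOn_comp_sq_mul hψ hc hs (by fun_prop)).abs
      (.of_forall fun r => by fun_prop)
    filter_upwards [Metric.ball_mem_nhds h₀ one_pos] with h hh
    refine ae_restrict_of_forall_mem measurableSet_Ioi fun r hr => ?_
    by_cases hrI : r ∈ Set.Icc δ T
    · rw [Real.norm_eq_abs, abs_mul, abs_mul, abs_mul (ψ _), abs_mul _ ((‖h₀‖ + 1) * C)]
      refine mul_le_mul_of_nonneg_left (mul_le_mul_of_nonneg_left ?_ (abs_nonneg _)) (abs_nonneg _)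
      rw [abs_of_nonneg (by positivity : 0 ≤ (‖h₀‖ + 1) * C)]
      refine (abs_real_inner_le_norm _ _).trans ?_
      have h1 : ‖h‖ ≤ ‖h₀‖ + 1 := by
        have := norm_le_norm_add_norm_sub' h h₀
        rw [mem_ball_iff_norm] at hh
        linarith
      have := (hb r hrI).1
      gcongr
    · rw [h0 r hr hrI]
      simp
  · rw [inner_toH2]
    simp_rw [hf]
    have hi : Integrable fun z => ψ (‖z - x‖ ^ 2) * g z := by
      simp_rw [← hf]
      exact integrable_mul _ _
    rw [integral_polar x hi]
    refine setIntegral_congr_fun measurableSet_Ioi fun r hr => ?_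
    rw [inner_sphRepr x hr, sphAvg_radial_mul x (fun s => ψ (s ^ 2)) g (le_of_lt hr)]
    ring

/-- The function `potential b ‖· - y‖` represents the functional `σ_b^y` in the Hilbert space, in
the sense that pairing it with another spherical mean gives the inner product of the
representers. -/
lemma inner_sphRepr_sphRepr (x y : E4) {a b : ℝ} (ha : 0 < a) (hb : 0 < b) :
    inner ℝ (sphRepr y b) (sphRepr x a) = sphAvg x (fun z => potential b ‖z - y‖) a := by
  have hU : Continuous fun z : E4 => potential b ‖z - y‖ := (continuous_potential hb).comp (by fun_prop)
  set G : ℝ → ℝ := fun r => r ^ 2 *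
    (inner ℝ (sphRepr y b) (sphRepr x r) - sphAvg x (fun z => potential b ‖z - y‖) r) with hG
  have hc1 := continuousOn_inner_sphRepr x (sphRepr y b)
  have hc2 : ContinuousOn (fun r => sphAvg x (fun z => potential b ‖z - y‖) r) (Set.Ioi 0) :=
    (continuous_sphAvg x hU).continuousOn
  have hGc : ContinuousOn G (Set.Ioi 0) := (continuous_pow 2).continuousOn.mul (hc1.sub hc2)
  have h := eq_zero_of_integral_comp_sq hGc (fun ψ hψ hc hs => ?_) ha
  · have := (mul_eq_zero.1 h).resolve_left (by positivity)
    linarith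
  obtain ⟨S, hS, hS0⟩ := exists_bound_of_hasCompactSupport hc
  obtain ⟨φ, hφ⟩ := exists_schwartz_comp_norm_sq x hψ hS hS0
  obtain ⟨g, hg⟩ := helmholtz_surjective φ
  obtain ⟨f, hf⟩ := helmholtz_surjective g
  have hf' : ∀ z, helmholtz (helmholtz f) z = ψ (‖z - x‖ ^ 2) := fun z => by rw [hf, hg, hφ]
  have e1 := inner_toH2_of_radial x hψ.continuous hc hs hf' (sphRepr y b)
  rw [inner_sphRepr y hb, ← integral_potential_mul y f hb] at e1
  have hi : Integrable fun z => potential b ‖z - y‖ * helmholtz (helmholtz f) z := by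
    obtain ⟨C, hC⟩ := exists_bound_potential hb
    exact (helmholtz (helmholtz f)).integrable.bdd_mul hU.aestronglyMeasurable
      (.of_forall fun z => hC _ (norm_nonneg _))
  rw [integral_polar x hi] at e1
  have e2 : ∀ r ∈ Set.Ioi (0 : ℝ),
      2 * Real.pi ^ 2 * (r ^ 3 * sphAvg x
        (fun z => potential b ‖z - y‖ * helmholtz (helmholtz f) z) r) =
      ψ (r ^ 2) * (2 * Real.pi ^ 2 * r ^ 3 * sphAvg x (fun z => potential b ‖z - y‖) r) := by
    intro r hr
    have : (fun z => potential b ‖z - y‖ * helmholtz (helmholtz f) z) =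
        fun z => ψ (‖z - x‖ ^ 2) * potential b ‖z - y‖ := by
      ext z
      rw [hf', mul_comm]
    rw [this, sphAvg_radial_mul x (fun s => ψ (s ^ 2)) _ (le_of_lt hr)]
    ring
  rw [setIntegral_congr_fun measurableSet_Ioi e2, eq_comm, ← sub_eq_zero, ← integral_sub] at e1
  · have e3 : ∀ r ∈ Set.Ioi (0 : ℝ), r * ψ (r ^ 2) * G r = (2 * Real.pi ^ 2)⁻¹ *
        (ψ (r ^ 2) * (2 * Real.pi ^ 2 * r ^ 3 * inner ℝ (sphRepr y b) (sphRepr x r)) -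
        ψ (r ^ 2) * (2 * Real.pi ^ 2 * r ^ 3 * sphAvg x (fun z => potential b ‖z - y‖) r)) := by
      intro r _
      simp only [hG]
      field_simp
    rw [setIntegral_congr_fun measurableSet_Ioi e3, integral_const_mul, e1, mul_zero]
  · exact integrableOn_comp_sq_mul hψ.continuous hc hs
      ((by fun_prop : Continuous fun r : ℝ => 2 * Real.pi ^ 2 * r ^ 3).continuousOn.mul hc1)
  · exact integrableOn_comp_sq_mul hψ.continuous hc hs
      ((by fun_prop : Continuous fun r : ℝ => 2 * Real.pi ^ 2 * r ^ 3).continuousOn.mul hc2)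

/-- The Gram matrix of the representers of `(σ_a^x, dσ_a^x)` and `(σ_b^y, dσ_b^y)`. -/
def gramMat (x y : E4) (a b : ℝ) : Matrix (Fin 2) (Fin 2) ℝ :=
  !![inner ℝ (sphRepr x a) (sphRepr y b), inner ℝ (sphRepr x a) (dSphRepr y b);
     inner ℝ (dSphRepr x a) (sphRepr y b), inner ℝ (dSphRepr x a) (dSphRepr y b)]

/-- If `(σ_a^x, σ_b^y)` is locally a bilinear expression in functions of `a` and of `b`, then
differentiating in `a` and in `b` gives the whole Gram matrix. -/
lemma gramMat_eq_of_eventually {x y : E4} {a b c : ℝ} (ha : 0 < a) (hb : 0 < b)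
    {p₀ p₁ q₀ q₁ : ℝ → ℝ} {p₀' p₁' q₀' q₁' : ℝ} (K : Matrix (Fin 2) (Fin 2) ℝ)
    (h : ∀ᶠ t in 𝓝 b, ∀ᶠ s in 𝓝 a, inner ℝ (sphRepr x s) (sphRepr y t) =
      c * ((p₀ s * K 0 0 + p₁ s * K 1 0) * q₀ t + (p₀ s * K 0 1 + p₁ s * K 1 1) * q₁ t))
    (hp₀ : HasDerivAt p₀ p₀' a) (hp₁ : HasDerivAt p₁ p₁' a)
    (hq₀ : HasDerivAt q₀ q₀' b) (hq₁ : HasDerivAt q₁ q₁' b) :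
    gramMat x y a b =
      c • (!![p₀ a, p₁ a; p₀', p₁'] * K * (!![q₀ b, q₁ b; q₀', q₁']).transpose) := by
  have h1 : (fun t => inner ℝ (sphRepr x a) (sphRepr y t)) =ᶠ[𝓝 b] fun t =>
      c * ((p₀ a * K 0 0 + p₁ a * K 1 0) * q₀ t + (p₀ a * K 0 1 + p₁ a * K 1 1) * q₁ t) :=
    h.mono fun t ht => ht.self_of_nhds
  have h2 : (fun t => inner ℝ (dSphRepr x a) (sphRepr y t)) =ᶠ[𝓝 b] fun t =>
      c * ((p₀' * K 0 0 + p₁' * K 1 0) * q₀ t + (p₀' * K 0 1 + p₁' * K 1 1) * q₁ t) :=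
    h.mono fun t ht => by
      have d1 := hasDerivAt_inner_sphRepr x (sphRepr y t) ha
      simp_rw [real_inner_comm (sphRepr y t)] at ht
      have d2 := (((((hp₀.mul_const (K 0 0)).add (hp₁.mul_const (K 1 0))).mul_const (q₀ t)).add
        (((hp₀.mul_const (K 0 1)).add (hp₁.mul_const (K 1 1))).mul_const (q₁ t))).const_mul
          c).congr_of_eventuallyEq ht
      exact (real_inner_comm _ _).trans (d1.unique d2)
  have h3 := (hasDerivAt_inner_sphRepr y (sphRepr x a) hb).unique
    ((((hq₀.const_mul _).add (hq₁.const_mul _)).const_mul c).congr_of_eventuallyEq h1)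
  have h4 := (hasDerivAt_inner_sphRepr y (dSphRepr x a) hb).unique
    ((((hq₀.const_mul _).add (hq₁.const_mul _)).const_mul c).congr_of_eventuallyEq h2)
  have h1' := h1.self_of_nhds
  have h2' := h2.self_of_nhds
  simp only at h1' h2'
  have ht : (!![q₀ b, q₁ b; q₀', q₁']).transpose = !![q₀ b, q₀'; q₁ b, q₁'] := by
    ext i j
    fin_cases i <;> fin_cases j <;> rfl
  rw [ht]
  conv_rhs => rw [Matrix.eta_fin_two K]
  ext i j
  fin_cases i <;> fin_cases j <;>
    simp [gramMat, h1', h2', h3, h4, -mul_eq_mul_left_iff]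

lemma gramMat_of_nested (x y : E4) {a b : ℝ} (hb : 0 < b) (h : ‖x - y‖ + b < a) :
    gramMat x y a b = (-(1 / (2 * Real.pi ^ 2))) • (matA a *
      !![regA ‖x - y‖, 0; regB ‖x - y‖, regA ‖x - y‖] * (matB b).transpose) := by
  have ha : 0 < a := lt_of_le_of_lt (by positivity) h
  have hreg := isBesselPair_reg hb.ne'
  have hdec := isBesselPair_dec ha
  rw [matA_eq ha, matB_eq hb]
  -- the functions `p` and `q` are the first rows of the matrices `A` and `B`, and their derivatives
  -- are the second rows
  refine gramMat_eq_of_eventually ha hb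
    (p₀ := fun s => decA s + decB s) (q₁ := fun s => regA s + regB s) _ ?_
    (hasDerivAt_add_of_isBesselPair hdec) hdec.1 hreg.1 (hasDerivAt_add_of_isBesselPair hreg)
  obtain ⟨m, hm1, hm2⟩ := exists_between (lt_sub_iff_add_lt'.2 h)
  filter_upwards [lt_mem_nhds hb, gt_mem_nhds hm1] with t ht0 ht
  filter_upwards [lt_mem_nhds (lt_sub_iff_add_lt'.1 hm2)] with s hs
  have hst : ‖y - x‖ + t < s := by rw [norm_sub_rev]; linarith
  rw [inner_sphRepr_sphRepr y x ht0 (lt_of_le_of_lt (by positivity) hst),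
    sphAvg_potential_of_nested y x ht0 hst, norm_sub_rev]
  simp
  ring

lemma gramMat_of_disjoint (x y : E4) {a b : ℝ} (ha : 0 < a) (hb : 0 < b) (h : a + b < ‖x - y‖) :
    gramMat x y a b =
      (-(1 / (2 * Real.pi ^ 2))) • (matB a * matD ‖x - y‖ * (matB b).transpose) := by
  have hra := isBesselPair_reg ha.ne'
  have hrb := isBesselPair_reg hb.ne'
  rw [matB_eq ha, matB_eq hb, matD_eq]
  refine gramMat_eq_of_eventually ha hb
    (p₁ := fun s => regA s + regB s) (q₁ := fun s => regA s + regB s) _ ?_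
    hra.1 (hasDerivAt_add_of_isBesselPair hra) hrb.1 (hasDerivAt_add_of_isBesselPair hrb)
  obtain ⟨m, hm1, hm2⟩ := exists_between (lt_sub_iff_add_lt'.2 h)
  filter_upwards [lt_mem_nhds hb, gt_mem_nhds hm1] with t ht0 ht
  filter_upwards [lt_mem_nhds ha, gt_mem_nhds (lt_sub_iff_add_lt.2 (lt_sub_iff_add_lt'.1 hm2))] with s hs0 hs
  rw [inner_sphRepr_sphRepr y x ht0 hs0, norm_sub_rev x y,
    sphAvg_potential_of_disjoint y x ht0 hs0 (by rw [norm_sub_rev]; linarith)]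
  simp
  ring

/-- In the concentric case the inequality of the radii need not be strict, by continuity. -/
lemma gramMat_self (x : E4) {a b : ℝ} (hb : 0 < b) (h : b ≤ a) :
    gramMat x x a b = (-(1 / (4 * Real.pi ^ 2))) • (matA a * (matB b).transpose) := by
  have h1 : ∀ s, b < s →
      gramMat x x s b = (-(1 / (4 * Real.pi ^ 2))) • (matA s * (matB b).transpose) := fun s hs => by
    rw [gramMat_of_nested x x hb (by simpa using hs)]
    -- for distance zero the middle matrix is half the identity
    have : !![regA ‖x - x‖, 0; regB ‖x - x‖, regA ‖x - x‖] = (1 / 2 : ℝ) • 1 := by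
      ext i j
      fin_cases i <;> fin_cases j <;> simp [regA_zero, regB_zero]
    rw [this, Matrix.mul_smul, Matrix.smul_mul, smul_smul, Matrix.mul_one]
    congr 1
    field_simp
    norm_num
  rcases h.lt_or_eq with h | rfl
  · exact h1 a h
  have c1 : ContinuousAt (fun s => gramMat x x s b) b := by
    have d1 (v : H2) : ContinuousAt (fun s => inner ℝ (sphRepr x s) v) b := by
      simp_rw [real_inner_comm v]
      exact (hasDerivAt_inner_sphRepr x v hb).continuousAt
    have d2 (v : H2) : ContinuousAt (fun s => inner ℝ (dSphRepr x s) v) b := by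
      simp_rw [real_inner_comm v]
      exact continuousAt_inner_dSphRepr x v hb
    refine continuousAt_pi.2 fun i => continuousAt_pi.2 fun j => ?_
    fin_cases i <;> fin_cases j
    exacts [d1 _, d1 _, d2 _, d2 _]
  have c2 : ContinuousAt matA b := by
    have dA : ContinuousAt decA b := continuousOn_decA.continuousAt (Ioi_mem_nhds hb)
    have dB : ContinuousAt decB b := continuousOn_decB.continuousAt (Ioi_mem_nhds hb)
    have : ContinuousAt (fun r => !![decA r + decB r, decA r; r * decA r - decB r / r, decB r / r])
        b := by
      refine continuousAt_pi.2 fun i => continuousAt_pi.2 fun j => ?_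
      have hb' := hb.ne'
      fin_cases i <;> fin_cases j
      exacts [dA.add dB, dA, (continuousAt_id.mul dA).sub (dB.div continuousAt_id hb'),
        dB.div continuousAt_id hb']
    exact this.congr (eventually_of_mem (Ioi_mem_nhds hb) fun r hr => (matA_eq hr).symm)
  have c3 : ContinuousAt (fun s => (-(1 / (4 * Real.pi ^ 2))) • (matA s * (matB b).transpose)) b :=
    ContinuousAt.comp (g := fun M : Matrix (Fin 2) (Fin 2) ℝ =>
      (-(1 / (4 * Real.pi ^ 2))) • (M * (matB b).transpose))
      (Continuous.continuousAt (by fun_prop)) c2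
  exact tendsto_nhds_unique_of_eventuallyEq (c1.mono_left nhdsWithin_le_nhds)
    (c3.mono_left nhdsWithin_le_nhds)
    (eventually_of_mem self_mem_nhdsWithin h1 : _ =ᶠ[𝓝[>] b] _)

/-! ### The Paley-Wiener integrals as a Gaussian process -/

lemma integral_norm_le_norm_Lp_two {α : Type*} [MeasurableSpace α] {W : Measure α}
    [IsProbabilityMeasure W] (f : Lp ℝ 2 W) : ∫ θ, ‖f θ‖ ∂W ≤ ‖f‖ := by
  rw [integral_norm_eq_lintegral_enorm (Lp.aestronglyMeasurable f),
    ← eLpNorm_one_eq_lintegral_enorm, Lp.norm_def]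
  exact ENNReal.toReal_mono (Lp.eLpNorm_ne_top f)
    (eLpNorm_le_eLpNorm_of_exponent_le (by norm_num) (Lp.aestronglyMeasurable f))

lemma norm_exp_I_mul_sub_exp_I_mul_le (a b : ℝ) :
    ‖Complex.exp (Complex.I * a) - Complex.exp (Complex.I * b)‖ ≤ ‖a - b‖ := by
  have h : Complex.exp (Complex.I * a) - Complex.exp (Complex.I * b) =
      Complex.exp (Complex.I * b) * (Complex.exp (Complex.I * (a - b : ℝ)) - 1) := by
    rw [mul_sub, ← Complex.exp_add]
    push_cast
    ring_nf
  rw [h, norm_mul, Complex.norm_exp_I_mul_ofReal, one_mul]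
  exact Real.norm_exp_I_mul_ofReal_sub_one_le

section

variable {Θ : Type*} [NormedAddCommGroup Θ] [NormedSpace ℝ Θ] [MeasurableSpace Θ] [BorelSpace Θ]
  {ι : H2 →L[ℝ] Θ} {W : Measure Θ}

lemma continuous_integral_exp_paleyWiener [IsProbabilityMeasure W] :
    Continuous fun h => ∫ θ, Complex.exp (Complex.I * (paleyWiener ι W h θ : ℝ)) ∂W := by
  have hm (f : Lp ℝ 2 W) : Integrable (fun θ => Complex.exp (Complex.I * (f θ : ℝ))) W := by
    refine Integrable.of_bound (C := 1) ?_ (.of_forall fun θ => ?_)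
    · exact (by fun_prop : Continuous fun u : ℝ => Complex.exp (Complex.I * u))
        |>.comp_aestronglyMeasurable (Lp.aestronglyMeasurable f)
    · rw [Complex.norm_exp_I_mul_ofReal]
  have hL : LipschitzWith 1 fun f : Lp ℝ 2 W => ∫ θ, Complex.exp (Complex.I * (f θ : ℝ)) ∂W := by
    refine LipschitzWith.of_dist_le_mul fun f g => ?_
    rw [NNReal.coe_one, one_mul, dist_eq_norm, dist_eq_norm, ← integral_sub (hm f) (hm g)]
    refine (norm_integral_le_of_norm_le ((Lp.memLp (f - g)).integrable (by norm_num)).norm ?_).trans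
      (integral_norm_le_norm_Lp_two (f - g))
    filter_upwards [Lp.coeFn_sub f g] with θ hθ
    rw [hθ]
    exact norm_exp_I_mul_sub_exp_I_mul_le _ _
  exact hL.continuous.comp (paleyWiener ι W).continuous

variable [CompleteSpace Θ] [TopologicalSpace.SeparableSpace Θ]

lemma integral_paleyWiener_mul (hW : IsAbstractWienerSpace ι W) (g h : H2) :
    ∫ θ, paleyWiener ι W g θ * paleyWiener ι W h θ ∂W = inner ℝ g h := by
  have h1 := (LinearIsometry.mk (paleyWiener ι W).toLinearMap (norm_paleyWiener hW)).inner_map_map h g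
  rw [real_inner_comm, ← h1, L2.inner_def]
  rfl

/-- The characteristic functional of the abstract Wiener space extends from the dual of `Θ` to all
of `H²(ℝ⁴)` by density. -/
lemma integral_exp_paleyWiener (hW : IsAbstractWienerSpace ι W) (h : H2) :
    ∫ θ, Complex.exp (Complex.I * (paleyWiener ι W h θ : ℝ)) ∂W =
      Complex.exp (-(‖h‖ : ℂ) ^ 2 / 2) := by
  have := hW.isProbabilityMeasure
  refine (denseRange_dualRepr hW.injective).induction_on h
    (isClosed_eq continuous_integral_exp_paleyWiener (by fun_prop)) fun L => ?_
  rw [← hW.charFun_eq L]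
  refine integral_congr_ae ?_
  filter_upwards [paleyWiener_dualRepr hW L] with θ hθ
  rw [hθ]

lemma map_paleyWiener (hW : IsAbstractWienerSpace ι W) (h : H2) :
    W.map (paleyWiener ι W h) = gaussianReal 0 (‖h‖₊ ^ 2) := by
  have := hW.isProbabilityMeasure
  have hm (h : H2) : AEMeasurable (paleyWiener ι W h) W :=
    (Lp.aestronglyMeasurable _).aemeasurable
  have := Measure.isProbabilityMeasure_map (hm h)
  refine Measure.ext_of_charFun (funext fun t => ?_)
  rw [charFun_apply_real, integral_map (hm h)
    (by fun_prop : Continuous fun x : ℝ => Complex.exp (t * x * Complex.I)).aestronglyMeasurable,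
    charFun_gaussianReal]
  have h1 := integral_exp_paleyWiener hW (t • h)
  have h2 : ∫ θ, Complex.exp (t * (paleyWiener ι W h θ : ℝ) * Complex.I) ∂W =
      ∫ θ, Complex.exp (Complex.I * (paleyWiener ι W (t • h) θ : ℝ)) ∂W := by
    refine integral_congr_ae ?_
    rw [map_smul]
    filter_upwards [Lp.coeFn_smul t (paleyWiener ι W h)] with θ hθ
    rw [hθ]
    simp
    ring_nf
  rw [h2, h1, norm_smul]
  congr 1
  push_cast
  rw [mul_pow, ← Complex.ofReal_pow ‖t‖, Real.norm_eq_abs, sq_abs]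
  push_cast
  ring

lemma integral_paleyWiener (hW : IsAbstractWienerSpace ι W) (h : H2) :
    ∫ θ, paleyWiener ι W h θ ∂W = 0 := by
  have hm : AEMeasurable (paleyWiener ι W h) W := (Lp.aestronglyMeasurable _).aemeasurable
  have h1 := integral_map hm (f := fun x : ℝ => x) aestronglyMeasurable_id
  rw [← h1, map_paleyWiener hW h]
  exact integral_id_gaussianReal

lemma isGaussianProcess_paleyWiener (hW : IsAbstractWienerSpace ι W) :
    IsGaussianProcess (fun (h : H2) θ => paleyWiener ι W h θ) W where
  hasGaussianLaw I := by
    classical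
    have hm : AEMeasurable (fun θ => I.restrict (fun h => paleyWiener ι W h θ)) W :=
      aemeasurable_pi_iff.2 fun h => (Lp.aestronglyMeasurable _).aemeasurable
    refine ⟨isGaussian_of_map_eq_gaussianReal fun L => ?_⟩
    -- a linear combination of Paley-Wiener integrals is again one
    set c : I → ℝ := fun i => L (Pi.single i 1) with hc
    have hLc (x : I → ℝ) : L x = ∑ i, c i * x i := by
      conv_lhs => rw [← Finset.univ_sum_single x, map_sum]
      refine Finset.sum_congr rfl fun i _ => ?_
      rw [hc, mul_comm, ← smul_eq_mul, ← map_smul, ← Pi.single_smul, smul_eq_mul, mul_one]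
    refine ⟨0, ‖∑ i : I, c i • (i : H2)‖₊ ^ 2, ?_⟩
    rw [AEMeasurable.map_map_of_aemeasurable (by fun_prop) hm, ← map_paleyWiener hW]
    refine Measure.map_congr ?_
    rw [map_sum]
    simp_rw [map_smul]
    have h1 : ∀ᵐ θ ∂W, ∀ i : I, (c i • paleyWiener ι W (i : H2)) θ = c i * paleyWiener ι W i θ :=
      ae_all_iff.2 fun i => Lp.coeFn_smul _ _
    filter_upwards [Lp.coeFn_finsetSum Finset.univ fun i : I => c i • paleyWiener ι W (i : H2), h1]
      with θ hθ1 hθ2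
    rw [hθ1, Finset.sum_apply, Function.comp_apply, hLc]
    exact Finset.sum_congr rfl fun i _ => (hθ2 i).symm

end

/-! ### Conditioning on a linear combination with an independent part -/

/-- If `Y` is `m`-measurable and `Z` is independent of `m`, then the conditional probability of
`Z + M Y ∈ A` given `m` is a function of `Y` which does not depend on `m`. -/
lemma condExp_indicator_add_mulVec {Ω : Type*} {m mΩ : MeasurableSpace Ω} {P : Measure Ω}
    [IsProbabilityMeasure P] {n : Type*} [Fintype n] (hm : m ≤ mΩ)
    {Y Z : Ω → n → ℝ} (hY : Measurable[m] Y) (hZ : Measurable Z)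
    (hind : Indep (MeasurableSpace.comap Z MeasurableSpace.pi) m P) (M : Matrix n n ℝ)
    {A : Set (n → ℝ)} (hA : MeasurableSet A) :
    P⟦(fun ω => Z ω + M.mulVec (Y ω)) ⁻¹' A | m⟧ =ᵐ[P]
      fun ω => (P.map Z).real {z | z + M.mulVec (Y ω) ∈ A} := by
  have hY' : Measurable Y := hY.mono hm le_rfl
  have hadd : Measurable fun p : (n → ℝ) × (n → ℝ) => p.1 + M.mulVec p.2 := by
    have : Continuous fun p : (n → ℝ) × (n → ℝ) => p.1 + M.mulVec p.2 := by fun_prop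
    exact this.measurable
  have hX : Measurable fun ω => Z ω + M.mulVec (Y ω) := hadd.comp (hZ.prodMk hY')
  have := Measure.isProbabilityMeasure_map (μ := P) hZ.aemeasurable
  have hκ : Measurable fun y : n → ℝ => (P.map Z).real {z | z + M.mulVec y ∈ A} := by
    have : Measurable fun y : n → ℝ => P.map Z {z | z + M.mulVec y ∈ A} :=
      measurable_measure_prodMk_right (hadd hA)
    exact this.ennreal_toReal
  symm
  refine ae_eq_condExp_of_forall_setIntegral_eq hm
    ((integrable_const (1 : ℝ)).indicator (hX hA)) (fun s _ _ => ?_) (fun s hs _ => ?_)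
    (hκ.comp hY).aestronglyMeasurable
  · exact (Integrable.of_bound (C := 1) (hκ.comp hY').aestronglyMeasurable
      (.of_forall fun ω => by
        rw [Function.comp_apply, Real.norm_of_nonneg measureReal_nonneg]
        exact measureReal_le_one)).integrableOn
  -- the law of `(Z, (Y, 1_s))` is a product
  · set Q : Ω → (n → ℝ) × ℝ := fun ω => (Y ω, s.indicator 1 ω) with hQ
    have hQm : Measurable[m] Q := hY.prodMk (stronglyMeasurable_one.indicator hs).measurable
    have hQ' : Measurable Q := hQm.mono hm le_rfl
    have hi : IndepFun Z Q P := indep_of_indep_of_le_right hind hQm.comap_le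
    have hprod := (indepFun_iff_map_prod_eq_prod_map_map hZ.aemeasurable hQ'.aemeasurable).1 hi
    have := Measure.isProbabilityMeasure_map (μ := P) hQ'.aemeasurable
    set F : (n → ℝ) × ((n → ℝ) × ℝ) → ℝ := fun p =>
      p.2.2 * A.indicator 1 (p.1 + M.mulVec p.2.1) with hF
    have hFm : Measurable F := by
      have h1 : Measurable fun p : (n → ℝ) × ((n → ℝ) × ℝ) => p.1 + M.mulVec p.2.1 :=
        hadd.comp (measurable_fst.prodMk (measurable_fst.comp measurable_snd))
      exact (measurable_snd.comp measurable_snd).mul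
        (((measurable_one (α := ℝ)).indicator hA).comp h1)
    have hFi : Integrable F ((P.map Z).prod (P.map Q)) := by
      rw [← hprod, integrable_map_measure hFm.aestronglyMeasurable (by fun_prop)]
      refine Integrable.of_bound (C := 1) (hFm.comp (hZ.prodMk hQ')).aestronglyMeasurable
        (.of_forall fun ω => ?_)
      by_cases h1 : ω ∈ s <;> by_cases h2 : Z ω + M.mulVec (Y ω) ∈ A <;> simp [hF, hQ, h1, h2]
    have e1 : ∫ ω in s, ((fun ω => Z ω + M.mulVec (Y ω)) ⁻¹' A).indicator (fun _ => (1 : ℝ)) ω ∂P =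
        ∫ ω, F (Z ω, Q ω) ∂P := by
      rw [← integral_indicator (hm s hs)]
      congr 1
      ext ω
      by_cases h1 : ω ∈ s <;> by_cases h2 : Z ω + M.mulVec (Y ω) ∈ A <;>
        simp [hF, hQ, h1, h2, Set.indicator]
    have e2 : ∫ ω, F (Z ω, Q ω) ∂P = ∫ q, ∫ z, F (z, q) ∂(P.map Z) ∂(P.map Q) := by
      rw [← integral_map (f := F) (hZ.prodMk hQ').aemeasurable hFm.aestronglyMeasurable, hprod,
        integral_prod_symm _ hFi]
    have e3 : ∀ q : (n → ℝ) × ℝ, ∫ z, F (z, q) ∂(P.map Z) =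
        q.2 * (P.map Z).real {z | z + M.mulVec q.1 ∈ A} := fun q => by
      simp only [hF]
      rw [integral_const_mul, ← integral_indicator_one
        (show MeasurableSet {z | z + M.mulVec q.1 ∈ A} from
          (hadd.comp (measurable_id.prodMk measurable_const)) hA)]
      rfl
    rw [e1, e2]
    simp_rw [e3]
    rw [integral_map (f := fun q : (n → ℝ) × ℝ => q.2 * (P.map Z).real {z | z + M.mulVec q.1 ∈ A})
      hQ'.aemeasurable (measurable_snd.mul (hκ.comp measurable_fst)).aestronglyMeasurable,
      ← integral_indicator (hm s hs)]
    congr 1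
    ext ω
    by_cases h1 : ω ∈ s <;> simp [hQ, h1]

/-! ### The spherical averages of the Gaussian free field -/

/-- The pair of representers whose Paley-Wiener integrals are the coordinates of `V_ε^x`. -/
def reprVec (x : E4) (ε : Set.Ioi (0 : ℝ)) : Fin 2 → H2 :=
  ![representer (sphereAvg x ε), representer (dSphereAvg x ε)]

lemma inner_reprVec (x y : E4) (a b : Set.Ioi (0 : ℝ)) (i j : Fin 2) :
    inner ℝ (reprVec x a i) (reprVec y b j) = gramMat x y a b i j := by
  fin_cases i <;> fin_cases j <;> simp [reprVec, gramMat, sphRepr_coe, dSphRepr_coe]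

lemma gramMat_transpose (x y : E4) (a b : ℝ) : (gramMat x y a b).transpose = gramMat y x b a := by
  ext i j
  fin_cases i <;> fin_cases j <;> simp [gramMat, real_inner_comm]

/-- The regression matrix of `V_a^x` on `V_b^x` is `B(a) B(b)⁻¹` for `a ≤ b`, and it also gives the
covariances with all the `V_c^x`, `c ≥ b`. -/
lemma gramMat_eq_mul_gramMat (x : E4) {a b c : ℝ} (ha : 0 < a) (hab : a ≤ b) (hbc : b ≤ c) :
    gramMat x x a c = matB a * (matB b)⁻¹ * gramMat x x b c := by
  have hb := ha.trans_le hab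
  rw [← gramMat_transpose x x c a, ← gramMat_transpose x x c b, gramMat_self x ha (hab.trans hbc),
    gramMat_self x hb hbc, Matrix.transpose_smul, Matrix.transpose_smul, Matrix.transpose_mul,
    Matrix.transpose_mul, Matrix.transpose_transpose, Matrix.transpose_transpose, Matrix.mul_smul,
    Matrix.mul_assoc, Matrix.nonsing_inv_mul_cancel_left _ _ (isUnit_det_matB hb)]

variable {Θ : Type*} [NormedAddCommGroup Θ] [NormedSpace ℝ Θ] [MeasurableSpace Θ] [BorelSpace Θ]
  {ι : H2 →L[ℝ] Θ} {W : Measure Θ} {V : E4 → Set.Ioi (0 : ℝ) → Θ → Fin 2 → ℝ}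

lemma ae_eq_paleyWiener_reprVec (hV : ∀ x ε, V x ε =ᵐ[W] sphereVec ι W x ε) (x : E4)
    (ε : Set.Ioi (0 : ℝ)) (i : Fin 2) :
    (fun θ => V x ε θ i) =ᵐ[W] paleyWiener ι W (reprVec x ε i) := by
  filter_upwards [hV x ε] with θ hθ
  rw [hθ]
  fin_cases i <;> rfl

variable [CompleteSpace Θ] [TopologicalSpace.SeparableSpace Θ]

lemma integral_mul_of_ae_eq_paleyWiener (hW : IsAbstractWienerSpace ι W) {X Y : Θ → ℝ} {g h : H2}
    (hX : X =ᵐ[W] paleyWiener ι W g) (hY : Y =ᵐ[W] paleyWiener ι W h) :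
    ∫ θ, X θ * Y θ ∂W = inner ℝ g h := by
  rw [← integral_paleyWiener_mul hW]
  exact integral_congr_ae (hX.mul hY)

lemma crossMoment_eq_gramMat (hW : IsAbstractWienerSpace ι W)
    (hV : ∀ x ε, V x ε =ᵐ[W] sphereVec ι W x ε) (x y : E4) (a b : Set.Ioi (0 : ℝ)) :
    crossMoment W (V x a) (V y b) = gramMat x y a b := by
  ext i j
  rw [← inner_reprVec]
  exact integral_mul_of_ae_eq_paleyWiener hW (ae_eq_paleyWiener_reprVec hV x a i)
    (ae_eq_paleyWiener_reprVec hV y b j)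

lemma isGaussianProcess_sphereVec (hW : IsAbstractWienerSpace ι W) :
    IsGaussianProcess (fun p : E4 × Set.Ioi (0 : ℝ) => sphereVec ι W p.1 p.2) W := by
  classical
  refine IsGaussianProcess.of_isGaussianProcess (isGaussianProcess_paleyWiener hW) fun p =>
    ⟨Finset.univ.image (reprVec p.1 p.2), ContinuousLinearMap.pi fun i =>
      ContinuousLinearMap.proj ⟨reprVec p.1 p.2 i, Finset.mem_image_of_mem _ (Finset.mem_univ i)⟩,
      fun θ => ?_⟩
  ext i
  fin_cases i <;> rfl

lemma integral_eq_zero_of_sphereVec (hW : IsAbstractWienerSpace ι W)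
    (hV : ∀ x ε, V x ε =ᵐ[W] sphereVec ι W x ε) (x : E4) (ε : Set.Ioi (0 : ℝ)) :
    ∫ θ, V x ε θ ∂W = 0 := by
  have := hW.isProbabilityMeasure
  ext i
  rw [eval_integral fun i => Integrable.congr ((Lp.memLp _).integrable (by norm_num))
    (ae_eq_paleyWiener_reprVec hV x ε i).symm,
    integral_congr_ae (ae_eq_paleyWiener_reprVec hV x ε i), integral_paleyWiener hW]
  rfl

/-- The innovation `V_a^x - B(a) B(b)⁻¹ V_b^x`, `a ≤ b`, is independent of all the `V_c^x` with
`c ≥ b`: it is jointly Gaussian with them and uncorrelated with each of them. -/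
lemma indep_innovation (hW : IsAbstractWienerSpace ι W) (hVmeas : ∀ x ε, Measurable (V x ε))
    (hV : ∀ x ε, V x ε =ᵐ[W] sphereVec ι W x ε) (x : E4) {a b : Set.Ioi (0 : ℝ)} (hab : a ≤ b) :
    Indep (MeasurableSpace.comap
        (fun θ => V x a θ - (matB a * (matB b)⁻¹).mulVec (V x b θ)) MeasurableSpace.pi)
      (⨆ c : Set.Ici b, MeasurableSpace.comap (V x c) MeasurableSpace.pi) W := by
  have := hW.isProbabilityMeasure
  set M := matB a * (matB b)⁻¹ with hM
  set g : Fin 2 → H2 := fun i => reprVec x a i - ∑ j, M i j • reprVec x b j with hg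
  set Z : Fin 2 → Θ → ℝ := fun i θ => (V x a θ - M.mulVec (V x b θ)) i with hZ
  set Y : Set.Ici b × Fin 2 → Θ → ℝ := fun p θ => V x p.1 θ p.2 with hY
  have hZg (i : Fin 2) : paleyWiener ι W (g i) =ᵐ[W] Z i := by
    have e : paleyWiener ι W (g i) = paleyWiener ι W (reprVec x a i) -
        (M i 0 • paleyWiener ι W (reprVec x b 0) + M i 1 • paleyWiener ι W (reprVec x b 1)) := by
      simp [hg]
    rw [e]
    filter_upwards [Lp.coeFn_sub (paleyWiener ι W (reprVec x a i))
        (M i 0 • paleyWiener ι W (reprVec x b 0) + M i 1 • paleyWiener ι W (reprVec x b 1)),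
      Lp.coeFn_add (M i 0 • paleyWiener ι W (reprVec x b 0))
        (M i 1 • paleyWiener ι W (reprVec x b 1)),
      Lp.coeFn_smul (M i 0) (paleyWiener ι W (reprVec x b 0)),
      Lp.coeFn_smul (M i 1) (paleyWiener ι W (reprVec x b 1)),
      ae_eq_paleyWiener_reprVec hV x a i, ae_eq_paleyWiener_reprVec hV x b 0,
      ae_eq_paleyWiener_reprVec hV x b 1] with θ h1 h2 h3 h4 h5 h6 h7
    rw [h1, Pi.sub_apply, h2, Pi.add_apply, h3, h4, Pi.smul_apply, Pi.smul_apply, ← h5, ← h6, ← h7]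
    fin_cases i <;> simp [hZ]
  have hYg (p : Set.Ici b × Fin 2) : paleyWiener ι W (reprVec x p.1 p.2) =ᵐ[W] Y p :=
    (ae_eq_paleyWiener_reprVec hV x p.1 p.2).symm
  have hgauss : IsGaussianProcess (Sum.elim Z Y) W := by
    refine ((isGaussianProcess_paleyWiener hW).comp_right
      (Sum.elim g fun p : Set.Ici b × Fin 2 => reprVec x p.1 p.2)).congr fun s => ?_
    rcases s with i | p
    exacts [hZg i, hYg p]
  have hZm : Measurable fun θ => V x a θ - M.mulVec (V x b θ) :=
    (hVmeas x a).sub ((by fun_prop : Continuous fun v : Fin 2 → ℝ => M.mulVec v).measurable.comp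
      (hVmeas x b))
  have hYm (p) : Measurable (Y p) := (measurable_pi_apply p.2).comp (hVmeas x p.1)
  have hind : IndepFun (fun θ i => Z i θ) (fun θ p => Y p θ) W := by
    refine hgauss.indepFun_of_covariance_eq_zero
      (fun i => ((measurable_pi_apply i).comp hZm).aemeasurable) (fun p => (hYm p).aemeasurable)
      fun i p => ?_
    have hc : (a : ℝ) ≤ b := hab
    have h1 := congrFun (congrFun (gramMat_eq_mul_gramMat x a.2 hc (c := p.1) p.1.2) i) p.2
    rw [covariance_eq_sub ((Lp.memLp _).ae_eq (hZg i)) ((Lp.memLp _).ae_eq (hYg p)),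
      integral_congr_ae (hZg i).symm, integral_paleyWiener hW, zero_mul, sub_zero]
    refine (integral_mul_of_ae_eq_paleyWiener hW (hZg i).symm (hYg p).symm).trans ?_
    rw [hg, inner_sub_left, sum_inner, sub_eq_zero, inner_reprVec, h1, Matrix.mul_apply]
    refine Finset.sum_congr rfl fun j _ => ?_
    rw [real_inner_smul_left, inner_reprVec]
  refine indep_of_indep_of_le_right hind (iSup_le fun c => ?_)
  have : V x c = (fun (y : Set.Ici b × Fin 2 → ℝ) i => y (c, i)) ∘ fun θ p => Y p θ := rfl
  rw [this, ← MeasurableSpace.comap_comp]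
  exact MeasurableSpace.comap_mono
    (measurable_pi_lambda _ fun i => measurable_pi_apply _).comap_le

/-- The reversed Markov property of `ε ↦ V_ε^x`. -/
lemma condExp_sphereVec_eq (hW : IsAbstractWienerSpace ι W) (hVmeas : ∀ x ε, Measurable (V x ε))
    (hV : ∀ x ε, V x ε =ᵐ[W] sphereVec ι W x ε) (x : E4) {a b : Set.Ioi (0 : ℝ)} (hab : a ≤ b)
    {A : Set (Fin 2 → ℝ)} (hA : MeasurableSet A) :
    W⟦V x a ⁻¹' A | ⨆ c : Set.Ici b, MeasurableSpace.comap (V x c) MeasurableSpace.pi⟧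
      =ᵐ[W] W⟦V x a ⁻¹' A | MeasurableSpace.comap (V x b) MeasurableSpace.pi⟧ := by
  have := hW.isProbabilityMeasure
  have hZm : Measurable fun θ => V x a θ - (matB a * (matB b)⁻¹).mulVec (V x b θ) :=
    (hVmeas x a).sub ((by fun_prop : Continuous fun v : Fin 2 → ℝ =>
      (matB a * (matB b)⁻¹).mulVec v).measurable.comp (hVmeas x b))
  have hind := indep_innovation hW hVmeas hV x hab
  have hle : MeasurableSpace.comap (V x b) MeasurableSpace.pi ≤
      ⨆ c : Set.Ici b, MeasurableSpace.comap (V x c) MeasurableSpace.pi :=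
    le_iSup (fun c : Set.Ici b => MeasurableSpace.comap (V x c) MeasurableSpace.pi)
      ⟨b, Set.self_mem_Ici⟩
  have h1 := condExp_indicator_add_mulVec (iSup_le fun c : Set.Ici b => (hVmeas x c).comap_le)
    ((comap_measurable (V x b)).mono hle le_rfl) hZm hind (matB a * (matB b)⁻¹) hA
  have h2 := condExp_indicator_add_mulVec (hVmeas x b).comap_le (comap_measurable (V x b)) hZm
    (indep_of_indep_of_le_right hind hle) (matB a * (matB b)⁻¹) hA
  simp only [sub_add_cancel] at h1 h2
  exact h1.trans h2.symm

end GFF4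

end

theorem lemma2p1 {Θ : Type*} [NormedAddCommGroup Θ] [NormedSpace ℝ Θ] [CompleteSpace Θ]
    [TopologicalSpace.SeparableSpace Θ] [MeasurableSpace Θ] [BorelSpace Θ]
    (ι : GFF4.H2 →L[ℝ] Θ) (W : Measure Θ) (hW : GFF4.IsAbstractWienerSpace ι W)
    (V : GFF4.E4 → Set.Ioi (0 : ℝ) → Θ → Fin 2 → ℝ)
    (hVmeas : ∀ x ε, Measurable (V x ε))
    (hV : ∀ x ε, V x ε =ᵐ[W] GFF4.sphereVec ι W x ε) :
    -- the distributions `σ_ε^x` and `dσ_ε^x` belong to `H⁻²`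
    (∀ x ε, GFF4.InHNegTwo (GFF4.sphereAvg x ε) ∧ GFF4.InHNegTwo (GFF4.dSphereAvg x ε)) ∧
    -- the vectors `V_ε^x` form a centered Gaussian family
    (IsGaussianProcess (fun p : GFF4.E4 × Set.Ioi (0 : ℝ) => V p.1 p.2) W ∧
      ∀ x ε, ∫ θ, V x ε θ ∂W = 0) ∧
    -- concentric case
    (∀ (x : GFF4.E4) (ε₁ ε₂ : Set.Ioi (0 : ℝ)), ε₂ ≤ ε₁ →
      GFF4.crossMoment W (V x ε₁) (V x ε₂) =
        (-(1 / (4 * Real.pi ^ 2))) • (GFF4.matA ε₁ * (GFF4.matB ε₂).transpose)) ∧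
    -- reversed Markov property
    (∀ (x : GFF4.E4) (ε₁ ε₂ : Set.Ioi (0 : ℝ)), ε₂ ≤ ε₁ →
      ∀ A : Set (Fin 2 → ℝ), MeasurableSet A →
        W⟦V x ε₂ ⁻¹' A | ⨆ η : Set.Ici ε₁, MeasurableSpace.comap (V x η) MeasurableSpace.pi⟧
          =ᵐ[W] W⟦V x ε₂ ⁻¹' A | MeasurableSpace.comap (V x ε₁) MeasurableSpace.pi⟧) ∧
    -- nested case
    (∀ (x y : GFF4.E4) (ε₁ ε₂ : Set.Ioi (0 : ℝ)), x ≠ y → ‖x - y‖ + (ε₂ : ℝ) < ε₁ →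
      GFF4.crossMoment W (V x ε₁) (V y ε₂) =
        (-(1 / (2 * Real.pi ^ 2))) •
          (GFF4.matA ε₁ * GFF4.matC ‖x - y‖ * (GFF4.matB ε₂).transpose)) ∧
    -- disjoint case
    (∀ (x y : GFF4.E4) (ε₁ ε₂ : Set.Ioi (0 : ℝ)), x ≠ y → (ε₁ : ℝ) + ε₂ < ‖x - y‖ →
      GFF4.crossMoment W (V x ε₁) (V y ε₂) =
        (-(1 / (2 * Real.pi ^ 2))) •
          (GFF4.matB ε₁ * GFF4.matD ‖x - y‖ * (GFF4.matB ε₂).transpose)) := by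
  refine ⟨fun x ε => ⟨GFF4.inHNegTwo_sphereAvg x ε, GFF4.inHNegTwo_dSphereAvg x ε⟩,
    ⟨(GFF4.isGaussianProcess_sphereVec hW).congr fun p => (hV p.1 p.2).symm,
      GFF4.integral_eq_zero_of_sphereVec hW hV⟩,
    fun x a b hba => ?_, fun x a b hba A hA => GFF4.condExp_sphereVec_eq hW hVmeas hV x hba hA,
    fun x y a b hxy h => ?_, fun x y a b _ h => ?_⟩
  · rw [GFF4.crossMoment_eq_gramMat hW hV, GFF4.gramMat_self x b.2 hba]
  · rw [GFF4.crossMoment_eq_gramMat hW hV, GFF4.gramMat_of_nested x y b.2 h,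
      GFF4.matC_eq (norm_pos_iff.2 (sub_ne_zero.2 hxy))]
  · rw [GFF4.crossMoment_eq_gramMat hW hV, GFF4.gramMat_of_disjoint x y a.2 b.2 h]
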